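/- Let $E\to M$ be a holomorphic vector bundle of finite rank $r$ on a complex manifold $M$, and let $\mathcal O_{\Lambda E}$ be the sheaf of holomorphic sections of $\Lambda E$. Let $End(\Lambda E)$ be the sheaf of even $\mathbb C$-linear endomorphisms of the sheaf $\mathcal O_{\Lambda E}$ and, for $k\ge 0$, let $End_{2k}(\Lambda E)$ be the subsheaf of those $f$ with $f(\mathcal O_{\Lambda^jE})\subset\mathcal O_{\Lambda^{j+2k}E}$ for all $j$, $Der_{2k}(\Lambda E)\subset End_{2k}(\Lambda E)$ the subsheaf of derivations, and $Der^{(2)}(\Lambda E)=\bigoplus_{k\ge1}Der_{2k}(\Lambda E)$. Denote by $pr_{2k}$ the projection of an endomorphism to its component of degree $2k$ and put $pr_{(2k)}=\sum_{l=1}^k pr_{2l}$. Let $G_E$ be the sheaf of groups of those automorphisms $g$ of the $\mathbb Z/2$-graded sheaf of algebras $\mathcal O_{\Lambda E}$ with $(g-Id)(\mathcal O_{\Lambda^jE})\subset\bigoplus_{k\ge1}\mathcal O_{\Lambda^{j+2k}E}$ for all $j$. The finite series $\exp$ and $\log$ are mutually inverse bijections between $Der^{(2)}(\Lambda E)$ and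 $G_E$. The group $H^0(M,Aut(E))$ of global holomorphic automorphisms of $E$ over $id_M$ acts on $\mathcal O_{\Lambda E}$, and by conjugation, written $\varphi.f=\varphi f\varphi^{-1}$, on $End(\Lambda E)$, $Der^{(2)}(\Lambda E)$ and $G_E$. Fix an open covering $\mathcal U=(U_i)$ of $M$; $C^p(\cdot)$ denotes the \v{C}ech cochains (all families indexed by $(p+1)$-tuples, no alternation required) on $\mathcal U$. For $u\in C^1(End(\Lambda E))$ and for $g=(g_{ij})$ put $(du)_{ijk}=u_{ij}+u_{jk}+u_{ki}$ and $(\mathbf dg)_{ijk}=g_{ij}g_{jk}g_{ki}$. Let $\tilde C^1$ be the set of all $u\in C^1(Der^{(2)}(\Lambda E))$ such that $\exp(u)$ is a cocycle, i.e. $\mathbf d\exp(u)=Id$. For $v\in C^0(Der^{(2)}(\Lambda E))$, $u\in C^1(Der^{(2)}(\Lambda E))$ and $q\ge2$ put $$(\exp(v).\exp(u))_{ij}=\exp(v_i)\exp(u_{ij})\exp(-v_j),\qquad \lambda(v,u)=\log(\exp(v).\exp(u)),$$ $$R_{2q}(u)=pr_{2q}\big(\mathbf d\exp(pr_{(2q-2)}(u))\big),\qquad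 F_{2q}(v,u)=Id+pr_{(2q)}\big(\exp(pr_{(2q-2)}(v)).\exp(pr_{(2q-2)}(u))-Id\big).$$ Let $D'_{2q}:\tilde C^1\to C^1(Der_{2q}(\Lambda E))$, $q\ge2$, be maps such that $D'_{2q}(u)$ depends only on $pr_{(2q-2)}(u)$ and $dD'_{2q}(u)=R_{2q}(u)$ for all $u\in\tilde C^1$. Assume that $$D'_{2q}(\lambda(v,u))=D'_{2q}(u)-pr_{2q}\big(\log F_{2q}(v,u)\big)\qquad\text{for all } q\ge2,\ v\in C^0(Der^{(2)}(\Lambda E)),\ u\in\tilde C^1 .$$ Put $D(Id,0,u)=\sum_{q\ge2}D'_{2q}(u)$ (a finite sum, since $Der_{2q}(\Lambda E)=0$ for $2q>r$). Then: (a) For $u\in\tilde C^1$ the cochain $D(Id,0,u)+u$ is a cocycle of $Der^{(2)}(\Lambda E)$, and there is exactly one map $\sigma_D:H^1(\mathcal U,G_E)\to H^1(\mathcal U,Der^{(2)}(\Lambda E))$ with $\sigma_D([\exp(u)])=[D(Id,0,u)+u]$ for all $u\in\tilde C^1$. This map is injective. If moreover $D'_{2q}(\varphi.u)=\varphi.D'_{2q}(u)$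 for all $q\ge2$, $u\in\tilde C^1$ and $\varphi\in H^0(M,Aut(E))$, then $\sigma_D$ is $H^0(M,Aut(E))$-equivariant. (b) If $\mathcal U$ computes $H^1(M,G_E)$, that is, if the canonical map from $H^1(\mathcal U,G_E)$ to the \v{C}ech cohomology $H^1(M,G_E)$ (the direct limit over all open coverings of $M$) is surjective, then the same holds on $M$: there is exactly one map $\sigma_D:H^1(M,G_E)\to H^1(M,Der^{(2)}(\Lambda E))$ with $\sigma_D([\exp(u)])=[D(Id,0,u)+u]$ for all $u\in\tilde C^1$, it is injective, and it is $H^0(M,Aut(E))$-equivariant if all the $D'_{2q}$ are. -/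

import Mathlib

open scoped Manifold ContDiff
open TopologicalSpace CategoryTheory

universe u v w t

noncomputable section

namespace HolSuper

/-! ### The exterior algebra of a vector space and its grading -/

section Algebra

variable {W W' : Type*} [AddCommGroup W] [Module ℂ W] [AddCommGroup W'] [Module ℂ W']

/-- The projection of `ΛW` onto its component `Λ^j W`. -/
def extProj (j : ℕ) : ExteriorAlgebra ℂ W →ₗ[ℂ] ExteriorAlgebra ℂ W :=
  GradedAlgebra.proj (fun i : ℕ => ⋀[ℂ]^i W) j

theorem extProj_mem (j : ℕ) (a : ExteriorAlgebra ℂ W) : extProj j a ∈ ⋀[ℂ]^j W := by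
  simp [extProj, GradedAlgebra.proj_apply]

theorem extProj_of_mem {i : ℕ} (j : ℕ) {a : ExteriorAlgebra ℂ W} (ha : a ∈ ⋀[ℂ]^i W) :
    extProj j a = if j = i then a else 0 := by
  simp only [extProj, GradedAlgebra.proj_apply]
  split_ifs with h
  · subst h
    exact DirectSum.decompose_of_mem_same (fun i : ℕ => ⋀[ℂ]^i W) ha
  · exact DirectSum.decompose_of_mem_ne (fun i : ℕ => ⋀[ℂ]^i W) ha (Ne.symm h)

theorem extProj_extProj (i j : ℕ) (a : ExteriorAlgebra ℂ W) :
    extProj j (extProj i a) = if j = i then extProj i a else 0 :=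
  extProj_of_mem j (extProj_mem i a)

theorem map_mem_exteriorPower (f : W →ₗ[ℂ] W') {i : ℕ} {a : ExteriorAlgebra ℂ W}
    (ha : a ∈ ⋀[ℂ]^i W) : ExteriorAlgebra.map f a ∈ ⋀[ℂ]^i W' := by
  have h : Submodule.map (ExteriorAlgebra.map f).toLinearMap (⋀[ℂ]^i W) ≤ ⋀[ℂ]^i W' := by
    rw [← ExteriorAlgebra.ιMulti_span_fixedDegree, Submodule.map_span, Submodule.span_le]
    rintro _ ⟨_, ⟨m, rfl⟩, rfl⟩
    rw [AlgHom.toLinearMap_apply, ExteriorAlgebra.map_apply_ιMulti]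
    exact ExteriorAlgebra.ιMulti_range ℂ i ⟨_, rfl⟩
  exact h (Submodule.mem_map_of_mem ha)

theorem extProj_decomp_induction {C : ExteriorAlgebra ℂ W → Prop} (a : ExteriorAlgebra ℂ W)
    (h : ∀ i, ∀ b ∈ ⋀[ℂ]^i W, C b) (hadd : ∀ b c, C b → C c → C (b + c)) : C a := by
  induction a using DirectSum.Decomposition.inductionOn (fun i : ℕ => ⋀[ℂ]^i W) with
  | zero => exact h 0 0 (zero_mem _)
  | homogeneous b => exact h _ _ b.2
  | add b c hb hc => exact hadd b c hb hc

theorem extProj_map (f : W →ₗ[ℂ] W') (j : ℕ) (a : ExteriorAlgebra ℂ W) :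
    extProj j (ExteriorAlgebra.map f a) = ExteriorAlgebra.map f (extProj j a) := by
  induction a using extProj_decomp_induction with
  | h i b hb =>
    rw [extProj_of_mem j (map_mem_exteriorPower f hb), extProj_of_mem j hb]
    split_ifs <;> simp
  | hadd b c hb hc => simp only [map_add, hb, hc]

theorem extProj_eq_zero [FiniteDimensional ℂ W] {j : ℕ} (hj : Module.finrank ℂ W < j)
    (a : ExteriorAlgebra ℂ W) : extProj j a = 0 := by
  have h : Module.finrank ℂ (⋀[ℂ]^j W) = 0 := by
    rw [exteriorPower.finrank_eq, Nat.choose_eq_zero_of_lt hj]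
  have h' := Module.finrank_zero_iff.1 h
  have := Subsingleton.elim (⟨_, extProj_mem j a⟩ : ⋀[ℂ]^j W) 0
  exact congrArg Subtype.val this

theorem sum_extProj [FiniteDimensional ℂ W] (a : ExteriorAlgebra ℂ W) :
    ∑ j ∈ Finset.range (Module.finrank ℂ W + 1), extProj j a = a := by
  induction a using extProj_decomp_induction with
  | h i b hb =>
    simp only [extProj_of_mem _ hb, Finset.sum_ite_eq', Finset.mem_range]
    split_ifs with h
    · rfl
    · have := extProj_eq_zero (j := i) (by omega) b
      rwa [extProj_of_mem _ hb, if_pos rfl, eq_comm] at this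
  | hadd b c hb hc => simp only [map_add, Finset.sum_add_distrib, hb, hc]

theorem finite_exteriorAlgebra [FiniteDimensional ℂ W] :
    FiniteDimensional ℂ (ExteriorAlgebra ℂ W) :=
  Module.Finite.of_basis (Module.finBasis ℂ W).ExteriorAlgebra

end Algebra

/-! ### Holomorphic functions with values in an exterior algebra -/

section HolAt

variable (B : Type t) [NormedAddCommGroup B] [NormedSpace ℂ B]
variable {N : Type*} [TopologicalSpace N] [ChartedSpace B N]
variable {F : Type v} [NormedAddCommGroup F] [NormedSpace ℂ F]

/-- A function on a complex manifold with values in the finite-dimensional space `ΛF` is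
holomorphic near `x` if all its coordinates (its compositions with linear forms) are. -/
def HolAt (f : N → ExteriorAlgebra ℂ F) (x : N) : Prop :=
  ∀ l : Module.Dual ℂ (ExteriorAlgebra ℂ F),
    ContMDiffAt 𝓘(ℂ, B) 𝓘(ℂ, ℂ) ω (fun y => l (f y)) x

variable {B}

theorem HolAt.linear {f : N → ExteriorAlgebra ℂ F} {x : N} (hf : HolAt B f x)
    (p : ExteriorAlgebra ℂ F →ₗ[ℂ] ExteriorAlgebra ℂ F) : HolAt B (fun y => p (f y)) x :=
  fun l => hf (l ∘ₗ p)

theorem holAt_const (a : ExteriorAlgebra ℂ F) (x : N) : HolAt B (fun _ : N => a) x :=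
  fun _ => contMDiffAt_const

theorem HolAt.add {f g : N → ExteriorAlgebra ℂ F} {x : N} (hf : HolAt B f x)
    (hg : HolAt B g x) : HolAt B (fun y => f y + g y) x := fun l => by
  simp only [map_add]
  exact (hf l).add (hg l)

theorem HolAt.smul {f : N → ExteriorAlgebra ℂ F} {c : N → ℂ} {x : N}
    (hc : ContMDiffAt 𝓘(ℂ, B) 𝓘(ℂ, ℂ) ω c x) (hf : HolAt B f x) :
    HolAt B (fun y => c y • f y) x := fun l => by
  simp only [map_smul]
  exact hc.smul (hf l)

theorem HolAt.sum {ι : Type*} (s : Finset ι) {f : ι → N → ExteriorAlgebra ℂ F} {x : N}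
    (hf : ∀ i ∈ s, HolAt B (f i) x) : HolAt B (fun y => ∑ i ∈ s, f i y) x := by
  classical
  induction s using Finset.induction_on with
  | empty => simpa using holAt_const 0 x
  | insert i s hi ih =>
    simp only [Finset.sum_insert hi]
    exact (hf i (by simp)).add (ih fun j hj => hf j (by simp [hj]))

theorem HolAt.congr {f g : N → ExteriorAlgebra ℂ F} {x : N} (hf : HolAt B f x)
    (h : ∀ᶠ y in nhds x, g y = f y) : HolAt B g x := fun l =>
  (hf l).congr_of_eventuallyEq (h.mono fun y hy => by simp only [hy])

/-- If `T y` is linear, `y ↦ T y a` is holomorphic for every `a` and `f` is holomorphic, then so is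
`y ↦ T y (f y)`. -/
theorem HolAt.apply [FiniteDimensional ℂ F] {f : N → ExteriorAlgebra ℂ F}
    {T : N → ExteriorAlgebra ℂ F →ₗ[ℂ] ExteriorAlgebra ℂ F} {x : N}
    (hT : ∀ a, HolAt B (fun y => T y a) x) (hf : HolAt B f x) :
    HolAt B (fun y => T y (f y)) x := by
  have := finite_exteriorAlgebra (W := F)
  let b := Module.finBasis ℂ (ExteriorAlgebra ℂ F)
  have h : (fun y => T y (f y)) = fun y => ∑ i, b.coord i (f y) • T y (b i) := by
    funext y
    conv_lhs => rw [← b.sum_repr (f y)]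
    simp only [map_sum, map_smul, Module.Basis.coord_apply]
  rw [h]
  exact HolAt.sum _ fun i _ => HolAt.smul (hf _) (hT _)

theorem HolAt.mul [FiniteDimensional ℂ F] {f g : N → ExteriorAlgebra ℂ F} {x : N}
    (hf : HolAt B f x) (hg : HolAt B g x) : HolAt B (fun y => f y * g y) x :=
  HolAt.apply (T := fun y => LinearMap.mulLeft ℂ (f y))
    (fun a => hf.linear (LinearMap.mulRight ℂ a)) hg

theorem HolAt.map [FiniteDimensional ℂ F] {f : N → ExteriorAlgebra ℂ F}
    {A : N → F →ₗ[ℂ] F} {x : N}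
    (hA : ∀ c, ContMDiffAt 𝓘(ℂ, B) 𝓘(ℂ, F) ω (fun y => A y c) x) (hf : HolAt B f x) :
    HolAt B (fun y => ExteriorAlgebra.map (A y) (f y)) x := by
  refine HolAt.apply (T := fun y => (ExteriorAlgebra.map (A y)).toLinearMap) (fun a => ?_) hf
  simp only [AlgHom.toLinearMap_apply]
  induction a using ExteriorAlgebra.induction with
  | algebraMap r => simpa using holAt_const (algebraMap ℂ _ r) x
  | ι c =>
    intro l
    simp only [ExteriorAlgebra.map_apply_ι]
    have h : ContMDiffAt 𝓘(ℂ, F) 𝓘(ℂ, ℂ) ω (fun z : F => l (ExteriorAlgebra.ι ℂ z)) (A x c) :=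
      (LinearMap.toContinuousLinearMap (l ∘ₗ ExteriorAlgebra.ι ℂ)).contMDiff.contMDiffAt
    exact ContMDiffAt.comp (g := fun z : F => l (ExteriorAlgebra.ι ℂ z)) x h (hA c)
  | mul a b ha hb => simpa using ha.mul hb
  | add a b ha hb => simpa using ha.add hb

end HolAt

/-! ### The sheaf `𝒪_ΛE` of holomorphic sections of `ΛE` -/

section Bundle

variable (B : Type t) [NormedAddCommGroup B] [NormedSpace ℂ B]
variable {M : Type u} [TopologicalSpace M] [ChartedSpace B M]
variable (F : Type v) [NormedAddCommGroup F] [NormedSpace ℂ F] [FiniteDimensional ℂ F]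
variable (E : M → Type w) [∀ x, AddCommGroup (E x)] [∀ x, Module ℂ (E x)]
  [∀ x, TopologicalSpace (E x)] [TopologicalSpace (Bundle.TotalSpace F E)]
  [FiberBundle F E] [VectorBundle ℂ F E]

/-- The fibrewise map `ΛE_x → ΛF` induced by the local trivialization of `E` at `x₀`. -/
def trivΛ (x₀ x : M) : ExteriorAlgebra ℂ (E x) →ₐ[ℂ] ExteriorAlgebra ℂ F :=
  ExteriorAlgebra.map ((trivializationAt F E x₀).linearMapAt ℂ x)

/-- The holomorphic sections of `ΛE` over the open set `V`, i.e. those which are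
holomorphic in the local trivializations of `ΛE` induced by those of `E`, as a subalgebra of all
sections. -/
def secSubalgebra (V : Opens M) : Subalgebra ℂ (∀ x : V, ExteriorAlgebra ℂ (E x)) where
  carrier := {s | ∀ x₀ : V, HolAt B (fun x : V => trivΛ F E x₀ x (s x)) x₀}
  mul_mem' := fun {a b} ha hb x₀ => by
    simpa only [Pi.mul_apply, map_mul] using (ha x₀).mul (hb x₀)
  add_mem' := fun {a b} ha hb x₀ => by
    simpa only [Pi.add_apply, map_add] using (ha x₀).add (hb x₀)
  algebraMap_mem' := fun r x₀ => by
    simpa only [Pi.algebraMap_apply, AlgHom.commutes] using holAt_const _ x₀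

/-- The algebra `𝒪_ΛE(V)` of holomorphic sections of `ΛE` over the open set `V`. -/
def Sec (V : Opens M) : Type (max u w) := secSubalgebra B F E V

instance (V : Opens M) : Ring (Sec B F E V) := inferInstanceAs (Ring (secSubalgebra B F E V))

instance (V : Opens M) : Algebra ℂ (Sec B F E V) :=
  inferInstanceAs (Algebra ℂ (secSubalgebra B F E V))

variable {F E}

/-- Restriction of sections. -/
def resSec {V' V : Opens M} (h : V' ≤ V) : Sec B F E V →ₐ[ℂ] Sec B F E V' where
  toFun s := ⟨fun x => s.1 ⟨x.1, h x.2⟩, fun x₀ l =>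
    ContMDiffAt.comp (I' := 𝓘(ℂ, B))
      (g := fun x : V => l (trivΛ F E x₀ x (s.1 x))) (f := Opens.inclusion h) x₀
      (s.2 ⟨x₀.1, h x₀.2⟩ l) (contMDiff_inclusion h).contMDiffAt⟩
  map_one' := rfl
  map_mul' _ _ := rfl
  map_zero' := rfl
  map_add' _ _ := rfl
  commutes' _ := rfl

/-- The projection of `𝒪_ΛE(V)` onto `𝒪_{Λ^j E}(V)`. -/
def projSec (j : ℕ) (V : Opens M) : Sec B F E V →ₗ[ℂ] Sec B F E V where
  toFun s := ⟨fun x => extProj j (s.1 x), fun x₀ => by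
    simpa only [trivΛ, extProj_map] using (s.2 x₀).linear (extProj j)⟩
  map_add' s t := Subtype.ext (funext fun x => map_add (extProj j) (s.1 x) (t.1 x))
  map_smul' c s := Subtype.ext (funext fun x => map_smul (extProj j) c (s.1 x))

variable (F E)

/-- The sections over `V` of the direct sum of the sheaves `𝒪_{Λ^j E}`, `j ∈ S`. -/
def degPart (S : Set ℕ) (V : Opens M) : Submodule ℂ (Sec B F E V) where
  carrier := {s | ∀ j ∉ S, projSec B j V s = 0}
  add_mem' := fun ha hb j hj => by rw [map_add, ha j hj, hb j hj, add_zero]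
  zero_mem' := fun _ _ => map_zero _
  smul_mem' := fun c s hs j hj => by rw [map_smul, hs j hj, smul_zero]

/-! ### The sheaves of endomorphisms, derivations and automorphisms -/

/-- The even `ℂ`-linear endomorphisms of the sheaf `𝒪_ΛE` restricted to `U`: families of linear
maps `𝒪_ΛE(V) → 𝒪_ΛE(V)`, `V ⊆ U` open, which commute with restrictions and preserve the even and
the odd part. -/
def endSubalgebra (U : Opens M) :
    Subalgebra ℂ (∀ V : {V : Opens M // V ≤ U}, Module.End ℂ (Sec B F E V.1)) where
  carrier := {f |
    (∀ (V V' : {V : Opens M // V ≤ U}) (h : V'.1 ≤ V.1) (s : Sec B F E V.1),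
      resSec B h (f V s) = f V' (resSec B h s)) ∧
    ∀ (V : {V : Opens M // V ≤ U}) (p : ℕ), ∀ s ∈ degPart B F E {j | j % 2 = p} V.1,
      f V s ∈ degPart B F E {j | j % 2 = p} V.1}
  mul_mem' := fun {a b} ha hb =>
    ⟨fun V V' h s => by
      rw [Pi.mul_apply, Pi.mul_apply, Module.End.mul_apply, Module.End.mul_apply, ha.1 V V' h,
        hb.1 V V' h],
    fun V p s hs => ha.2 V p _ (hb.2 V p s hs)⟩
  add_mem' := fun {a b} ha hb =>
    ⟨fun V V' h s => by
      rw [Pi.add_apply, Pi.add_apply, LinearMap.add_apply, LinearMap.add_apply, map_add,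
        ha.1 V V' h, hb.1 V V' h],
    fun V p s hs => add_mem (ha.2 V p s hs) (hb.2 V p s hs)⟩
  algebraMap_mem' := fun r =>
    ⟨fun V V' h s => map_smul (resSec B h) r s,
    fun V p s hs => Submodule.smul_mem _ r hs⟩

/-- The algebra `End(ΛE)(U)` of even `ℂ`-linear endomorphisms of `𝒪_ΛE` over `U`. -/
def EndΛ (U : Opens M) : Type (max u w) := endSubalgebra B F E U

instance (U : Opens M) : Ring (EndΛ B F E U) := inferInstanceAs (Ring (endSubalgebra B F E U))

instance (U : Opens M) : Algebra ℂ (EndΛ B F E U) :=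
  inferInstanceAs (Algebra ℂ (endSubalgebra B F E U))

variable {B F E}

/-- The action of an endomorphism of `𝒪_ΛE` over `U` on the sections over `V ⊆ U`. -/
def EndΛ.app {U : Opens M} (f : EndΛ B F E U) {V : Opens M} (h : V ≤ U) :
    Sec B F E V →ₗ[ℂ] Sec B F E V := f.1 ⟨V, h⟩

theorem EndΛ.ext {U : Opens M} {f g : EndΛ B F E U}
    (H : ∀ (V : Opens M) (h : V ≤ U) (s : Sec B F E V), f.app h s = g.app h s) : f = g :=
  Subtype.ext (funext fun V => LinearMap.ext fun s => H V.1 V.2 s)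

section app

variable {U V : Opens M} (h : V ≤ U) (f g : EndΛ B F E U) (s : Sec B F E V)

theorem EndΛ.app_add : (f + g).app h s = f.app h s + g.app h s := rfl
theorem EndΛ.app_mul : (f * g).app h s = f.app h (g.app h s) := rfl
theorem EndΛ.app_one : (1 : EndΛ B F E U).app h s = s := rfl
theorem EndΛ.app_zero : (0 : EndΛ B F E U).app h s = 0 := rfl
theorem EndΛ.app_neg : (-f).app h s = -f.app h s := rfl
theorem EndΛ.app_sub : (f - g).app h s = f.app h s - g.app h s := by
  rw [sub_eq_add_neg, EndΛ.app_add, EndΛ.app_neg, sub_eq_add_neg]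
theorem EndΛ.app_smul (c : ℂ) : (c • f).app h s = c • f.app h s := rfl

end app

variable (B)

/-- Restriction of endomorphisms of `𝒪_ΛE` to smaller open sets. -/
def resEnd {U' U : Opens M} (h : U' ≤ U) : EndΛ B F E U →ₐ[ℂ] EndΛ B F E U' where
  toFun f := ⟨fun V => f.1 ⟨V.1, V.2.trans h⟩,
    fun V V' => f.2.1 ⟨V.1, V.2.trans h⟩ ⟨V'.1, V'.2.trans h⟩,
    fun V => f.2.2 ⟨V.1, V.2.trans h⟩⟩
  map_one' := rfl
  map_mul' _ _ := rfl
  map_zero' := rfl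
  map_add' _ _ := rfl
  commutes' _ := rfl

variable (F E)

/-- `End_{2k}(ΛE)(U)`: the endomorphisms which map `𝒪_{Λ^j E}` to `𝒪_{Λ^{j+2k} E}` for all `j`. -/
def EndDeg (k : ℕ) (U : Opens M) : Submodule ℂ (EndΛ B F E U) where
  carrier := {f | ∀ (V : Opens M) (h : V ≤ U) (j : ℕ), ∀ s ∈ degPart B F E {j} V,
    f.app h s ∈ degPart B F E {j + 2 * k} V}
  add_mem' := fun ha hb V h j s hs => add_mem (ha V h j s hs) (hb V h j s hs)
  zero_mem' := fun _ _ _ _ _ => zero_mem _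
  smul_mem' := fun c _ hf V h j s hs => Submodule.smul_mem _ c (hf V h j s hs)

/-- `Der_{2k}(ΛE)(U)`: the derivations of `𝒪_ΛE` over `U` which lie in `End_{2k}(ΛE)(U)`. -/
def DerDeg (k : ℕ) (U : Opens M) : Submodule ℂ (EndΛ B F E U) where
  carrier := {f | f ∈ EndDeg B F E k U ∧ ∀ (V : Opens M) (h : V ≤ U) (s s' : Sec B F E V),
    f.app h (s * s') = f.app h s * s' + s * f.app h s'}
  add_mem' := fun ha hb => ⟨add_mem ha.1 hb.1, fun V h s s' => by
    rw [EndΛ.app_add, EndΛ.app_add, EndΛ.app_add, ha.2, hb.2, add_mul, mul_add]; abel⟩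
  zero_mem' := ⟨zero_mem _, fun V h s s' => by
    rw [EndΛ.app_zero, EndΛ.app_zero, EndΛ.app_zero, zero_mul, mul_zero, add_zero]⟩
  smul_mem' := fun c f hf => ⟨Submodule.smul_mem _ c hf.1, fun V h s s' => by
    rw [EndΛ.app_smul, EndΛ.app_smul, EndΛ.app_smul, hf.2, smul_add, smul_mul_assoc,
      mul_smul_comm]⟩

/-- `Der^{(2)}(ΛE)(U) = ⨁_{k ≥ 1} Der_{2k}(ΛE)(U)`. -/
def Der2 (U : Opens M) : Submodule ℂ (EndΛ B F E U) :=
  ⨆ (k : ℕ) (_ : 1 ≤ k), DerDeg B F E k U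

/-- `Aut(ΛE)(U)`: the automorphisms of the `ℤ/2`-graded sheaf of algebras `𝒪_ΛE` over `U`. -/
def AutΛ (U : Opens M) : Subgroup (EndΛ B F E U)ˣ where
  carrier := {g | ∀ (V : Opens M) (h : V ≤ U), g.1.app h 1 = 1 ∧
    ∀ s s' : Sec B F E V, g.1.app h (s * s') = g.1.app h s * g.1.app h s'}
  mul_mem' := fun {a b} ha hb V h => by
    refine ⟨?_, fun s s' => ?_⟩
    · rw [Units.val_mul, EndΛ.app_mul, (hb V h).1, (ha V h).1]
    · rw [Units.val_mul, EndΛ.app_mul, (hb V h).2, (ha V h).2, EndΛ.app_mul, EndΛ.app_mul]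
  one_mem' := fun _ _ => ⟨rfl, fun _ _ => rfl⟩
  inv_mem' := fun {g} hg V h => by
    have h1 : ∀ s, g⁻¹.1.app h (g.1.app h s) = s := fun s => by
      rw [← EndΛ.app_mul, Units.inv_mul, EndΛ.app_one]
    have h2 : ∀ s, g.1.app h (g⁻¹.1.app h s) = s := fun s => by
      rw [← EndΛ.app_mul, Units.mul_inv, EndΛ.app_one]
    refine ⟨?_, fun s s' => ?_⟩
    · conv_lhs => rw [← (hg V h).1]
      exact h1 1
    · conv_lhs => rw [← h2 s, ← h2 s', ← (hg V h).2]
      exact h1 _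

/-- The endomorphisms of `𝒪_ΛE` over `U` mapping `𝒪_{Λ^j E}` to `⨁_{k ≥ 1} 𝒪_{Λ^{j+2k} E}`
for all `j`. -/
def EndGe2 (U : Opens M) : Submodule ℂ (EndΛ B F E U) where
  carrier := {f | ∀ (V : Opens M) (h : V ≤ U) (j : ℕ), ∀ s ∈ degPart B F E {j} V,
    f.app h s ∈ degPart B F E {i | ∃ k, 1 ≤ k ∧ i = j + 2 * k} V}
  add_mem' := fun ha hb V h j s hs => add_mem (ha V h j s hs) (hb V h j s hs)
  zero_mem' := fun _ _ _ _ _ => zero_mem _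
  smul_mem' := fun c _ hf V h j s hs => Submodule.smul_mem _ c (hf V h j s hs)

variable {B F E}

theorem finrank_fiber (x : M) :
    FiniteDimensional ℂ (E x) ∧ Module.finrank ℂ (E x) = Module.finrank ℂ F := by
  have e : E x ≃ₗ[ℂ] F := (Bundle.Trivialization.continuousLinearEquivAt ℂ (trivializationAt F E x)
    x (FiberBundle.mem_baseSet_trivializationAt' x)).toLinearEquiv
  exact ⟨Module.Finite.equiv e.symm, e.finrank_eq⟩

theorem sum_projSec (V : Opens M) (s : Sec B F E V) :
    ∑ j ∈ Finset.range (Module.finrank ℂ F + 1), projSec B j V s = s := by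
  apply Subtype.ext
  funext x
  have := (finrank_fiber (F := F) (E := E) x.1).1
  have h := sum_extProj (s.1 x)
  rw [(finrank_fiber (F := F) (E := E) x.1).2] at h
  refine Eq.trans ?_ h
  refine (congrFun (AddSubmonoidClass.coe_finsetSum (S := secSubalgebra B F E V) _ _) x).trans ?_
  rw [Finset.sum_apply]
  rfl

theorem projSec_projSec (i j : ℕ) (V : Opens M) (s : Sec B F E V) :
    projSec B j V (projSec B i V s) = if j = i then projSec B i V s else 0 := by
  apply Subtype.ext
  funext x
  refine (extProj_extProj i j (s.1 x)).trans ?_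
  split_ifs <;> rfl

theorem projSec_mem (j : ℕ) (V : Opens M) (s : Sec B F E V) :
    projSec B j V s ∈ degPart B F E {j} V := fun i hi => by
  rw [projSec_projSec, if_neg (by simpa using hi)]

theorem degPart_mono {S T : Set ℕ} (h : S ⊆ T) (V : Opens M) :
    degPart B F E S V ≤ degPart B F E T V := fun _ hs j hj => hs j fun h' => hj (h h')

theorem projSec_mem_of_mem {S : Set ℕ} {V : Opens M} {s : Sec B F E V}
    (hs : s ∈ degPart B F E S V) (j : ℕ) : projSec B j V s ∈ degPart B F E S V := by
  by_cases hj : j ∈ S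
  · exact degPart_mono (by simpa using hj) V (projSec_mem j V s)
  · rw [hs j hj]
    exact zero_mem _

theorem EndGe2.apply_mem {U : Opens M} {f : EndΛ B F E U} (hf : f ∈ EndGe2 B F E U)
    {S T : Set ℕ} (hST : ∀ j ∈ S, ∀ k, 1 ≤ k → j + 2 * k ∈ T) {V : Opens M} (h : V ≤ U)
    {s : Sec B F E V} (hs : s ∈ degPart B F E S V) : f.app h s ∈ degPart B F E T V := by
  rw [← sum_projSec V s, map_sum]
  refine sum_mem fun j _ => ?_
  by_cases hj : j ∈ S
  · refine degPart_mono ?_ _ (hf V h j _ (projSec_mem j V s))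
    rintro _ ⟨k, hk, rfl⟩
    exact hST j hj k hk
  · rw [hs j hj, map_zero]
    exact zero_mem _

theorem EndGe2.mul_mem {U : Opens M} {f g : EndΛ B F E U} (hf : f ∈ EndGe2 B F E U)
    (hg : g ∈ EndGe2 B F E U) : f * g ∈ EndGe2 B F E U := fun V h j s hs =>
  EndGe2.apply_mem hf (by rintro _ ⟨k, hk, rfl⟩ k' hk'; exact ⟨k + k', by omega, by omega⟩) h
    (hg V h j s hs)

theorem EndGe2.isNilpotent {U : Opens M} {f : EndΛ B F E U} (hf : f ∈ EndGe2 B F E U) :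
    IsNilpotent f := by
  have key : ∀ (n : ℕ) (V : Opens M) (h : V ≤ U) (s : Sec B F E V),
      (f ^ n).app h s ∈ degPart B F E {i | n ≤ i} V := by
    intro n
    induction n with
    | zero => exact fun V h s j hj => absurd (Nat.zero_le j) hj
    | succ n ih =>
      intro V h s
      rw [pow_succ', EndΛ.app_mul]
      refine EndGe2.apply_mem hf (S := {i | n ≤ i}) ?_ h (ih V h s)
      intro j hj k hk
      change n ≤ j at hj
      change n + 1 ≤ j + 2 * k
      omega
  refine ⟨Module.finrank ℂ F + 1, EndΛ.ext fun V h s => ?_⟩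
  rw [← sum_projSec V ((f ^ (Module.finrank ℂ F + 1)).app h s)]
  refine Finset.sum_eq_zero fun j hj => key _ V h s j ?_
  simp only [Finset.mem_range] at hj
  simpa using hj

theorem EndGe2.inv_mem {U : Opens M} {g : (EndΛ B F E U)ˣ} (hg : g.1 - 1 ∈ EndGe2 B F E U) :
    g⁻¹.1 - 1 ∈ EndGe2 B F E U := by
  obtain ⟨N, hN⟩ := EndGe2.isNilpotent hg
  have h1 : g⁻¹.1 = ∑ i ∈ Finset.range N, (-(g.1 - 1)) ^ i := by
    have h := mul_neg_geom_sum (-(g.1 - 1)) N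
    rw [neg_pow, hN, mul_zero, sub_zero, sub_neg_eq_add, add_sub_cancel] at h
    exact Units.inv_eq_of_mul_eq_one_right h
  have h2 : ∀ i, (-(g.1 - 1)) ^ (i + 1) ∈ EndGe2 B F E U := by
    intro i
    induction i with
    | zero => simpa using neg_mem hg
    | succ i ih => rw [pow_succ]; exact EndGe2.mul_mem ih (neg_mem hg)
  cases N with
  | zero =>
    have h0 : (1 : EndΛ B F E U) = 0 := by simpa using hN
    have : g⁻¹.1 - 1 = 0 := by rw [← mul_one (g⁻¹.1 - 1), h0, mul_zero]
    rw [this]; exact zero_mem _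
  | succ N =>
    rw [h1, Finset.sum_range_succ', pow_zero, add_sub_cancel_right]
    exact sum_mem fun i _ => h2 i

variable (B F E)

/-- `G_E(U)`: the automorphisms `g ∈ Aut(ΛE)(U)` such that `g - Id` maps `𝒪_{Λ^j E}` to
`⨁_{k ≥ 1} 𝒪_{Λ^{j+2k} E}` for all `j`. -/
def GE (U : Opens M) : Subgroup (EndΛ B F E U)ˣ where
  carrier := {g | g ∈ AutΛ B F E U ∧ g.1 - 1 ∈ EndGe2 B F E U}
  mul_mem' := fun {a b} ha hb => ⟨mul_mem ha.1 hb.1, by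
    have h : (a * b).1 - 1 = (a.1 - 1) * (b.1 - 1) + (a.1 - 1) + (b.1 - 1) := by
      rw [Units.val_mul]; noncomm_ring
    rw [h]
    exact add_mem (add_mem (EndGe2.mul_mem ha.2 hb.2) ha.2) hb.2⟩
  one_mem' := ⟨one_mem _, by rw [Units.val_one, sub_self]; exact zero_mem _⟩
  inv_mem' := fun hg => ⟨inv_mem hg.1, EndGe2.inv_mem hg.2⟩

variable {B F E}

theorem resEnd_mem_Der2 {U' U : Opens M} (h : U' ≤ U) {f : EndΛ B F E U}
    (hf : f ∈ Der2 B F E U) : resEnd B h f ∈ Der2 B F E U' := by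
  have h' : Der2 B F E U ≤ (Der2 B F E U').comap (resEnd B h).toLinearMap := by
    refine iSup₂_le fun k hk g hg => ?_
    refine Submodule.mem_iSup_of_mem k (Submodule.mem_iSup_of_mem hk ?_)
    exact ⟨fun V hV => hg.1 V (hV.trans h), fun V hV => hg.2 V (hV.trans h)⟩
  exact h' hf

theorem resEnd_mem_GE {U' U : Opens M} (h : U' ≤ U) {g : (EndΛ B F E U)ˣ}
    (hg : g ∈ GE B F E U) : Units.map (resEnd B h).toMonoidHom g ∈ GE B F E U' :=
  ⟨fun V hV => hg.1 V (hV.trans h), fun V hV => hg.2 V (hV.trans h)⟩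

variable (B F E)

/-- The sheaf of groups `G_E`. -/
def GESheaf : (Opens M)ᵒᵖ ⥤ GrpCat.{max u w} where
  obj U := GrpCat.of (GE B F E U.unop)
  map a := GrpCat.ofHom
    { toFun := fun g => ⟨_, resEnd_mem_GE (leOfHom a.unop) g.2⟩
      map_one' := rfl
      map_mul' := fun _ _ => rfl }
  map_id _ := rfl
  map_comp _ _ := rfl

/-- The sheaf of abelian groups `Der^{(2)}(ΛE)`, written multiplicatively. -/
def Der2Sheaf : (Opens M)ᵒᵖ ⥤ GrpCat.{max u w} where
  obj U := GrpCat.of (Multiplicative (Der2 B F E U.unop))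
  map a := GrpCat.ofHom (AddMonoidHom.toMultiplicative
    { toFun := fun f => ⟨_, resEnd_mem_Der2 (leOfHom a.unop) f.2⟩
      map_zero' := rfl
      map_add' := fun _ _ => rfl })
  map_id _ := rfl
  map_comp _ _ := rfl

/-! ### Projections, exponential and logarithm -/

/-- The projection of `𝒪_ΛE` onto `𝒪_{Λ^j E}`, as an endomorphism over `U`. -/
def proj (j : ℕ) (U : Opens M) : EndΛ B F E U :=
  ⟨fun V => projSec B j V.1, fun _ _ _ _ => rfl, fun _ _ _ hs => projSec_mem_of_mem hs j⟩

variable {B F E}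
variable {U : Opens M}

/-- `pr_{2k}`: the component of degree `2k` of an endomorphism; it maps `𝒪_{Λ^j E}` to
`𝒪_{Λ^{j+2k} E}` for all `j`. Here `j` runs through the degrees `0, …, rank E`. -/
def pr (k : ℕ) (f : EndΛ B F E U) : EndΛ B F E U :=
  ∑ j ∈ Finset.range (Module.finrank ℂ F + 1), proj B F E (j + 2 * k) U * f * proj B F E j U

/-- `pr_{(2k)}`: the sum of the components of degree `2, 4, …, 2k`. -/
def prLe (k : ℕ) (f : EndΛ B F E U) : EndΛ B F E U := ∑ l ∈ Finset.Icc 1 k, pr l f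

/-- The exponential series, on endomorphisms raising degrees by at least `2`; the `n`-th power of
such an endomorphism vanishes for `n > rank E`. -/
def expΛ (f : EndΛ B F E U) : EndΛ B F E U :=
  ∑ n ∈ Finset.range (Module.finrank ℂ F + 1), ((n.factorial : ℂ)⁻¹) • f ^ n

/-- The logarithm series, on endomorphisms `g` such that `g - Id` raises degrees by at least `2`. -/
def logΛ (g : EndΛ B F E U) : EndΛ B F E U :=
  ∑ n ∈ Finset.Icc 1 (Module.finrank ℂ F), ((-1 : ℂ) ^ (n + 1) / (n : ℂ)) • (g - 1) ^ n

/-! ### Global automorphisms of the vector bundle -/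

variable (B F E)

/-- The families of linear automorphisms of the fibres of `E` which, together with their inverses,
are holomorphic as maps of the total space of `E`. -/
def autSubgroup : Subgroup (∀ x, E x ≃ₗ[ℂ] E x) where
  carrier := {φ |
    ContMDiff (𝓘(ℂ, B).prod 𝓘(ℂ, F)) (𝓘(ℂ, B).prod 𝓘(ℂ, F)) ω
      (fun p : Bundle.TotalSpace F E => Bundle.TotalSpace.mk' F p.1 (φ p.1 p.2)) ∧
    ContMDiff (𝓘(ℂ, B).prod 𝓘(ℂ, F)) (𝓘(ℂ, B).prod 𝓘(ℂ, F)) ω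
      (fun p : Bundle.TotalSpace F E => Bundle.TotalSpace.mk' F p.1 (φ⁻¹ p.1 p.2))}
  mul_mem' := fun ha hb => ⟨ha.1.comp hb.1, by
    rw [mul_inv_rev]
    exact hb.2.comp ha.2⟩
  one_mem' := ⟨contMDiff_id, contMDiff_id⟩
  inv_mem' := fun h => ⟨h.2, by rw [inv_inv]; exact h.1⟩

/-- `H^0(M, Aut(E))`: the group of automorphisms of the holomorphic vector bundle `E` over the
identity of `M`. -/
def AutE : Type (max u w) := autSubgroup B F E

instance : Group (AutE B F E) := inferInstanceAs (Group (autSubgroup B F E))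

variable {B F E}

theorem AutE.holAt (φ : AutE B F E) (V : Opens M) (s : Sec B F E V) (x₀ : V) :
    HolAt B (fun x : V => trivΛ F E x₀ x (ExteriorAlgebra.map (φ.1 x).toLinearMap (s.1 x))) x₀ := by
  set e := trivializationAt F E (x₀ : M) with he
  have hx₀ : (x₀ : M) ∈ e.baseSet := FiberBundle.mem_baseSet_trivializationAt' _
  have hev : ∀ᶠ x : M in nhds (x₀ : M), x ∈ e.baseSet := e.open_baseSet.mem_nhds hx₀
  have hevV : ∀ᶠ x : V in nhds x₀, (x : M) ∈ e.baseSet :=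
    continuous_subtype_val.continuousAt.eventually hev
  let A : M → F →ₗ[ℂ] F := fun x => e.linearMapAt ℂ x ∘ₗ (φ.1 x).toLinearMap ∘ₗ e.symmₗ ℂ x
  have hA : ∀ c, ContMDiffAt 𝓘(ℂ, B) 𝓘(ℂ, F) ω (fun x : V => A x c) x₀ := by
    intro c
    rw [contMDiffAt_subtype_iff (f := fun x : M => A x c)]
    have h1 : ContMDiffAt 𝓘(ℂ, B) (𝓘(ℂ, B).prod 𝓘(ℂ, F)) ω
        (fun x : M => Bundle.TotalSpace.mk' F x (e.symm x c)) (x₀ : M) := by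
      refine (Bundle.contMDiffAt_section (s := fun x => e.symm x c) (x₀ : M)).2 ?_
      refine (contMDiffAt_const (c := c)).congr_of_eventuallyEq ?_
      filter_upwards [hev] with x hx
      rw [← he, e.apply_mk_symm hx]
    have h2 := (φ.2.1.contMDiffAt (x := Bundle.TotalSpace.mk' F (x₀ : M) (e.symm x₀ c))).comp
      (x₀ : M) h1
    have h3 := (Bundle.contMDiffAt_section (s := fun x => φ.1 x (e.symm x c)) (x₀ : M)).1 h2
    refine h3.congr_of_eventuallyEq ?_
    filter_upwards [hev] with x hx
    simp only [A, LinearMap.comp_apply, e.coe_linearMapAt_of_mem hx]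
    change (e ⟨x, φ.1 x (e.symmₗ ℂ x c)⟩).2 = (e ⟨x, φ.1 x (e.symm x c)⟩).2
    rw [e.symmₗ_apply hx]
  refine (HolAt.map hA (s.2 x₀)).congr ?_
  filter_upwards [hevV] with x hx
  have h : e.linearMapAt ℂ (x : M) ∘ₗ (φ.1 x).toLinearMap = A x ∘ₗ e.linearMapAt ℂ (x : M) := by
    ext c
    simp only [A, LinearMap.comp_apply, e.symmₗ_linearMapAt hx]
  simp only [trivΛ, ← he]
  rw [← AlgHom.comp_apply, ← AlgHom.comp_apply, ExteriorAlgebra.map_comp_map,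
    ExteriorAlgebra.map_comp_map, h]

/-- The algebra endomorphism `s ↦ Λφ ∘ s` of `𝒪_ΛE(V)` induced by `φ ∈ H^0(M, Aut(E))`. -/
def AutE.sec (φ : AutE B F E) (V : Opens M) : Sec B F E V →ₐ[ℂ] Sec B F E V where
  toFun s := ⟨fun x => ExteriorAlgebra.map (φ.1 x).toLinearMap (s.1 x), φ.holAt V s⟩
  map_one' := Subtype.ext (funext fun x => map_one (ExteriorAlgebra.map (φ.1 x).toLinearMap))
  map_mul' s s' := Subtype.ext (funext fun x => map_mul (ExteriorAlgebra.map (φ.1 x).toLinearMap)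
    (s.1 x) (s'.1 x))
  map_zero' := Subtype.ext (funext fun x => map_zero (ExteriorAlgebra.map (φ.1 x).toLinearMap))
  map_add' s s' := Subtype.ext (funext fun x => map_add (ExteriorAlgebra.map (φ.1 x).toLinearMap)
    (s.1 x) (s'.1 x))
  commutes' r := Subtype.ext (funext fun x =>
    (ExteriorAlgebra.map (φ.1 x).toLinearMap).commutes r)

theorem AutE.projSec_sec (φ : AutE B F E) (j : ℕ) (V : Opens M) (s : Sec B F E V) :
    projSec B j V (φ.sec V s) = φ.sec V (projSec B j V s) :=
  Subtype.ext (funext fun x => extProj_map (φ.1 x).toLinearMap j (s.1 x))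

theorem AutE.sec_mem (φ : AutE B F E) {S : Set ℕ} {V : Opens M} {s : Sec B F E V}
    (hs : s ∈ degPart B F E S V) : φ.sec V s ∈ degPart B F E S V := fun j hj => by
  rw [φ.projSec_sec, hs j hj, map_zero]

theorem AutE.sec_mul (φ ψ : AutE B F E) (V : Opens M) (s : Sec B F E V) :
    (φ * ψ).sec V s = φ.sec V (ψ.sec V s) := Subtype.ext (funext fun x => by
  change ExteriorAlgebra.map ((φ * ψ).1 x).toLinearMap (s.1 x) =
    ExteriorAlgebra.map (φ.1 x).toLinearMap (ExteriorAlgebra.map (ψ.1 x).toLinearMap (s.1 x))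
  rw [← AlgHom.comp_apply, ExteriorAlgebra.map_comp_map]
  rfl)

theorem AutE.sec_one (V : Opens M) (s : Sec B F E V) : (1 : AutE B F E).sec V s = s :=
  Subtype.ext (funext fun x => by
    change ExteriorAlgebra.map LinearMap.id (s.1 x) = s.1 x
    rw [ExteriorAlgebra.map_id]
    rfl)

/-- The automorphism of `𝒪_ΛE` over `U` induced by `φ ∈ H^0(M, Aut(E))`, as a group homomorphism. -/
def AutE.toUnits (U : Opens M) : AutE B F E →* (EndΛ B F E U)ˣ :=
  MonoidHom.toHomUnits
    { toFun := fun φ => ⟨fun V => (φ.sec V.1).toLinearMap, fun _ _ _ _ => rfl,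
        fun _ _ _ hs => φ.sec_mem hs⟩
      map_one' := EndΛ.ext fun V _ s => AutE.sec_one V s
      map_mul' := fun φ ψ => EndΛ.ext fun V _ s => AutE.sec_mul φ ψ V s }

theorem AutE.toUnits_app (φ : AutE B F E) {U V : Opens M} (h : V ≤ U) (s : Sec B F E V) :
    (AutE.toUnits U φ).1.app h s = φ.sec V s := rfl

theorem AutE.toUnits_inv_app (φ : AutE B F E) {U V : Opens M} (h : V ≤ U) (s : Sec B F E V) :
    (AutE.toUnits U φ)⁻¹.1.app h s = φ⁻¹.sec V s := by
  rw [← map_inv]; rfl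

/-- The action `φ.f = φ ∘ f ∘ φ⁻¹` of `H^0(M, Aut(E))` on `End(ΛE)(U)`. -/
def AutE.act (φ : AutE B F E) (f : EndΛ B F E U) : EndΛ B F E U :=
  (AutE.toUnits U φ).1 * f * (AutE.toUnits U φ)⁻¹.1

theorem AutE.act_app (φ : AutE B F E) (f : EndΛ B F E U) {V : Opens M} (h : V ≤ U)
    (s : Sec B F E V) : (φ.act f).app h s = φ.sec V (f.app h (φ⁻¹.sec V s)) := by
  rw [AutE.act, EndΛ.app_mul, EndΛ.app_mul, AutE.toUnits_app, AutE.toUnits_inv_app]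

theorem AutE.act_add (φ : AutE B F E) (f g : EndΛ B F E U) :
    φ.act (f + g) = φ.act f + φ.act g := by
  simp only [AutE.act, mul_add, add_mul]

theorem AutE.act_smul (φ : AutE B F E) (c : ℂ) (f : EndΛ B F E U) :
    φ.act (c • f) = c • φ.act f := by
  simp only [AutE.act, mul_smul_comm, smul_mul_assoc]

theorem AutE.act_mem_Der2 (φ : AutE B F E) {f : EndΛ B F E U} (hf : f ∈ Der2 B F E U) :
    φ.act f ∈ Der2 B F E U := by
  let T : EndΛ B F E U →ₗ[ℂ] EndΛ B F E U :=
    { toFun := φ.act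
      map_add' := φ.act_add
      map_smul' := φ.act_smul }
  have h' : Der2 B F E U ≤ (Der2 B F E U).comap T := by
    refine iSup₂_le fun k hk g hg => ?_
    refine Submodule.mem_iSup_of_mem k (Submodule.mem_iSup_of_mem hk ?_)
    change φ.act g ∈ DerDeg B F E k U
    refine ⟨fun V h j s hs => ?_, fun V h s s' => ?_⟩
    · rw [AutE.act_app]
      exact φ.sec_mem (hg.1 V h j _ (φ⁻¹.sec_mem hs))
    · have hs : ∀ s, φ.sec V (φ⁻¹.sec V s) = s := fun s => by
        rw [← AutE.sec_mul, mul_inv_cancel, AutE.sec_one]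
      simp only [AutE.act_app]
      rw [map_mul, hg.2, map_add, map_mul, map_mul, hs, hs]
  exact h' hf

theorem AutE.act_mem_GE (φ : AutE B F E) {g : (EndΛ B F E U)ˣ} (hg : g ∈ GE B F E U) :
    AutE.toUnits U φ * g * (AutE.toUnits U φ)⁻¹ ∈ GE B F E U := by
  refine ⟨fun V h => ?_, fun V h j s hs => ?_⟩
  · have h1 : ∀ s, (AutE.toUnits U φ * g * (AutE.toUnits U φ)⁻¹).1.app h s =
        φ.sec V (g.1.app h (φ⁻¹.sec V s)) := fun s => φ.act_app g.1 h s
    refine ⟨by rw [h1, map_one, (hg.1 V h).1, map_one], fun s s' => ?_⟩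
    rw [h1, h1, h1, map_mul, (hg.1 V h).2, map_mul]
  · have h2 : (AutE.toUnits U φ * g * (AutE.toUnits U φ)⁻¹).1 - 1 = φ.act (g.1 - 1) := by
      simp only [AutE.act, mul_sub, sub_mul, Units.val_mul, mul_one, Units.mul_inv]
    rw [h2, AutE.act_app]
    exact φ.sec_mem (hg.2 V h j _ (φ⁻¹.sec_mem hs))

/-- The action of `φ ∈ H^0(M, Aut(E))` on the sheaf `G_E`. -/
def AutE.onGE (φ : AutE B F E) : GESheaf B F E ⟶ GESheaf B F E where
  app U := GrpCat.ofHom (((MulAut.conj (AutE.toUnits U.unop φ)).toMonoidHom.comp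
    (GE B F E U.unop).subtype).codRestrict (GE B F E U.unop) fun g => φ.act_mem_GE g.2)
  naturality _ _ _ := by
    ext g
    exact Subtype.ext (Units.ext rfl)

/-- The action of `φ ∈ H^0(M, Aut(E))` on the sheaf `Der^{(2)}(ΛE)`. -/
def AutE.onDer2 (φ : AutE B F E) : Der2Sheaf B F E ⟶ Der2Sheaf B F E where
  app U := GrpCat.ofHom (AddMonoidHom.toMultiplicative
    { toFun := fun f => ⟨φ.act f.1, φ.act_mem_Der2 f.2⟩
      map_zero' := Subtype.ext (by
        change φ.act 0 = 0
        rw [AutE.act, mul_zero, zero_mul])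
      map_add' := fun f g => Subtype.ext (φ.act_add f.1 g.1) })
  naturality _ _ _ := rfl

end Bundle

/-! ### Čech cohomology with values in a presheaf of groups -/

section Cech

/-- Open coverings of `M`. -/
structure OpenCover (M : Type u) [TopologicalSpace M] where
  /-- the index set -/
  ι : Type u
  /-- the members of the covering -/
  U : ι → Opens M
  covers : ∀ x, ∃ i, x ∈ U i

variable {M : Type u} [TopologicalSpace M]
variable {P Q : (Opens M)ᵒᵖ ⥤ GrpCat.{w}}

/-- The restriction of a cocycle on the family `U` to a refinement `V` of `U`. -/
def refineCocycle {I J : Type u} {U : I → Opens M} {V : J → Opens M} (τ : J → I)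
    (hτ : ∀ j, V j ≤ U (τ j)) (γ : PresheafOfGroups.OneCocycle P U) :
    PresheafOfGroups.OneCocycle P V where
  ev i j _ a b := γ.ev (τ i) (τ j) (a ≫ homOfLE (hτ i)) (b ≫ homOfLE (hτ j))
  ev_precomp _ _ _ _ _ _ _ := γ.ev_precomp _ _ _ _ _
  ev_trans _ _ _ _ _ _ _ := γ.ev_trans _ _ _ _ _ _

/-- Two cocycles on open coverings of `M` are equivalent if they become cohomologous on a common
refinement of these coverings. -/
def CechRel (P : (Opens M)ᵒᵖ ⥤ GrpCat.{w})
    (a b : Σ 𝒰 : OpenCover M, PresheafOfGroups.OneCocycle P 𝒰.U) : Prop :=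
  ∃ (𝒲 : OpenCover M) (σ : 𝒲.ι → a.1.ι) (τ : 𝒲.ι → b.1.ι)
    (hσ : ∀ i, 𝒲.U i ≤ a.1.U (σ i)) (hτ : ∀ i, 𝒲.U i ≤ b.1.U (τ i)),
    (refineCocycle σ hσ a.2).IsCohomologous (refineCocycle τ hτ b.2)

/-- The Čech cohomology `H^1(M, P)`: the direct limit of the cohomologies `H^1(𝒰, P)` over all
open coverings `𝒰` of `M`. -/
def CechH1 (P : (Opens M)ᵒᵖ ⥤ GrpCat.{w}) : Type (max (u + 1) w) := Quot (CechRel P)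

/-- The canonical map `H^1(𝒰, P) → H^1(M, P)`. -/
def toCechH1 (P : (Opens M)ᵒᵖ ⥤ GrpCat.{w}) (𝒰 : OpenCover M) :
    PresheafOfGroups.H1 P 𝒰.U → CechH1 P :=
  Quot.lift (fun γ => Quot.mk _ ⟨𝒰, γ⟩) fun _ _ ⟨α, h⟩ =>
    Quot.sound ⟨𝒰, id, id, fun _ => le_rfl, fun _ => le_rfl, α, fun i j _ a b => h i j a b⟩

/-- The image of a cocycle under a morphism of presheaves of groups. -/
def mapCocycle (θ : P ⟶ Q) {I : Type u} {U : I → Opens M} (γ : PresheafOfGroups.OneCocycle P U) :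
    PresheafOfGroups.OneCocycle Q U where
  ev i j T a b := θ.app (Opposite.op T) (γ.ev i j a b)
  ev_precomp i j T T' φ a b := by
    rw [← γ.ev_precomp i j φ a b]
    exact (ConcreteCategory.congr_hom (θ.naturality φ.op) (γ.ev i j a b)).symm
  ev_trans i j k T a b c := by
    rw [← γ.ev_trans i j k a b c, map_mul]

theorem mapCocycle_isCohomologous (θ : P ⟶ Q) {I : Type u} {U : I → Opens M}
    {γ γ' : PresheafOfGroups.OneCocycle P U} (h : γ.IsCohomologous γ') :
    (mapCocycle θ γ).IsCohomologous (mapCocycle θ γ') := by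
  obtain ⟨α, hα⟩ := h
  refine ⟨fun i => θ.app _ (α i), fun i j T a b => ?_⟩
  have hn : ∀ (i : I) (a : T ⟶ U i), Q.map a.op (θ.app _ (α i)) = θ.app _ (P.map a.op (α i)) :=
    fun i a => (ConcreteCategory.congr_hom (θ.naturality a.op) (α i)).symm
  have h := congrArg (θ.app (Opposite.op T)) (hα i j a b)
  rw [map_mul, map_mul] at h
  rw [hn, hn]
  exact h

/-- The map `H^1(𝒰, P) → H^1(𝒰, Q)` induced by a morphism `P → Q`. -/
def mapH1 (θ : P ⟶ Q) {I : Type u} {U : I → Opens M} :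
    PresheafOfGroups.H1 P U → PresheafOfGroups.H1 Q U :=
  Quot.map (mapCocycle θ) fun _ _ => mapCocycle_isCohomologous θ

/-- The map `H^1(M, P) → H^1(M, Q)` induced by a morphism `P → Q`. -/
def mapCechH1 (θ : P ⟶ Q) : CechH1 P → CechH1 Q :=
  Quot.map (fun a => ⟨a.1, mapCocycle θ a.2⟩) fun _ _ ⟨𝒲, σ, τ, hσ, hτ, h⟩ =>
    ⟨𝒲, σ, τ, hσ, hτ, mapCocycle_isCohomologous θ h⟩

end Cech

/-! ### The cochains and the maps of the construction -/

section Construction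

variable {B : Type t} [NormedAddCommGroup B] [NormedSpace ℂ B]
variable {M : Type u} [TopologicalSpace M] [ChartedSpace B M]
variable {F : Type v} [NormedAddCommGroup F] [NormedSpace ℂ F] [FiniteDimensional ℂ F]
variable {E : M → Type w} [∀ x, AddCommGroup (E x)] [∀ x, Module ℂ (E x)]
  [∀ x, TopologicalSpace (E x)] [TopologicalSpace (Bundle.TotalSpace F E)]
  [FiberBundle F E] [VectorBundle ℂ F E]

/-- `C^0(𝒰, End(ΛE))`. -/
abbrev C0 (B : Type t) [NormedAddCommGroup B] [NormedSpace ℂ B] [ChartedSpace B M]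
    (F : Type v) [NormedAddCommGroup F] [NormedSpace ℂ F] [FiniteDimensional ℂ F]
    (E : M → Type w) [∀ x, AddCommGroup (E x)] [∀ x, Module ℂ (E x)]
    [∀ x, TopologicalSpace (E x)] [TopologicalSpace (Bundle.TotalSpace F E)]
    [FiberBundle F E] [VectorBundle ℂ F E] (𝒰 : OpenCover M) : Type (max u w) :=
  ∀ i : 𝒰.ι, EndΛ B F E (𝒰.U i)

/-- `C^1(𝒰, End(ΛE))`. -/
abbrev C1 (B : Type t) [NormedAddCommGroup B] [NormedSpace ℂ B] [ChartedSpace B M]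
    (F : Type v) [NormedAddCommGroup F] [NormedSpace ℂ F] [FiniteDimensional ℂ F]
    (E : M → Type w) [∀ x, AddCommGroup (E x)] [∀ x, Module ℂ (E x)]
    [∀ x, TopologicalSpace (E x)] [TopologicalSpace (Bundle.TotalSpace F E)]
    [FiberBundle F E] [VectorBundle ℂ F E] (𝒰 : OpenCover M) : Type (max u w) :=
  ∀ i j : 𝒰.ι, EndΛ B F E (𝒰.U i ⊓ 𝒰.U j)

/-- `C^2(𝒰, End(ΛE))`. -/
abbrev C2 (B : Type t) [NormedAddCommGroup B] [NormedSpace ℂ B] [ChartedSpace B M]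
    (F : Type v) [NormedAddCommGroup F] [NormedSpace ℂ F] [FiniteDimensional ℂ F]
    (E : M → Type w) [∀ x, AddCommGroup (E x)] [∀ x, Module ℂ (E x)]
    [∀ x, TopologicalSpace (E x)] [TopologicalSpace (Bundle.TotalSpace F E)]
    [FiberBundle F E] [VectorBundle ℂ F E] (𝒰 : OpenCover M) : Type (max u w) :=
  ∀ i j k : 𝒰.ι, EndΛ B F E (𝒰.U i ⊓ 𝒰.U j ⊓ 𝒰.U k)

variable {𝒰 : OpenCover M}

/-- The additive coboundary `(du)_{ijk} = u_{ij} + u_{jk} + u_{ki}`. -/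
def dAdd (u : C1 B F E 𝒰) : C2 B F E 𝒰 := fun i j k =>
  resEnd B inf_le_left (u i j) + resEnd B (le_inf (inf_le_left.trans inf_le_right) inf_le_right)
    (u j k) + resEnd B (le_inf inf_le_right (inf_le_left.trans inf_le_left)) (u k i)

/-- The multiplicative coboundary `(𝐝g)_{ijk} = g_{ij} g_{jk} g_{ki}`. -/
def dMul (g : C1 B F E 𝒰) : C2 B F E 𝒰 := fun i j k =>
  resEnd B inf_le_left (g i j) * resEnd B (le_inf (inf_le_left.trans inf_le_right) inf_le_right)
    (g j k) * resEnd B (le_inf inf_le_right (inf_le_left.trans inf_le_left)) (g k i)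

/-- `(exp(v).exp(u))_{ij} = exp(v_i) exp(u_{ij}) exp(-v_j)`. -/
def expAct (v : C0 B F E 𝒰) (u : C1 B F E 𝒰) : C1 B F E 𝒰 := fun i j =>
  expΛ (resEnd B inf_le_left (v i)) * expΛ (u i j) * expΛ (-resEnd B inf_le_right (v j))

/-- `λ(v,u) = log(exp(v).exp(u))`. -/
def lam (v : C0 B F E 𝒰) (u : C1 B F E 𝒰) : C1 B F E 𝒰 := fun i j => logΛ (expAct v u i j)

/-- `R_{2q}(u) = pr_{2q}(𝐝 exp(pr_{(2q-2)}(u)))`. -/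
def Rmap (q : ℕ) (u : C1 B F E 𝒰) : C2 B F E 𝒰 := fun i j k =>
  pr q (dMul (fun i j => expΛ (prLe (q - 1) (u i j))) i j k)

/-- `F_{2q}(v,u) = pr_{(2q)}(exp(pr_{(2q-2)}(v)).exp(pr_{(2q-2)}(u)))`, where the truncation
`pr_{(2q)}` of a cochain of the form `Id + …` keeps the component `Id` of degree `0`. -/
def Fmap (q : ℕ) (v : C0 B F E 𝒰) (u : C1 B F E 𝒰) : C1 B F E 𝒰 := fun i j =>
  1 + prLe q (expAct (fun i => prLe (q - 1) (v i)) (fun i j => prLe (q - 1) (u i j)) i j - 1)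

variable (B F E 𝒰)

/-- `C^0(𝒰, Der^{(2)}(ΛE))`. -/
def C0Der : Set (C0 B F E 𝒰) := {v | ∀ i, v i ∈ Der2 B F E (𝒰.U i)}

/-- `C̃^1(𝒰, Der^{(2)}(ΛE))`: the cochains `u ∈ C^1(𝒰, Der^{(2)}(ΛE))` such that `exp(u)` is a
cocycle of `G_E`. -/
def C1Tilde : Set (C1 B F E 𝒰) :=
  {u | (∀ i j, u i j ∈ Der2 B F E (𝒰.U i ⊓ 𝒰.U j)) ∧
    ∀ i j k, dMul (fun i j => expΛ (u i j)) i j k = 1}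

variable {B F E 𝒰}

/-- The conditions on the maps `D'_{2q} : C̃^1(𝒰, Der^{(2)}(ΛE)) → C^1(𝒰, Der_{2q}(ΛE))`, `q ≥ 2`:
`D'_{2q}` factorizes over `pr_{(2q-2)}` and `d D'_{2q}(u) = R_{2q}(u)`. Only the values of
`D' q` for `q ≥ 2` on `C̃^1(𝒰, Der^{(2)}(ΛE))` are relevant. -/
structure IsChoice (D' : ℕ → C1 B F E 𝒰 → C1 B F E 𝒰) : Prop where
  mem_der : ∀ q, 2 ≤ q → ∀ u ∈ C1Tilde B F E 𝒰, ∀ i j,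
    D' q u i j ∈ DerDeg B F E q (𝒰.U i ⊓ 𝒰.U j)
  factors : ∀ q, 2 ≤ q → ∀ u ∈ C1Tilde B F E 𝒰, ∀ u' ∈ C1Tilde B F E 𝒰,
    (∀ i j, prLe (q - 1) (u i j) = prLe (q - 1) (u' i j)) → D' q u = D' q u'
  d_eq : ∀ q, 2 ≤ q → ∀ u ∈ C1Tilde B F E 𝒰, dAdd (D' q u) = Rmap q u

/-- The compatibility identity
`D'_{2q}(λ(v,u)) = D'_{2q}(u) - pr_{2q}(log(F_{2q}(v,u)))`. -/
def IsCompatible (D' : ℕ → C1 B F E 𝒰 → C1 B F E 𝒰) : Prop :=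
  ∀ q, 2 ≤ q → ∀ v ∈ C0Der B F E 𝒰, ∀ u ∈ C1Tilde B F E 𝒰, ∀ i j,
    D' q (lam v u) i j = D' q u i j - pr q (logΛ (Fmap q v u i j))

/-- `D(Id,0,u) = ∑_{q ≥ 2} D'_{2q}(u)`; the summands with `2q > rank E` vanish. -/
def Dsum (D' : ℕ → C1 B F E 𝒰 → C1 B F E 𝒰) (u : C1 B F E 𝒰) : C1 B F E 𝒰 := fun i j =>
  ∑ q ∈ Finset.Icc 2 (Module.finrank ℂ F), D' q u i j

/-- The endomorphism underlying a section of `G_E`. -/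
def valGE {U : Opens M} (g : GE B F E U) : EndΛ B F E U := g.1.1

/-- The endomorphism underlying a section of `Der^{(2)}(ΛE)`. -/
def valDer2 {U : Opens M} (f : Multiplicative (Der2 B F E U)) : EndΛ B F E U :=
  (Multiplicative.toAdd f).1

/-- The cocycle `γ` of `G_E` has the components `g_{ij}` on `U_i ∩ U_j`. -/
def HasValuesGE (γ : PresheafOfGroups.OneCocycle (GESheaf B F E) 𝒰.U) (g : C1 B F E 𝒰) : Prop :=
  ∀ i j, valGE (γ.ev i j (homOfLE inf_le_left) (homOfLE inf_le_right)) = g i j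

/-- The cocycle `δ` of `Der^{(2)}(ΛE)` has the components `w_{ij}` on `U_i ∩ U_j`. -/
def HasValuesDer2 (δ : PresheafOfGroups.OneCocycle (Der2Sheaf B F E) 𝒰.U) (w : C1 B F E 𝒰) :
    Prop :=
  ∀ i j, valDer2 (δ.ev i j (homOfLE inf_le_left) (homOfLE inf_le_right)) = w i j

/-- `σ([exp(u)]) = [D(Id,0,u) + u]` in `H^1(𝒰, ·)` for all `u ∈ C̃^1(𝒰, Der^{(2)}(ΛE))`; this
includes that `exp(u)` and `D(Id,0,u) + u` are cocycles. -/
def IsSigma (D' : ℕ → C1 B F E 𝒰 → C1 B F E 𝒰)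
    (σ : PresheafOfGroups.H1 (GESheaf B F E) 𝒰.U → PresheafOfGroups.H1 (Der2Sheaf B F E) 𝒰.U) :
    Prop :=
  ∀ u ∈ C1Tilde B F E 𝒰, ∃ γ δ, HasValuesGE γ (fun i j => expΛ (u i j)) ∧
    HasValuesDer2 δ (fun i j => Dsum D' u i j + u i j) ∧ σ γ.class = δ.class

/-- `σ([exp(u)]) = [D(Id,0,u) + u]` in `H^1(M, ·)` for all `u ∈ C̃^1(𝒰, Der^{(2)}(ΛE))`; this
includes that `exp(u)` and `D(Id,0,u) + u` are cocycles. -/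
def IsCechSigma (D' : ℕ → C1 B F E 𝒰 → C1 B F E 𝒰)
    (σ : CechH1 (GESheaf B F E) → CechH1 (Der2Sheaf B F E)) : Prop :=
  ∀ u ∈ C1Tilde B F E 𝒰, ∃ γ δ, HasValuesGE γ (fun i j => expΛ (u i j)) ∧
    HasValuesDer2 δ (fun i j => Dsum D' u i j + u i j) ∧
    σ (toCechH1 _ 𝒰 γ.class) = toCechH1 _ 𝒰 δ.class

/-- The maps `D'_{2q}`, `q ≥ 2`, are `H^0(M, Aut(E))`-equivariant. -/
def IsEquivariant (D' : ℕ → C1 B F E 𝒰 → C1 B F E 𝒰) : Prop :=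
  ∀ (φ : AutE B F E) (q : ℕ), 2 ≤ q → ∀ u ∈ C1Tilde B F E 𝒰,
    D' q (fun i j => φ.act (u i j)) = fun i j => φ.act (D' q u i j)

end Construction

end HolSuper

end

namespace HolSuper

/-! ### The truncated exponential and logarithm -/

section ExpLog

open Polynomial

/-! The proof runs through the filtration of even endomorphisms by the amount `2n` by which they
raise degrees. It is finite because degrees above the rank carry no sections, and it moves in steps
of two because endomorphisms are even. If `f`, `g` lie in the first step and `f - g` in step `q`,
then `exp f - exp g` and `log (1 + f) - log (1 + g)` agree with `f - g` modulo step `q + 1`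
(`aeval_sub_aeval_mem_EndFil`). Hence leading terms of products of exponentials simply add.

Two consequences carry the theorem. In degree `2q`, the relation `exp(u_ij) exp(u_jk) exp(u_ki) = 1`
reads `R_{2q}(u) + d(pr_{2q} u) = 0` (`pr_add_pr_add_pr`); together with `dD'_{2q} = R_{2q}` it
makes `D(Id,0,u) + u` closed. Likewise `pr_{2q} λ(v,u)` is `v_i + u_ij - v_j` in degree `2q` plus
`pr_{2q} log F_{2q}(v,u)` (`pr_lam`). The compatibility identity removes exactly this correction, so
that passing from `u` to `λ(v,u)` changes `D(Id,0,u) + u` by the coboundary `v_i - v_j`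
(`Dsum_lam_add`).

Moreover `u ↦ D(Id,0,u) + u` is injective: since `D'_{2q}` depends only on components of lower
degree, `u` is recovered degree by degree (`eq_of_Dsum_add_eq`). Therefore, for a fixed `v`, `u' =
λ(v,u)` holds if and only if the two images differ by the coboundary of `v`. The same `v` witnesses
both cohomology relations, which gives well-definedness and injectivity at once (`SigmaRel.eq_iff`).

Every cocycle of `G_E` is some `exp(u)`, because the logarithm of a unipotent automorphism is a
derivation (`logΛ_valGE_mem`). Since cochains are not assumed alternating, a triple product equal to
`1` is turned into a cocycle by the absence of 3-torsion (`exists_cocycle_of_mul_mul_eq_one`). The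
statement on `M` follows from the one on the covering: both presheaves are sheaves, so `H^1(𝒰, ·) →
H^1(M, ·)` is injective, and for `G_E` it is surjective by assumption. -/

/-- The Taylor polynomial of degree `n` of `exp X`. -/
noncomputable def expPoly (n : ℕ) : ℂ[X] :=
  ∑ i ∈ Finset.range (n + 1), C ((i.factorial : ℂ)⁻¹) * X ^ i

/-- The Taylor polynomial of degree `n` of `log (1 + X)`. -/
noncomputable def logPoly (n : ℕ) : ℂ[X] :=
  ∑ i ∈ Finset.Icc 1 n, C ((-1 : ℂ) ^ (i + 1) / (i : ℂ)) * X ^ i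

theorem expPoly_succ (n : ℕ) :
    expPoly (n + 1) = expPoly n + C (((n + 1).factorial : ℂ)⁻¹) * X ^ (n + 1) :=
  Finset.sum_range_succ _ _

theorem logPoly_succ (n : ℕ) :
    logPoly (n + 1) = logPoly n + C ((-1 : ℂ) ^ (n + 2) / ((n + 1 : ℕ) : ℂ)) * X ^ (n + 1) :=
  Finset.sum_Icc_succ_top (by omega) _

theorem expPoly_zero : expPoly 0 = 1 := by simp [expPoly]

theorem logPoly_zero : logPoly 0 = 0 := by simp [logPoly]

theorem X_dvd_expPoly_sub_one (n : ℕ) : X ∣ expPoly n - 1 := by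
  induction n with
  | zero => simp [expPoly_zero]
  | succ n ih =>
    rw [expPoly_succ, add_sub_right_comm]
    exact dvd_add ih (Dvd.dvd.mul_left (dvd_pow_self X (by omega)) _)

theorem X_dvd_logPoly (n : ℕ) : X ∣ logPoly n := by
  induction n with
  | zero => simp [logPoly_zero]
  | succ n ih =>
    rw [logPoly_succ]
    exact dvd_add ih (Dvd.dvd.mul_left (dvd_pow_self X (by omega)) _)

theorem derivative_expPoly (n : ℕ) :
    derivative (expPoly n) = expPoly n - C ((n.factorial : ℂ)⁻¹) * X ^ n := by
  induction n with
  | zero => simp [expPoly_zero]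
  | succ n ih =>
    rw [expPoly_succ, derivative_add, ih, derivative_C_mul_X_pow, Nat.factorial_succ]
    have h1 : ((n : ℂ) + 1) ≠ 0 := Nat.cast_add_one_ne_zero n
    have h2 : (n.factorial : ℂ) ≠ 0 := by exact_mod_cast n.factorial_ne_zero
    have h : (((n + 1) * n.factorial : ℕ) : ℂ)⁻¹ * ((n + 1 : ℕ) : ℂ) = (n.factorial : ℂ)⁻¹ := by
      push_cast
      field_simp
    rw [h, Nat.add_sub_cancel]
    ring

theorem one_add_X_mul_derivative_logPoly (n : ℕ) :
    derivative (logPoly n) * (1 + X) = 1 - (-X) ^ n := by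
  induction n with
  | zero => simp [logPoly_zero]
  | succ n ih =>
    rw [logPoly_succ, derivative_add, add_mul, ih, derivative_C_mul_X_pow]
    have h1 : ((n + 1 : ℕ) : ℂ) ≠ 0 := by exact_mod_cast n.succ_ne_zero
    rw [div_mul_cancel₀ _ h1, Nat.add_sub_cancel, map_pow, map_neg, map_one, neg_pow (X : ℂ[X]) n,
      neg_pow (X : ℂ[X]) (n + 1)]
    ring

/-- Both terms vanish at `0`, so in characteristic zero it suffices to compare derivatives modulo `X
^ n`. The chain rule leaves two errors, one from each truncation: a multiple of `(expPoly n - 1) ^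
n` and a multiple of `X ^ n`. -/
theorem X_pow_dvd_logPoly_comp_expPoly (n : ℕ) :
    X ^ (n + 1) ∣ (logPoly n).comp (expPoly n - 1) - X := by
  set p := (logPoly n).comp (expPoly n - 1) with hp
  have h0 : X ∣ p := by
    obtain ⟨a, ha⟩ := X_dvd_logPoly n
    rw [hp, ha, mul_comp, X_comp]
    exact Dvd.dvd.mul_right (X_dvd_expPoly_sub_one n) _
  have h1 : X ^ n ∣ derivative p - 1 := by
    have h := congrArg (fun q => q.comp (expPoly n - 1)) (one_add_X_mul_derivative_logPoly n)
    simp only [mul_comp, add_comp, sub_comp, one_comp, X_comp, pow_comp, neg_comp,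
      add_sub_cancel] at h
    have h2 : derivative p - 1 = -((-(expPoly n - 1)) ^ n +
        X ^ n * (C ((n.factorial : ℂ)⁻¹) * (derivative (logPoly n)).comp (expPoly n - 1))) := by
      rw [hp, derivative_comp, derivative_sub, derivative_one, sub_zero, derivative_expPoly]
      linear_combination h
    rw [h2]
    refine (dvd_neg.2 (dvd_add ?_ (dvd_mul_right _ _)))
    exact pow_dvd_pow_of_dvd (dvd_neg.2 (X_dvd_expPoly_sub_one n)) n
  rw [X_pow_dvd_iff] at h1 ⊢
  intro d hd
  cases d with
  | zero => simpa using X_dvd_iff.1 h0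
  | succ d =>
    have h := h1 d (by omega)
    have h2 : derivative p - 1 = derivative (p - X) := by simp
    rw [h2, coeff_derivative] at h
    exact (mul_eq_zero.1 h).resolve_right (Nat.cast_add_one_ne_zero d)

variable {A : Type*} [Ring A] [Algebra ℂ A]

theorem aeval_expPoly (n : ℕ) (a : A) :
    aeval a (expPoly n) = ∑ i ∈ Finset.range (n + 1), ((i.factorial : ℂ)⁻¹) • a ^ i := by
  simp [expPoly, Algebra.smul_def]

theorem aeval_logPoly (n : ℕ) (a : A) :
    aeval a (logPoly n) = ∑ i ∈ Finset.Icc 1 n, ((-1 : ℂ) ^ (i + 1) / (i : ℂ)) • a ^ i := by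
  simp [logPoly, Algebra.smul_def]

theorem aeval_expPoly_eq_of_le {n m : ℕ} (h : n ≤ m) {a : A} (ha : a ^ (n + 1) = 0) :
    aeval a (expPoly m) = aeval a (expPoly n) := by
  induction m, h using Nat.le_induction with
  | base => rfl
  | succ m hm ih =>
    rw [expPoly_succ, map_add, ih, map_mul, map_pow, aeval_X, pow_eq_zero_of_le (by omega) ha,
      mul_zero, add_zero]

theorem aeval_logPoly_eq_of_le {n m : ℕ} (h : n ≤ m) {a : A} (ha : a ^ (n + 1) = 0) :
    aeval a (logPoly m) = aeval a (logPoly n) := by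
  induction m, h using Nat.le_induction with
  | base => rfl
  | succ m hm ih =>
    rw [logPoly_succ, map_add, ih, map_mul, map_pow, aeval_X, pow_eq_zero_of_le (by omega) ha,
      mul_zero, add_zero]

theorem aeval_logPoly_aeval_expPoly {n : ℕ} {a : A} (ha : a ^ (n + 1) = 0) :
    aeval (aeval a (expPoly n) - 1) (logPoly n) = a := by
  obtain ⟨q, hq⟩ := X_pow_dvd_logPoly_comp_expPoly n
  have h := congrArg (aeval a) hq
  rw [map_mul, map_pow, aeval_X, ha, zero_mul, map_sub, aeval_X, aeval_comp, map_sub, map_one] at h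
  exact sub_eq_zero.1 h

/-- This makes the addition and derivation theorems for `IsNilpotent.exp` available; only the
scalars change from rational to complex. -/
theorem aeval_expPoly_eq_exp [Module ℚ A] {n : ℕ} {a : A} (ha : a ^ (n + 1) = 0) :
    aeval a (expPoly n) = IsNilpotent.exp a := by
  rw [IsNilpotent.exp_eq_sum ha, aeval_expPoly]
  refine Finset.sum_congr rfl fun i _ => ?_
  rw [← Rat.cast_smul_eq_qsmul ℂ]
  simp

/-- The degree doubles because only `(a + b) ^ (2 * n + 1) = 0` is available for the sum. -/
theorem aeval_expPoly_add {n : ℕ} {a b : A} (hab : Commute a b) (ha : a ^ (n + 1) = 0)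
    (hb : b ^ (n + 1) = 0) :
    aeval (a + b) (expPoly (2 * n)) = aeval a (expPoly n) * aeval b (expPoly n) := by
  let _ : Module ℚ A := Module.compHom A (algebraMap ℚ ℂ)
  rw [aeval_expPoly_eq_exp ha, aeval_expPoly_eq_exp hb, aeval_expPoly_eq_exp
    (Commute.add_pow_eq_zero_of_add_le_succ_of_pow_eq_zero hab ha hb (by omega)),
    IsNilpotent.exp_add_of_commute hab ⟨_, ha⟩ ⟨_, hb⟩]

variable {S : Type*} [Ring S] [Algebra ℂ S]

theorem aeval_expPoly_map_mul {n : ℕ} {D : Module.End ℂ S} (hD : D ^ (n + 1) = 0)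
    (hder : ∀ x y, D (x * y) = D x * y + x * D y) (x y : S) :
    aeval D (expPoly n) (x * y) = aeval D (expPoly n) x * aeval D (expPoly n) y := by
  let _ : Module ℚ S := Module.compHom S (algebraMap ℚ ℂ)
  rw [aeval_expPoly_eq_exp hD]
  exact Module.End.exp_mul_of_derivation ℂ S D (fun x y => by rw [hder, add_comm]) ⟨_, hD⟩ x y

open scoped TensorProduct in
/-- If the exponential of the nilpotent linear map `D` is multiplicative, `D` is a derivation. -/
theorem derivation_of_aeval_expPoly_map_mul {n : ℕ} {D : Module.End ℂ S} (hD : D ^ (n + 1) = 0)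
    (hmul : ∀ x y, aeval D (expPoly n) (x * y) =
      aeval D (expPoly n) x * aeval D (expPoly n) y)
    (hpow : (aeval D (expPoly n) - 1) ^ (n + 1) = 0) (x y : S) :
    D (x * y) = D x * y + x * D y := by
  -- Put `L = 1 ⊗ D` and `R = D ⊗ 1`. They commute and `exp (R + L) = g ⊗ g`, so multiplicativity of
  -- `g = exp D` says that the multiplication map `m` intertwines `G - 1` with `g - 1`.
  let L : Module.End ℂ (S ⊗[ℂ] S) := D.lTensor S
  let R : Module.End ℂ (S ⊗[ℂ] S) := D.rTensor S
  have hL : L ^ (n + 1) = 0 := by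
    exact (map_pow (Module.End.lTensorAlgHom ℂ S S) D (n + 1)).symm.trans (by rw [hD, map_zero])
  have hR : R ^ (n + 1) = 0 := by
    exact (map_pow (Module.End.rTensorAlgHom ℂ S S) D (n + 1)).symm.trans (by rw [hD, map_zero])
  have hLR : Commute R L := by ext; simp [L, R]
  let m : S ⊗[ℂ] S →ₗ[ℂ] S := LinearMap.mul' ℂ S
  set g := aeval D (expPoly n) with hg
  set G : Module.End ℂ (S ⊗[ℂ] S) := aeval (R + L) (expPoly (2 * n)) with hG
  have hG' : G = g.rTensor S * g.lTensor S := by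
    rw [hG, aeval_expPoly_add hLR hR hL]
    exact congrArg₂ (· * ·) (aeval_algHom_apply (Module.End.rTensorAlgHom ℂ S S) D (expPoly n))
      (aeval_algHom_apply (Module.End.lTensorAlgHom ℂ S S) D (expPoly n))
  have h1 : (g - 1) ∘ₗ m = m ∘ₗ (G - 1) := by
    rw [hG']
    ext x y
    simp [m, hmul]
  -- Intertwining passes to polynomials. Applied to the logarithm it gives `D ∘ m = m ∘ (R + L)`,
  -- which is the Leibniz rule.
  have h2 : ∀ p : ℂ[X], (aeval (g - 1) p) ∘ₗ m = m ∘ₗ (aeval (G - 1) p) := by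
    intro p
    induction p using Polynomial.induction_on' with
    | add p q hp hq => rw [map_add, map_add, LinearMap.add_comp, hp, hq, LinearMap.comp_add]
    | monomial k c =>
      rw [aeval_monomial, aeval_monomial, ← Algebra.smul_def, ← Algebra.smul_def,
        LinearMap.smul_comp, LinearMap.comp_smul, Module.End.commute_pow_left_of_commute h1]
  have h3 : aeval (g - 1) (logPoly (2 * n)) = D := by
    rw [aeval_logPoly_eq_of_le (by omega) hpow, aeval_logPoly_aeval_expPoly hD]
  have h4 : aeval (G - 1) (logPoly (2 * n)) = R + L :=
    aeval_logPoly_aeval_expPoly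
      (Commute.add_pow_eq_zero_of_add_le_succ_of_pow_eq_zero hLR hR hL (by omega))
  have h5 := h2 (logPoly (2 * n))
  rw [h3, h4] at h5
  simpa [m, L, R] using LinearMap.congr_fun h5 (x ⊗ₜ[ℂ] y)

end ExpLog

/-! ### The filtration of the even endomorphisms by degree -/

section Filtration

variable {B : Type t} [NormedAddCommGroup B] [NormedSpace ℂ B]
variable {M : Type u} [TopologicalSpace M] [ChartedSpace B M]
variable {F : Type v} [NormedAddCommGroup F] [NormedSpace ℂ F] [FiniteDimensional ℂ F]
variable {E : M → Type w} [∀ x, AddCommGroup (E x)] [∀ x, Module ℂ (E x)]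
  [∀ x, TopologicalSpace (E x)] [TopologicalSpace (Bundle.TotalSpace F E)]
  [FiberBundle F E] [VectorBundle ℂ F E]

/-- Membership in `degPart` only says that the other components vanish; that the remaining one is
the whole section follows by summing all components. For `j` above the rank both sides are zero. -/
theorem projSec_of_mem {i : ℕ} {V : Opens M} {s : Sec B F E V} (hs : s ∈ degPart B F E {i} V)
    (j : ℕ) : projSec B j V s = if j = i then s else 0 := by
  split_ifs with h
  · subst h
    conv_rhs => rw [← sum_projSec V s]
    have h0 : ∀ i, i ≠ j → projSec B i V s = 0 := fun i hi => hs i hi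
    by_cases hj : j < Module.finrank ℂ F + 1
    · rw [Finset.sum_eq_single_of_mem j (Finset.mem_range.2 hj) fun i _ hi => h0 i hi]
    · rw [Finset.sum_eq_zero fun i hi => h0 i fun h => hj (h ▸ Finset.mem_range.1 hi)]
      rw [← sum_projSec V s, map_sum]
      refine Finset.sum_eq_zero fun i hi => ?_
      rw [h0 i fun h => hj (h ▸ Finset.mem_range.1 hi), map_zero]
  · exact hs j h

theorem eq_zero_of_mem_degPart {S : Set ℕ} {V : Opens M} {s : Sec B F E V}
    (hs : s ∈ degPart B F E S V) (hS : ∀ j ∈ S, Module.finrank ℂ F < j) : s = 0 := by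
  rw [← sum_projSec V s]
  refine Finset.sum_eq_zero fun j hj => hs j fun h => ?_
  have := hS j h
  rw [Finset.mem_range] at hj
  omega

theorem degPart_inter {S T : Set ℕ} {V : Opens M} {s : Sec B F E V}
    (hS : s ∈ degPart B F E S V) (hT : s ∈ degPart B F E T V) :
    s ∈ degPart B F E (S ∩ T) V := fun j hj => by
  by_cases h : j ∈ S
  · exact hT j fun h' => hj ⟨h, h'⟩
  · exact hS j h

theorem EndΛ.app_sum {U V : Opens M} (h : V ≤ U) {ι : Type*} (t : Finset ι)
    (f : ι → EndΛ B F E U) (s : Sec B F E V) :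
    (∑ i ∈ t, f i).app h s = ∑ i ∈ t, (f i).app h s := by
  classical
  induction t using Finset.induction_on with
  | empty => simp [EndΛ.app_zero]
  | insert i t hi ih => rw [Finset.sum_insert hi, Finset.sum_insert hi, EndΛ.app_add, ih]

theorem EndΛ.ext_homogeneous {U : Opens M} {f g : EndΛ B F E U}
    (H : ∀ (V : Opens M) (h : V ≤ U) (j : ℕ), ∀ s ∈ degPart B F E {j} V,
      f.app h s = g.app h s) : f = g :=
  EndΛ.ext fun V h s => by
    rw [← sum_projSec V s, map_sum, map_sum]
    exact Finset.sum_congr rfl fun j _ => H V h j _ (projSec_mem j V s)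

variable (B F E) in
/-- The even endomorphisms raising degrees by at least `2n`. -/
def EndFil (n : ℕ) (U : Opens M) : Submodule ℂ (EndΛ B F E U) where
  carrier := {f | ∀ (V : Opens M) (h : V ≤ U) (m : ℕ), ∀ s ∈ degPart B F E {i | m ≤ i} V,
    f.app h s ∈ degPart B F E {i | m + 2 * n ≤ i} V}
  add_mem' := fun ha hb V h j s hs => add_mem (ha V h j s hs) (hb V h j s hs)
  zero_mem' := fun _ _ _ _ _ => zero_mem _
  smul_mem' := fun c _ hf V h j s hs => Submodule.smul_mem _ c (hf V h j s hs)

variable {U : Opens M}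

theorem mem_EndFil_of_homogeneous {n : ℕ} {f : EndΛ B F E U}
    (H : ∀ (V : Opens M) (h : V ≤ U) (j : ℕ), ∀ s ∈ degPart B F E {j} V,
      f.app h s ∈ degPart B F E {i | j + 2 * n ≤ i} V) : f ∈ EndFil B F E n U := by
  intro V h m s hs
  rw [← sum_projSec V s, map_sum]
  refine sum_mem fun j _ => ?_
  by_cases hj : m ≤ j
  · refine degPart_mono (fun i hi => ?_) _ (H V h j _ (projSec_mem j V s))
    change m + 2 * n ≤ i
    change j + 2 * n ≤ i at hi
    omega
  · rw [hs j hj, map_zero]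
    exact zero_mem _

theorem EndFil.app_mem {n : ℕ} {f : EndΛ B F E U} (hf : f ∈ EndFil B F E n U) {V : Opens M}
    (h : V ≤ U) {j : ℕ} {s : Sec B F E V} (hs : s ∈ degPart B F E {j} V) :
    f.app h s ∈ degPart B F E {i | j + 2 * n ≤ i} V :=
  hf V h j s (degPart_mono (by simp) V hs)

theorem EndFil_anti {m n : ℕ} (h : m ≤ n) : EndFil B F E n U ≤ EndFil B F E m U :=
  fun _ hf V hV j s hs => degPart_mono (fun i hi => by
    change j + 2 * n ≤ i at hi
    change j + 2 * m ≤ i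
    omega) V (hf V hV j s hs)

theorem EndFil.mul_mem {m n : ℕ} {f g : EndΛ B F E U} (hf : f ∈ EndFil B F E m U)
    (hg : g ∈ EndFil B F E n U) : f * g ∈ EndFil B F E (m + n) U := fun V h j s hs => by
  rw [show j + 2 * (m + n) = j + 2 * n + 2 * m by ring]
  exact hf V h _ _ (hg V h j s hs)

/-- Degrees above the rank carry no sections. This is why all series are finite and why inductions
along the filtration terminate. -/
theorem EndFil.eq_zero {n : ℕ} {f : EndΛ B F E U} (hf : f ∈ EndFil B F E n U)
    (hn : Module.finrank ℂ F < 2 * n) : f = 0 :=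
  EndΛ.ext_homogeneous fun V h j s hs =>
    eq_zero_of_mem_degPart (EndFil.app_mem hf h hs) fun i hi => by
      change j + 2 * n ≤ i at hi
      omega

theorem one_mem_EndFil : (1 : EndΛ B F E U) ∈ EndFil B F E 0 U := fun _ _ _ _ hs => hs

theorem EndFil.pow_mem {f : EndΛ B F E U} (hf : f ∈ EndFil B F E 1 U) (n : ℕ) :
    f ^ n ∈ EndFil B F E n U := by
  induction n with
  | zero => simpa using one_mem_EndFil
  | succ n ih => rw [pow_succ]; exact EndFil.mul_mem ih hf

theorem EndFil.pow_eq_zero {f : EndΛ B F E U} (hf : f ∈ EndFil B F E 1 U) :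
    f ^ (Module.finrank ℂ F + 1) = 0 :=
  EndFil.eq_zero (EndFil.pow_mem hf _) (by omega)

/-- An even endomorphism maps sections of degree `j` to sections whose components have degrees
of the same parity as `j`. -/
theorem EndΛ.app_mem_parity (f : EndΛ B F E U) {V : Opens M} (h : V ≤ U) {j : ℕ}
    {s : Sec B F E V} (hs : s ∈ degPart B F E {j} V) :
    f.app h s ∈ degPart B F E {i | i % 2 = j % 2} V :=
  f.2.2 ⟨V, h⟩ (j % 2) s (degPart_mono (by simp) V hs)

/-- Parity is what matters from right to left: an even endomorphism that raises degrees by at least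
`2` can only raise them by even amounts. -/
theorem mem_EndGe2_iff {f : EndΛ B F E U} : f ∈ EndGe2 B F E U ↔ f ∈ EndFil B F E 1 U := by
  constructor
  · intro hf
    refine mem_EndFil_of_homogeneous fun V h j s hs => degPart_mono ?_ V (hf V h j s hs)
    rintro _ ⟨k, hk, rfl⟩
    change j + 2 * 1 ≤ j + 2 * k
    omega
  · intro hf V h j s hs
    refine degPart_mono ?_ V (degPart_inter (EndFil.app_mem hf h hs) (f.app_mem_parity h hs))
    rintro i ⟨h1, h2⟩
    change j + 2 * 1 ≤ i at h1
    change i % 2 = j % 2 at h2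
    exact ⟨(i - j) / 2, by omega, by omega⟩

/-! ### The homogeneous components -/

theorem proj_app {V : Opens M} (h : V ≤ U) (j : ℕ) (s : Sec B F E V) :
    (proj B F E j U).app h s = projSec B j V s := rfl

/-- On a section of degree `j` only the `j`-th summand of `pr` survives; if `j` exceeds the rank,
the section is zero. -/
theorem pr_app_of_mem {V : Opens M} (h : V ≤ U) (k : ℕ) (f : EndΛ B F E U) {j : ℕ}
    {s : Sec B F E V} (hs : s ∈ degPart B F E {j} V) :
    (pr k f).app h s = projSec B (j + 2 * k) V (f.app h s) := by
  simp only [pr, EndΛ.app_sum, EndΛ.app_mul, proj_app, projSec_of_mem hs]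
  by_cases hj : j < Module.finrank ℂ F + 1
  · rw [Finset.sum_eq_single_of_mem j (Finset.mem_range.2 hj), if_pos rfl]
    intro i _ hi
    rw [if_neg hi, map_zero, map_zero]
  · rw [Finset.sum_eq_zero, eq_zero_of_mem_degPart hs, map_zero, map_zero]
    · simp only [Set.mem_singleton_iff, forall_eq]
      omega
    · intro i hi
      rw [if_neg fun h : i = j => hj (h ▸ Finset.mem_range.1 hi), map_zero, map_zero]

theorem pr_add (k : ℕ) (f g : EndΛ B F E U) : pr k (f + g) = pr k f + pr k g := by
  simp only [pr, mul_add, add_mul, Finset.sum_add_distrib]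

theorem pr_neg (k : ℕ) (f : EndΛ B F E U) : pr k (-f) = -pr k f := by
  simp only [pr, mul_neg, neg_mul, Finset.sum_neg_distrib]

theorem pr_sub (k : ℕ) (f g : EndΛ B F E U) : pr k (f - g) = pr k f - pr k g := by
  rw [sub_eq_add_neg, pr_add, pr_neg, ← sub_eq_add_neg]

theorem pr_sum (k : ℕ) {ι : Type*} (t : Finset ι) (f : ι → EndΛ B F E U) :
    pr k (∑ i ∈ t, f i) = ∑ i ∈ t, pr k (f i) := by
  simp only [pr, Finset.mul_sum, Finset.sum_mul]
  exact Finset.sum_comm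

theorem prLe_succ (k : ℕ) (f : EndΛ B F E U) : prLe (k + 1) f = prLe k f + pr (k + 1) f :=
  Finset.sum_Icc_succ_top (by omega) _

theorem prLe_zero (f : EndΛ B F E U) : prLe 0 f = 0 := rfl

theorem pr_mem_EndDeg (k : ℕ) (f : EndΛ B F E U) : pr k f ∈ EndDeg B F E k U :=
  fun V h j s hs => by
    rw [pr_app_of_mem h k f hs]
    exact projSec_mem _ V _

theorem EndDeg_le_EndFil (k : ℕ) : EndDeg B F E k U ≤ EndFil B F E k U := fun _ hf =>
  mem_EndFil_of_homogeneous fun V h j s hs => degPart_mono (by simp) V (hf V h j s hs)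

theorem pr_mem_EndFil (k : ℕ) (f : EndΛ B F E U) : pr k f ∈ EndFil B F E k U :=
  EndDeg_le_EndFil k (pr_mem_EndDeg k f)

theorem pr_of_mem_EndDeg {k : ℕ} {f : EndΛ B F E U} (hf : f ∈ EndDeg B F E k U) (l : ℕ) :
    pr l f = if l = k then f else 0 := by
  refine EndΛ.ext_homogeneous fun V h j s hs => ?_
  rw [pr_app_of_mem h l f hs, projSec_of_mem (hf V h j s hs)]
  by_cases hl : l = k
  · rw [if_pos (by omega), if_pos hl]
  · rw [if_neg (by omega), if_neg hl, EndΛ.app_zero]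

theorem pr_pr (k l : ℕ) (f : EndΛ B F E U) : pr l (pr k f) = if l = k then pr k f else 0 :=
  pr_of_mem_EndDeg (pr_mem_EndDeg k f) l

theorem pr_eq_zero_of_mem_EndFil {k : ℕ} {f : EndΛ B F E U} (hf : f ∈ EndFil B F E (k + 1) U) :
    pr k f = 0 := by
  refine EndΛ.ext_homogeneous fun V h j s hs => ?_
  rw [pr_app_of_mem h k f hs]
  refine EndFil.app_mem hf h hs _ fun hk => ?_
  change j + 2 * (k + 1) ≤ j + 2 * k at hk
  omega

/-- Removing the component of degree `2k` gains a full step of two, since evenness excludes a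
component of degree `2k + 1`. -/
theorem sub_pr_mem_EndFil {k : ℕ} {f : EndΛ B F E U} (hf : f ∈ EndFil B F E k U) :
    f - pr k f ∈ EndFil B F E (k + 1) U := by
  refine mem_EndFil_of_homogeneous fun V h j s hs i hi => ?_
  rw [EndΛ.app_sub, pr_app_of_mem h k f hs, map_sub, projSec_projSec]
  split_ifs with hk
  · rw [hk, sub_self]
  · rw [sub_zero]
    refine degPart_inter (EndFil.app_mem hf h hs) (f.app_mem_parity h hs) i ?_
    rintro ⟨h1, h2⟩
    change ¬ j + 2 * (k + 1) ≤ i at hi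
    change j + 2 * k ≤ i at h1
    change i % 2 = j % 2 at h2
    omega

theorem pr_prLe_of_lt {k l : ℕ} (h : k < l) (f : EndΛ B F E U) : pr l (prLe k f) = 0 := by
  rw [prLe, pr_sum]
  refine Finset.sum_eq_zero fun i hi => ?_
  rw [pr_pr, if_neg]
  have := Finset.mem_Icc.1 hi
  omega

theorem prLe_mem_EndFil (k : ℕ) (f : EndΛ B F E U) : prLe k f ∈ EndFil B F E 1 U :=
  sum_mem fun l hl => EndFil_anti (Finset.mem_Icc.1 hl).1 (pr_mem_EndFil l f)

theorem sub_prLe_mem_EndFil {f : EndΛ B F E U} (hf : f ∈ EndFil B F E 1 U) (k : ℕ) :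
    f - prLe k f ∈ EndFil B F E (k + 1) U := by
  induction k with
  | zero => simpa [prLe_zero] using hf
  | succ k ih =>
    have h := sub_pr_mem_EndFil ih
    rwa [pr_sub, pr_prLe_of_lt (Nat.lt_succ_self k), sub_zero, sub_sub, ← prLe_succ] at h

theorem prLe_eq_self {f : EndΛ B F E U} (hf : f ∈ EndFil B F E 1 U) {k : ℕ}
    (hk : Module.finrank ℂ F ≤ k) : prLe k f = f :=
  (sub_eq_zero.1 (EndFil.eq_zero (sub_prLe_mem_EndFil hf k) (by omega))).symm

theorem eq_of_pr_eq {f g : EndΛ B F E U} (hf : f ∈ EndFil B F E 1 U)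
    (hg : g ∈ EndFil B F E 1 U) (h : ∀ k, 1 ≤ k → pr k f = pr k g) : f = g := by
  rw [← prLe_eq_self hf le_rfl, ← prLe_eq_self hg le_rfl]
  exact Finset.sum_congr rfl fun k hk => h k (Finset.mem_Icc.1 hk).1

/-! ### Exponential and logarithm on the filtration -/

theorem pow_sub_pow_mem_EndFil {q : ℕ} {f g : EndΛ B F E U} (hf : f ∈ EndFil B F E 1 U)
    (hg : g ∈ EndFil B F E 1 U) (hfg : f - g ∈ EndFil B F E q U) (n : ℕ) :
    f ^ (n + 1) - g ^ (n + 1) ∈ EndFil B F E (q + n) U := by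
  induction n with
  | zero => simpa using hfg
  | succ n ih =>
    have h : f ^ (n + 1 + 1) - g ^ (n + 1 + 1) =
        f * (f ^ (n + 1) - g ^ (n + 1)) + (f - g) * g ^ (n + 1) := by
      rw [pow_succ' f, pow_succ' g]; noncomm_ring
    rw [h]
    refine add_mem (EndFil_anti (by omega) (EndFil.mul_mem hf ih)) ?_
    exact EndFil.mul_mem hfg (EndFil.pow_mem hg (n + 1))

-- Only the linear term of `p` matters: for `n ≥ 2` the difference of `n`-th powers lies in step `q
-- + n - 1 ≥ q + 1`. All later comparisons of exponentials and logarithms rest on this.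
open Polynomial in
theorem aeval_sub_aeval_mem_EndFil {q : ℕ} {f g : EndΛ B F E U} (hf : f ∈ EndFil B F E 1 U)
    (hg : g ∈ EndFil B F E 1 U) (hfg : f - g ∈ EndFil B F E q U) (p : ℂ[X]) :
    aeval f p - aeval g p - p.coeff 1 • (f - g) ∈ EndFil B F E (q + 1) U := by
  induction p using Polynomial.induction_on' with
  | add p p' hp hp' =>
    convert add_mem hp hp' using 1
    rw [map_add, map_add, coeff_add, add_smul]
    abel
  | monomial n c =>
    rw [aeval_monomial, aeval_monomial, ← Algebra.smul_def, ← Algebra.smul_def, coeff_monomial]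
    match n with
    | 0 => simp
    | 1 => simp [smul_sub]
    | n + 2 =>
      rw [if_neg (by omega), zero_smul, sub_zero, ← smul_sub]
      exact Submodule.smul_mem _ c (EndFil_anti (by omega)
        (pow_sub_pow_mem_EndFil hf hg hfg (n + 1)))

theorem expΛ_eq_aeval {f : EndΛ B F E U} (hf : f ∈ EndFil B F E 1 U) {n : ℕ}
    (hn : Module.finrank ℂ F ≤ n) : expΛ f = Polynomial.aeval f (expPoly n) := by
  rw [aeval_expPoly_eq_of_le hn (EndFil.pow_eq_zero hf), aeval_expPoly, expΛ]

theorem logΛ_eq_aeval {g : EndΛ B F E U} (hg : g - 1 ∈ EndFil B F E 1 U) {n : ℕ}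
    (hn : Module.finrank ℂ F ≤ n) : logΛ g = Polynomial.aeval (g - 1) (logPoly n) := by
  rw [aeval_logPoly_eq_of_le hn (EndFil.pow_eq_zero hg), aeval_logPoly, logΛ]

theorem coeff_one_expPoly (n : ℕ) : (expPoly (n + 1)).coeff 1 = 1 := by
  simp [expPoly, Polynomial.coeff_X_pow]

theorem coeff_one_logPoly (n : ℕ) : (logPoly (n + 1)).coeff 1 = 1 := by
  simp [logPoly, Polynomial.coeff_X_pow]

theorem expΛ_sub_sub_mem_EndFil {q : ℕ} {f g : EndΛ B F E U} (hf : f ∈ EndFil B F E 1 U)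
    (hg : g ∈ EndFil B F E 1 U) (hfg : f - g ∈ EndFil B F E q U) :
    expΛ f - expΛ g - (f - g) ∈ EndFil B F E (q + 1) U := by
  -- The truncation degree is the rank plus one, so that the linear coefficient is `1` even in rank
  -- zero.
  rw [expΛ_eq_aeval hf (Nat.le_succ _), expΛ_eq_aeval hg (Nat.le_succ _)]
  have h := aeval_sub_aeval_mem_EndFil hf hg hfg (expPoly (Module.finrank ℂ F + 1))
  rwa [coeff_one_expPoly, one_smul] at h

theorem logΛ_sub_sub_mem_EndFil {q : ℕ} {f g : EndΛ B F E U} (hf : f - 1 ∈ EndFil B F E 1 U)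
    (hg : g - 1 ∈ EndFil B F E 1 U) (hfg : f - g ∈ EndFil B F E q U) :
    logΛ f - logΛ g - (f - g) ∈ EndFil B F E (q + 1) U := by
  rw [logΛ_eq_aeval hf (Nat.le_succ _), logΛ_eq_aeval hg (Nat.le_succ _)]
  have h := aeval_sub_aeval_mem_EndFil hf hg (q := q) (by rwa [sub_sub_sub_cancel_right])
    (logPoly (Module.finrank ℂ F + 1))
  rwa [coeff_one_logPoly, one_smul, sub_sub_sub_cancel_right] at h

theorem expΛ_zero : expΛ (0 : EndΛ B F E U) = 1 := by
  rw [expΛ, Finset.sum_range_succ']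
  simp

theorem logΛ_one : logΛ (1 : EndΛ B F E U) = 0 :=
  Finset.sum_eq_zero fun n hn => by
    rw [sub_self, zero_pow (by have := Finset.mem_Icc.1 hn; omega), smul_zero]

theorem expΛ_sub_one_mem {f : EndΛ B F E U} (hf : f ∈ EndFil B F E 1 U) :
    expΛ f - 1 ∈ EndFil B F E 1 U := by
  have h := expΛ_sub_sub_mem_EndFil hf (zero_mem _) (by rwa [sub_zero])
  rw [expΛ_zero, sub_zero] at h
  have h' := add_mem (EndFil_anti (by omega) h) hf
  rwa [sub_add_cancel] at h'

theorem logΛ_mem {g : EndΛ B F E U} (hg : g - 1 ∈ EndFil B F E 1 U) :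
    logΛ g ∈ EndFil B F E 1 U := by
  have h := logΛ_sub_sub_mem_EndFil hg (g := 1) (by rw [sub_self]; exact zero_mem _) hg
  rw [logΛ_one, sub_zero] at h
  have h' := add_mem (EndFil_anti (by omega) h) hg
  rwa [sub_add_cancel] at h'

theorem logΛ_expΛ {f : EndΛ B F E U} (hf : f ∈ EndFil B F E 1 U) : logΛ (expΛ f) = f := by
  rw [logΛ_eq_aeval (expΛ_sub_one_mem hf) le_rfl, expΛ_eq_aeval hf le_rfl]
  exact aeval_logPoly_aeval_expPoly (EndFil.pow_eq_zero hf)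

/-- The difference `f - g` is pushed down the filtration: modulo the next step it equals the
difference of the logarithms, which is zero. -/
theorem eq_of_logΛ_eq {f g : EndΛ B F E U} (hf : f - 1 ∈ EndFil B F E 1 U)
    (hg : g - 1 ∈ EndFil B F E 1 U) (h : logΛ f = logΛ g) : f = g := by
  have key : ∀ q, f - g ∈ EndFil B F E (q + 1) U := by
    intro q
    induction q with
    | zero =>
      have h1 := sub_mem hf hg
      rwa [sub_sub_sub_cancel_right] at h1
    | succ q ih =>
      have h1 := logΛ_sub_sub_mem_EndFil hf hg ih
      rwa [h, sub_self, zero_sub, neg_mem_iff] at h1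
  exact sub_eq_zero.1 (EndFil.eq_zero (key (Module.finrank ℂ F)) (by omega))

/-- Both sides have the same logarithm, so injectivity of the logarithm upgrades `logΛ_expΛ` to a
two-sided inverse without a second polynomial identity. -/
theorem expΛ_logΛ {g : EndΛ B F E U} (hg : g - 1 ∈ EndFil B F E 1 U) : expΛ (logΛ g) = g :=
  eq_of_logΛ_eq (expΛ_sub_one_mem (logΛ_mem hg)) hg (logΛ_expΛ (logΛ_mem hg))

theorem expΛ_add {f g : EndΛ B F E U} (hfg : Commute f g) (hf : f ∈ EndFil B F E 1 U)
    (hg : g ∈ EndFil B F E 1 U) : expΛ (f + g) = expΛ f * expΛ g := by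
  rw [expΛ_eq_aeval (add_mem hf hg) (n := 2 * Module.finrank ℂ F) (by omega),
    expΛ_eq_aeval hf le_rfl, expΛ_eq_aeval hg le_rfl]
  exact aeval_expPoly_add hfg (EndFil.pow_eq_zero hf) (EndFil.pow_eq_zero hg)

theorem expΛ_mul_expΛ_neg {f : EndΛ B F E U} (hf : f ∈ EndFil B F E 1 U) :
    expΛ f * expΛ (-f) = 1 := by
  rw [← expΛ_add ((Commute.refl f).neg_right) hf (neg_mem hf), add_neg_cancel, expΛ_zero]

theorem expΛ_neg_mul_expΛ {f : EndΛ B F E U} (hf : f ∈ EndFil B F E 1 U) :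
    expΛ (-f) * expΛ f = 1 := by
  rw [← expΛ_add ((Commute.refl f).neg_left) (neg_mem hf) hf, neg_add_cancel, expΛ_zero]

theorem eq_of_expΛ_eq {f g : EndΛ B F E U} (hf : f ∈ EndFil B F E 1 U)
    (hg : g ∈ EndFil B F E 1 U) (h : expΛ f = expΛ g) : f = g := by
  rw [← logΛ_expΛ hf, h, logΛ_expΛ hg]

/-- A section of the unipotent group whose third power is trivial is trivial. -/
theorem eq_one_of_mul_mul_eq_one {g : EndΛ B F E U} (hg : g - 1 ∈ EndFil B F E 1 U)
    (h : g * g * g = 1) : g = 1 := by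
  have hl := logΛ_mem hg
  have h3 : expΛ (logΛ g + logΛ g + logΛ g) = expΛ 0 := by
    rw [expΛ_add ((Commute.refl _).add_left (Commute.refl _)) (add_mem hl hl) hl,
      expΛ_add (Commute.refl _) hl hl, expΛ_logΛ hg, h, expΛ_zero]
  have h4 := eq_of_expΛ_eq (add_mem (add_mem hl hl) hl) (zero_mem _) h3
  have h5 : (3 : ℂ) • logΛ g = 0 := by
    rw [← h4, show (3 : ℂ) = 1 + 1 + 1 by norm_num, add_smul, add_smul, one_smul]
  rw [← expΛ_logΛ hg, (smul_eq_zero_iff_right (by norm_num : (3 : ℂ) ≠ 0)).1 h5, expΛ_zero]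

/-! ### Compatibility with restrictions -/

section Restriction

variable {U' : Opens M} (h : U' ≤ U)

theorem resEnd_mem_EndFil {n : ℕ} {f : EndΛ B F E U} (hf : f ∈ EndFil B F E n U) :
    resEnd B h f ∈ EndFil B F E n U' := fun V hV => hf V (hV.trans h)

theorem resEnd_pr (k : ℕ) (f : EndΛ B F E U) : resEnd B h (pr k f) = pr k (resEnd B h f) := by
  simp only [pr, map_sum, map_mul]
  rfl

theorem resEnd_prLe (k : ℕ) (f : EndΛ B F E U) :
    resEnd B h (prLe k f) = prLe k (resEnd B h f) := by
  simp only [prLe, map_sum, resEnd_pr]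

theorem resEnd_expΛ (f : EndΛ B F E U) : resEnd B h (expΛ f) = expΛ (resEnd B h f) := by
  simp only [expΛ, map_sum, map_smul, map_pow]

end Restriction

/-! ### The action of bundle automorphisms -/

/-- The action of a bundle automorphism on the even endomorphisms, as an algebra homomorphism. -/
noncomputable def AutE.actHom (φ : AutE B F E) (U : Opens M) : EndΛ B F E U →ₐ[ℂ] EndΛ B F E U :=
  AlgHom.ofLinearMap
    { toFun := φ.act
      map_add' := φ.act_add
      map_smul' := φ.act_smul }
    (by simp [AutE.act])
    (fun f g => by simp [AutE.act, mul_assoc])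

theorem AutE.actHom_apply (φ : AutE B F E) (f : EndΛ B F E U) : φ.actHom U f = φ.act f := rfl

theorem AutE.act_expΛ (φ : AutE B F E) (f : EndΛ B F E U) :
    φ.act (expΛ f) = expΛ (φ.act f) := by
  simp only [← AutE.actHom_apply, expΛ, map_sum, map_smul, map_pow]

end Filtration

/-! ### Derivations and automorphisms -/

section Derivations

variable {B : Type t} [NormedAddCommGroup B] [NormedSpace ℂ B]
variable {M : Type u} [TopologicalSpace M] [ChartedSpace B M]
variable {F : Type v} [NormedAddCommGroup F] [NormedSpace ℂ F] [FiniteDimensional ℂ F]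
variable {E : M → Type w} [∀ x, AddCommGroup (E x)] [∀ x, Module ℂ (E x)]
  [∀ x, TopologicalSpace (E x)] [TopologicalSpace (Bundle.TotalSpace F E)]
  [FiberBundle F E] [VectorBundle ℂ F E]

/-- The degree condition can be read fibrewise, where `ΛE_x` is a graded algebra. -/
theorem mul_mem_degPart {i j : ℕ} {V : Opens M} {s s' : Sec B F E V}
    (hs : s ∈ degPart B F E {i} V) (hs' : s' ∈ degPart B F E {j} V) :
    s * s' ∈ degPart B F E {i + j} V := by
  have h : ∀ {i : ℕ} {s : Sec B F E V}, s ∈ degPart B F E {i} V →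
      ∀ x : V, s.1 x ∈ ⋀[ℂ]^i (E x) := fun {i s} hs x => by
    have h := projSec_of_mem hs i
    rw [if_pos rfl] at h
    rw [← h]
    exact extProj_mem i (s.1 x)
  intro n hn
  refine Subtype.ext (funext fun x => ?_)
  change extProj n (s.1 x * s'.1 x) = 0
  rw [extProj_of_mem (i := i + j) n (SetLike.mul_mem_graded (h hs x) (h hs' x)), if_neg (by simpa using hn)]

theorem projSec_mul_of_mem_right (n : ℕ) {j : ℕ} {V : Opens M} (s : Sec B F E V)
    {s' : Sec B F E V} (hs' : s' ∈ degPart B F E {j} V) :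
    projSec B (n + j) V (s * s') = projSec B n V s * s' := by
  rw [← sum_projSec V s]
  simp only [map_sum, Finset.sum_mul]
  refine Finset.sum_congr rfl fun i _ => ?_
  rw [projSec_of_mem (mul_mem_degPart (projSec_mem i V s) hs'), projSec_projSec]
  by_cases h : n = i
  · rw [if_pos (by omega), if_pos h]
  · rw [if_neg (by omega), if_neg h, zero_mul]

theorem projSec_mul_of_mem_left (n : ℕ) {j : ℕ} {V : Opens M} {s : Sec B F E V}
    (s' : Sec B F E V) (hs : s ∈ degPart B F E {j} V) :
    projSec B (j + n) V (s * s') = s * projSec B n V s' := by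
  rw [← sum_projSec V s']
  simp only [map_sum, Finset.mul_sum]
  refine Finset.sum_congr rfl fun i _ => ?_
  rw [projSec_of_mem (mul_mem_degPart hs (projSec_mem i V s')), projSec_projSec]
  by_cases h : n = i
  · rw [if_pos (by omega), if_pos h]
  · rw [if_neg (by omega), if_neg h, mul_zero]

variable {U : Opens M}

/-- The even endomorphism `f` satisfies the Leibniz rule. -/
def EndΛ.IsDerivation (f : EndΛ B F E U) : Prop :=
  ∀ (V : Opens M) (h : V ≤ U) (s s' : Sec B F E V),
    f.app h (s * s') = f.app h s * s' + s * f.app h s'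

/-- For homogeneous sections of degrees `i` and `j`, this is the component of degree `i + j + 2k` of
the Leibniz rule for `f`; multiplication by a homogeneous factor shifts the projections by its
degree. -/
theorem EndΛ.IsDerivation.pr {f : EndΛ B F E U} (hf : f.IsDerivation) (k : ℕ) :
    (pr k f).IsDerivation := by
  intro V h s s'
  rw [← sum_projSec V s, ← sum_projSec V s']
  simp only [Finset.sum_mul, Finset.mul_sum, map_sum, ← Finset.sum_add_distrib]
  refine Finset.sum_congr rfl fun j _ => Finset.sum_congr rfl fun i _ => ?_
  have hi := projSec_mem i V s
  have hj := projSec_mem j V s'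
  rw [pr_app_of_mem h k f (mul_mem_degPart hi hj), pr_app_of_mem h k f hi,
    pr_app_of_mem h k f hj, hf, map_add, add_right_comm i j, projSec_mul_of_mem_right _ _ hj,
    add_right_comm i, add_assoc i j, projSec_mul_of_mem_left _ _ hi]

/-- The homogeneous components of a derivation are derivations, so the direct sum can be replaced by
two conditions that can be checked on sections. -/
theorem mem_Der2_iff {f : EndΛ B F E U} :
    f ∈ Der2 B F E U ↔ f ∈ EndFil B F E 1 U ∧ f.IsDerivation := by
  constructor
  · intro hf
    let N : Submodule ℂ (EndΛ B F E U) :=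
      { carrier := {f | f ∈ EndFil B F E 1 U ∧ f.IsDerivation}
        add_mem' := fun ha hb => ⟨add_mem ha.1 hb.1, fun V h s s' => by
          rw [EndΛ.app_add, EndΛ.app_add, EndΛ.app_add, ha.2, hb.2, add_mul, mul_add]; abel⟩
        zero_mem' := ⟨zero_mem _, fun V h s s' => by
          rw [EndΛ.app_zero, EndΛ.app_zero, EndΛ.app_zero, zero_mul, mul_zero, add_zero]⟩
        smul_mem' := fun c f hf => ⟨Submodule.smul_mem _ c hf.1, fun V h s s' => by
          rw [EndΛ.app_smul, EndΛ.app_smul, EndΛ.app_smul, hf.2, smul_add, smul_mul_assoc,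
            mul_smul_comm]⟩ }
    have h : Der2 B F E U ≤ N := iSup₂_le fun k hk g hg =>
      ⟨EndFil_anti hk (EndDeg_le_EndFil k hg.1), hg.2⟩
    exact h hf
  · rintro ⟨hf, hder⟩
    rw [← prLe_eq_self hf le_rfl]
    exact sum_mem fun k hk => Submodule.mem_iSup_of_mem k
      (Submodule.mem_iSup_of_mem (Finset.mem_Icc.1 hk).1 ⟨pr_mem_EndDeg k f, hder.pr k⟩)

theorem Der2_le_EndFil : Der2 B F E U ≤ EndFil B F E 1 U := fun _ hf => (mem_Der2_iff.1 hf).1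

theorem DerDeg_le_Der2 {k : ℕ} (hk : 1 ≤ k) : DerDeg B F E k U ≤ Der2 B F E U := fun _ hf =>
  Submodule.mem_iSup_of_mem k (Submodule.mem_iSup_of_mem hk hf)

/-- The action of endomorphisms on the sections over `V`, as an algebra homomorphism. -/
def appHom {V : Opens M} (h : V ≤ U) : EndΛ B F E U →ₐ[ℂ] Module.End ℂ (Sec B F E V) where
  toFun f := f.app h
  map_one' := rfl
  map_mul' _ _ := rfl
  map_zero' := rfl
  map_add' _ _ := rfl
  commutes' _ := rfl

theorem appHom_apply {V : Opens M} (h : V ≤ U) (f : EndΛ B F E U) : appHom h f = f.app h := rfl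

theorem app_expΛ {f : EndΛ B F E U} (hf : f ∈ EndFil B F E 1 U) {V : Opens M} (h : V ≤ U) :
    (expΛ f).app h = Polynomial.aeval (f.app h) (expPoly (Module.finrank ℂ F)) := by
  rw [expΛ_eq_aeval hf le_rfl, ← appHom_apply, ← Polynomial.aeval_algHom_apply, appHom_apply]

theorem app_pow_eq_zero {f : EndΛ B F E U} (hf : f ∈ EndFil B F E 1 U) {V : Opens M}
    (h : V ≤ U) : f.app h ^ (Module.finrank ℂ F + 1) = 0 := by
  rw [← appHom_apply, ← map_pow, EndFil.pow_eq_zero hf, map_zero]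

theorem expΛ_app_mul {f : EndΛ B F E U} (hf : f ∈ Der2 B F E U) {V : Opens M} (h : V ≤ U)
    (s s' : Sec B F E V) :
    (expΛ f).app h (s * s') = (expΛ f).app h s * (expΛ f).app h s' := by
  obtain ⟨h1, h2⟩ := mem_Der2_iff.1 hf
  rw [app_expΛ h1]
  exact aeval_expPoly_map_mul (app_pow_eq_zero h1 h) (h2 V h) s s'

/-- Since `exp f` is multiplicative and maps `s = exp(-f)(1)` to `1`, applying it to `s * 1` yields
`1 = 1 * exp f (1)`. -/
theorem expΛ_app_one {f : EndΛ B F E U} (hf : f ∈ Der2 B F E U) {V : Opens M} (h : V ≤ U) :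
    (expΛ f).app h (1 : Sec B F E V) = 1 := by
  have h1 : (expΛ f).app h ((expΛ (-f)).app h (1 : Sec B F E V)) = 1 := by
    rw [← EndΛ.app_mul, expΛ_mul_expΛ_neg (Der2_le_EndFil hf), EndΛ.app_one]
  have h2 := expΛ_app_mul hf h ((expΛ (-f)).app h (1 : Sec B F E V)) 1
  rwa [mul_one, h1, one_mul, eq_comm] at h2

/-- The exponential of a section of `Der^{(2)}(ΛE)`, as a section of `G_E`. -/
noncomputable def expGE (f : EndΛ B F E U) (hf : f ∈ Der2 B F E U) : GE B F E U :=
  ⟨⟨expΛ f, expΛ (-f), expΛ_mul_expΛ_neg (Der2_le_EndFil hf),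
    expΛ_neg_mul_expΛ (Der2_le_EndFil hf)⟩,
    fun _ h => ⟨expΛ_app_one hf h, expΛ_app_mul hf h⟩,
    mem_EndGe2_iff.2 (expΛ_sub_one_mem (Der2_le_EndFil hf))⟩

theorem valGE_sub_one_mem (g : GE B F E U) : valGE g - 1 ∈ EndFil B F E 1 U :=
  mem_EndGe2_iff.1 g.2.2

/-- The exponential of the logarithm is the given multiplicative map, so over each open set
`derivation_of_aeval_expPoly_map_mul` yields the Leibniz rule. -/
theorem logΛ_valGE_mem (g : GE B F E U) : logΛ (valGE g) ∈ Der2 B F E U := by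
  have hl := logΛ_mem (valGE_sub_one_mem g)
  refine mem_Der2_iff.2 ⟨hl, fun V h s s' => ?_⟩
  have he : Polynomial.aeval ((logΛ (valGE g)).app h) (expPoly (Module.finrank ℂ F)) =
      (valGE g).app h := by
    rw [← app_expΛ hl, expΛ_logΛ (valGE_sub_one_mem g)]
  refine derivation_of_aeval_expPoly_map_mul (app_pow_eq_zero hl h) ?_ ?_ s s'
  · rw [he]
    exact (g.2.1 V h).2
  · rw [he]
    exact app_pow_eq_zero (valGE_sub_one_mem g) h

theorem valGE_injective : Function.Injective (valGE : GE B F E U → EndΛ B F E U) :=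
  fun _ _ h => Subtype.ext (Units.ext h)

theorem expGE_logΛ (g : GE B F E U) : expGE (logΛ (valGE g)) (logΛ_valGE_mem g) = g :=
  valGE_injective (expΛ_logΛ (valGE_sub_one_mem g))

end Derivations

/-! ### Čech cohomology of a sheaf of groups -/

section CechGeneral

variable {M : Type u} [TopologicalSpace M] {P : (Opens M)ᵒᵖ ⥤ GrpCat.{w}}

/-- The restriction maps of a presheaf of groups on a topological space. -/
abbrev resP (P : (Opens M)ᵒᵖ ⥤ GrpCat.{w}) {V U : Opens M} (h : V ≤ U) :
    P.obj (Opposite.op U) →* P.obj (Opposite.op V) := (P.map (homOfLE h).op).hom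

theorem resP_resP {W V U : Opens M} (h : W ≤ V) (h' : V ≤ U) (s : P.obj (Opposite.op U)) :
    resP P h (resP P h' s) = resP P (h.trans h') s := by
  change (P.map (homOfLE h').op ≫ P.map (homOfLE h).op) s = _
  rw [← P.map_comp]
  rfl

theorem resP_self {U : Opens M} (s : P.obj (Opposite.op U)) : resP P le_rfl s = s := by
  change P.map (𝟙 (Opposite.op U)) s = s
  rw [P.map_id]
  rfl

/-- The components of a cochain, indexed by the inclusions of open sets. -/
abbrev evP {I : Type u} {U : I → Opens M} (γ : PresheafOfGroups.OneCocycle P U) (i j : I)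
    {T : Opens M} (a : T ≤ U i) (b : T ≤ U j) : P.obj (Opposite.op T) :=
  γ.ev i j (homOfLE a) (homOfLE b)

section evP

variable {I : Type u} {U : I → Opens M} (γ : PresheafOfGroups.OneCocycle P U)

theorem evP_res (i j : I) {T T' : Opens M} (h : T ≤ T') (a : T' ≤ U i) (b : T' ≤ U j) :
    resP P h (evP γ i j a b) = evP γ i j (h.trans a) (h.trans b) :=
  γ.ev_precomp i j (homOfLE h) (homOfLE a) (homOfLE b)

theorem evP_trans (i j k : I) {T : Opens M} (a : T ≤ U i) (b : T ≤ U j) (c : T ≤ U k) :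
    evP γ i j a b * evP γ j k b c = evP γ i k a c := γ.ev_trans i j k _ _ _

end evP

/-- The cocycle with prescribed components on the intersections of two members of the covering. -/
def cocycleOf {I : Type u} {U : I → Opens M} (c : ∀ i j, P.obj (Opposite.op (U i ⊓ U j)))
    (hc : ∀ (i j k : I) (T : Opens M) (a : T ≤ U i) (b : T ≤ U j) (d : T ≤ U k),
      resP P (le_inf a b) (c i j) * resP P (le_inf b d) (c j k) = resP P (le_inf a d) (c i k)) :
    PresheafOfGroups.OneCocycle P U where
  ev i j _ a b := resP P (le_inf (leOfHom a) (leOfHom b)) (c i j)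
  ev_precomp _ _ _ _ φ _ _ := resP_resP (leOfHom φ) _ _
  ev_trans i j k _ a b d := hc i j k _ (leOfHom a) (leOfHom b) (leOfHom d)

theorem isCohomologous_iff {I : Type u} {U : I → Opens M}
    {γ γ' : PresheafOfGroups.OneCocycle P U} :
    γ.IsCohomologous γ' ↔ ∃ α : ∀ i, P.obj (Opposite.op (U i)),
      ∀ (i j : I) (T : Opens M) (a : T ≤ U i) (b : T ≤ U j),
        resP P a (α i) * evP γ i j a b = evP γ' i j a b * resP P b (α j) :=
  ⟨fun ⟨α, h⟩ => ⟨α, fun i j _ a b => h i j (homOfLE a) (homOfLE b)⟩,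
    fun ⟨α, h⟩ => ⟨α, fun i j _ a b => h i j _ (leOfHom a) (leOfHom b)⟩⟩

/-- An open set contained in `U i` and `U j` lies in their intersection, so the relation there
implies all the others by restriction. -/
theorem isCohomologous_of_inf {I : Type u} {U : I → Opens M}
    {γ γ' : PresheafOfGroups.OneCocycle P U} (α : ∀ i, P.obj (Opposite.op (U i)))
    (h : ∀ i j, resP P inf_le_left (α i) * evP γ i j inf_le_left inf_le_right =
      evP γ' i j inf_le_left inf_le_right * resP P inf_le_right (α j)) :
    γ.IsCohomologous γ' :=
  isCohomologous_iff.2 ⟨α, fun i j T a b => by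
    have h1 := congrArg (resP P (le_inf a b)) (h i j)
    rwa [map_mul, map_mul, resP_resP, resP_resP, evP_res, evP_res] at h1⟩

theorem refineCocycle_isCohomologous {I J : Type u} {U : I → Opens M} {V : J → Opens M}
    (τ : J → I) (hτ : ∀ j, V j ≤ U (τ j)) {γ γ' : PresheafOfGroups.OneCocycle P U}
    (h : γ.IsCohomologous γ') :
    (refineCocycle τ hτ γ).IsCohomologous (refineCocycle τ hτ γ') := by
  obtain ⟨α, hα⟩ := isCohomologous_iff.1 h
  refine isCohomologous_iff.2 ⟨fun j => resP P (hτ j) (α (τ j)), fun i j T a b => ?_⟩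
  rw [resP_resP, resP_resP]
  exact hα (τ i) (τ j) T (a.trans (hτ i)) (b.trans (hτ j))

/-- The restrictions of a cocycle along two refinement maps are cohomologous. -/
theorem refineCocycle_isCohomologous_refineCocycle {I J : Type u} {U : I → Opens M}
    {V : J → Opens M} (σ τ : J → I) (hσ : ∀ j, V j ≤ U (σ j)) (hτ : ∀ j, V j ≤ U (τ j))
    (γ : PresheafOfGroups.OneCocycle P U) :
    (refineCocycle σ hσ γ).IsCohomologous (refineCocycle τ hτ γ) := by
  -- The connecting 0-cochain consists of components of the cocycle itself, those between the two
  -- chosen members of the covering.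
  refine isCohomologous_iff.2 ⟨fun j => evP γ (τ j) (σ j) (hτ j) (hσ j), fun i j T a b => ?_⟩
  rw [evP_res, evP_res]
  change _ * evP γ (σ i) (σ j) (a.trans (hσ i)) (b.trans (hσ j)) =
    evP γ (τ i) (τ j) (a.trans (hτ i)) (b.trans (hτ j)) * _
  rw [evP_trans, evP_trans]

/-- Needed so that equality in the quotient `CechH1` yields an actual common refinement. -/
theorem cechRel_equivalence : _root_.Equivalence (CechRel P) where
  refl a := ⟨a.1, id, id, fun _ => le_rfl, fun _ => le_rfl,
    (PresheafOfGroups.OneCocycle.equivalence_isCohomologous P a.1.U).refl _⟩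
  symm := fun ⟨𝒲, σ, τ, hσ, hτ, h⟩ => ⟨𝒲, τ, σ, hτ, hσ,
    (PresheafOfGroups.OneCocycle.equivalence_isCohomologous P 𝒲.U).symm h⟩
  trans := by
    rintro a b c ⟨𝒲, σ, τ, hσ, hτ, h⟩ ⟨𝒲', σ', τ', hσ', hτ', h'⟩
    -- Transitivity uses the pairwise intersections of the two refinements. There the middle cocycle
    -- arrives along two different refinement maps, and these restrictions are cohomologous.
    refine ⟨⟨𝒲.ι × 𝒲'.ι, fun k => 𝒲.U k.1 ⊓ 𝒲'.U k.2, fun x => ?_⟩,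
      fun k : 𝒲.ι × 𝒲'.ι => σ k.1, fun k : 𝒲.ι × 𝒲'.ι => τ' k.2,
      fun k : 𝒲.ι × 𝒲'.ι => inf_le_left.trans (hσ k.1),
      fun k : 𝒲.ι × 𝒲'.ι => inf_le_right.trans (hτ' k.2), ?_⟩
    · obtain ⟨i, hi⟩ := 𝒲.covers x
      obtain ⟨j, hj⟩ := 𝒲'.covers x
      exact ⟨(i, j), hi, hj⟩
    · have e := PresheafOfGroups.OneCocycle.equivalence_isCohomologous P
        (fun k : 𝒲.ι × 𝒲'.ι => 𝒲.U k.1 ⊓ 𝒲'.U k.2)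
      have h1 := refineCocycle_isCohomologous (V := fun k : 𝒲.ι × 𝒲'.ι => 𝒲.U k.1 ⊓ 𝒲'.U k.2)
        Prod.fst (fun _ => inf_le_left) h
      have h2 := refineCocycle_isCohomologous (V := fun k : 𝒲.ι × 𝒲'.ι => 𝒲.U k.1 ⊓ 𝒲'.U k.2)
        Prod.snd (fun _ => inf_le_right) h'
      exact e.trans h1 (e.trans (refineCocycle_isCohomologous_refineCocycle
        (fun k : 𝒲.ι × 𝒲'.ι => τ k.1) (fun k : 𝒲.ι × 𝒲'.ι => σ' k.2)
        (fun k : 𝒲.ι × 𝒲'.ι => inf_le_left.trans (hτ k.1))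
        (fun k : 𝒲.ι × 𝒲'.ι => inf_le_right.trans (hσ' k.2)) b.2) h2)

/-- The sheaf property of a presheaf of groups. -/
structure IsGluing (P : (Opens M)ᵒᵖ ⥤ GrpCat.{w}) : Prop where
  separated : ∀ {U : Opens M} {κ : Type u} (W : κ → Opens M) (hW : ∀ k, W k ≤ U),
    (∀ x ∈ U, ∃ k, x ∈ W k) → ∀ s s' : P.obj (Opposite.op U),
    (∀ k, resP P (hW k) s = resP P (hW k) s') → s = s'
  glue : ∀ {U : Opens M} {κ : Type u} (W : κ → Opens M) (hW : ∀ k, W k ≤ U),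
    (∀ x ∈ U, ∃ k, x ∈ W k) → ∀ s : ∀ k, P.obj (Opposite.op (W k)),
    (∀ k l, resP P inf_le_left (s k) = resP P (inf_le_right : W k ⊓ W l ≤ W l) (s l)) →
    ∃ t : P.obj (Opposite.op U), ∀ k, resP P (hW k) t = s k

/-- For a sheaf, cocycles which become cohomologous on a refinement are cohomologous. -/
theorem IsGluing.isCohomologous_of_refine (hP : IsGluing P) {I : Type u} {U : I → Opens M}
    (𝒲 : OpenCover M) (σ τ : 𝒲.ι → I) (hσ : ∀ k, 𝒲.U k ≤ U (σ k))
    (hτ : ∀ k, 𝒲.U k ≤ U (τ k)) (γ γ' : PresheafOfGroups.OneCocycle P U)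
    (h : (refineCocycle σ hσ γ).IsCohomologous (refineCocycle τ hτ γ')) :
    γ.IsCohomologous γ' := by
  obtain ⟨α, hα'⟩ := isCohomologous_iff.1 h
  have hα : ∀ (k l : 𝒲.ι) (T : Opens M) (a : T ≤ 𝒲.U k) (b : T ≤ 𝒲.U l),
      resP P a (α k) * evP γ (σ k) (σ l) (a.trans (hσ k)) (b.trans (hσ l)) =
      evP γ' (τ k) (τ l) (a.trans (hτ k)) (b.trans (hτ l)) * resP P b (α l) := hα'
  -- The candidate on `U i ∩ W k` is `γ'_{i,τ(k)} α_k γ_{σ(k),i}`. It does not depend on `k` by the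
  -- cocycle relations and `hα`, so the pieces glue to a section over `U i`.
  let β : ∀ (i : I) (k : 𝒲.ι) (T : Opens M), T ≤ U i → T ≤ 𝒲.U k → P.obj (Opposite.op T) :=
    fun i k T a b => evP γ' i (τ k) a (b.trans (hτ k)) * resP P b (α k) *
      evP γ (σ k) i (b.trans (hσ k)) a
  have hβres : ∀ i k (T T' : Opens M) (c : T ≤ T') (a : T' ≤ U i) (b : T' ≤ 𝒲.U k),
      resP P c (β i k T' a b) = β i k T (c.trans a) (c.trans b) := by
    intro i k T T' c a b
    simp only [β, map_mul, resP_resP, evP_res]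
  have hβ : ∀ i k l (T : Opens M) (a : T ≤ U i) (b : T ≤ 𝒲.U k) (c : T ≤ 𝒲.U l),
      β i k T a b = β i l T a c := by
    intro i k l T a b c
    simp only [β]
    rw [← evP_trans γ (σ k) (σ l) i (b.trans (hσ k)) (c.trans (hσ l)) a, ← mul_assoc,
      mul_assoc (evP γ' i (τ k) a _), hα k l T b c, ← mul_assoc, evP_trans]
  have hglue : ∀ i, ∃ t : P.obj (Opposite.op (U i)), ∀ k,
      resP P inf_le_left t = β i k (U i ⊓ 𝒲.U k) inf_le_left inf_le_right := fun i =>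
    hP.glue (fun k => U i ⊓ 𝒲.U k) (fun _ => inf_le_left)
      (fun x hx => (𝒲.covers x).imp fun k hk => ⟨hx, hk⟩) _ fun k l => by
        rw [hβres, hβres]
        exact hβ i k l _ _ _ _
  choose t ht using hglue
  have ht' : ∀ i k (T : Opens M) (a : T ≤ U i) (b : T ≤ 𝒲.U k),
      resP P a (t i) = β i k T a b := fun i k T a b => by
    rw [← hβres i k T _ (le_inf a b) inf_le_left inf_le_right, ← ht i k, resP_resP]
  refine isCohomologous_iff.2 ⟨t, fun i j T a b => ?_⟩
  -- On `T ∩ W k` the glued sections are given by `β`, and both sides become `γ'_{i,τ(k)} α_k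
  -- γ_{σ(k),j}`.
  refine hP.separated (fun k => T ⊓ 𝒲.U k) (fun _ => inf_le_left)
    (fun x hx => (𝒲.covers x).imp fun k hk => ⟨hx, hk⟩) _ _ fun k => ?_
  rw [map_mul, map_mul, resP_resP, resP_resP, evP_res, evP_res,
    ht' i k _ (inf_le_left.trans a) inf_le_right, ht' j k _ (inf_le_left.trans b) inf_le_right]
  simp only [β]
  rw [mul_assoc, evP_trans, ← mul_assoc, ← mul_assoc, evP_trans]

/-- For a sheaf `P`, the canonical map `H^1(𝒰, P) → H^1(M, P)` is injective. -/
theorem IsGluing.toCechH1_injective (hP : IsGluing P) (𝒰 : OpenCover M) :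
    Function.Injective (toCechH1 P 𝒰) := by
  intro a b
  induction a using Quot.ind with | mk γ => ?_
  induction b using Quot.ind with | mk γ' => ?_
  intro h
  obtain ⟨𝒲, σ, τ, hσ, hτ, hc⟩ := (cechRel_equivalence.quot_mk_eq_iff _ _).1 h
  exact Quot.sound (hP.isCohomologous_of_refine 𝒲 σ τ hσ hτ γ γ' hc)

end CechGeneral

/-! ### Gluing of sections, endomorphisms, automorphisms and derivations -/

section Gluing

variable {B : Type t} [NormedAddCommGroup B] [NormedSpace ℂ B]
variable {M : Type u} [TopologicalSpace M] [ChartedSpace B M]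
variable {F : Type v} [NormedAddCommGroup F] [NormedSpace ℂ F] [FiniteDimensional ℂ F]
variable {E : M → Type w} [∀ x, AddCommGroup (E x)] [∀ x, Module ℂ (E x)]
  [∀ x, TopologicalSpace (E x)] [TopologicalSpace (Bundle.TotalSpace F E)]
  [FiberBundle F E] [VectorBundle ℂ F E]
variable {κ : Type*}

theorem Sec.ext_of_cover {V : Opens M} {W : κ → Opens M} (hcov : ∀ x ∈ V, ∃ k, x ∈ W k)
    {s s' : Sec B F E V}
    (h : ∀ k, resSec B (inf_le_left : V ⊓ W k ≤ V) s = resSec B inf_le_left s') : s = s' := by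
  refine Subtype.ext (funext fun x => ?_)
  obtain ⟨k, hk⟩ := hcov x.1 x.2
  exact congrFun (congrArg Subtype.val (h k)) ⟨x.1, x.2, hk⟩

theorem Sec.exists_glue {V : Opens M} {W : κ → Opens M} (hW : ∀ k, W k ≤ V)
    (hcov : ∀ x ∈ V, ∃ k, x ∈ W k) (s : ∀ k, Sec B F E (W k))
    (hs : ∀ k l, resSec B inf_le_left (s k) =
      resSec B (inf_le_right : W k ⊓ W l ≤ W l) (s l)) :
    ∃ t : Sec B F E V, ∀ k, resSec B (hW k) t = s k := by
  choose c hc using hcov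
  -- The value at `x` is taken from an arbitrarily chosen member containing `x`; agreement on
  -- overlaps makes the choice irrelevant.
  have hval : ∀ k (x : M) (hx : x ∈ V) (hk : x ∈ W k),
      (s (c x hx)).1 ⟨x, hc x hx⟩ = (s k).1 ⟨x, hk⟩ := fun k x hx hk =>
    congrFun (congrArg Subtype.val (hs (c x hx) k)) ⟨x, hc x hx, hk⟩
  refine ⟨⟨fun x => (s (c x.1 x.2)).1 ⟨x.1, hc x.1 x.2⟩, fun x₀ l => ?_⟩,
    fun k => Subtype.ext (funext fun x => hval k x.1 (hW k x.2) x.2)⟩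
  set k := c x₀.1 x₀.2 with hk
  have hx₀ : x₀.1 ∈ W k := hc x₀.1 x₀.2
  classical
  -- Holomorphy is known on `W k` and wanted on `V`. The extension by zero to `M` allows passing
  -- between these two open submanifolds, and near `x₀` its value is irrelevant outside `W k`.
  let G : M → ℂ := fun y =>
    if h : y ∈ W k then l (trivΛ F E x₀.1 y ((s k).1 ⟨y, h⟩)) else 0
  have h1 : ContMDiffAt 𝓘(ℂ, B) 𝓘(ℂ, ℂ) ω (fun x : W k => G x) ⟨x₀.1, hx₀⟩ := by
    refine ((s k).2 ⟨x₀.1, hx₀⟩ l).congr_of_eventuallyEq (Filter.Eventually.of_forall fun x => ?_)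
    exact dif_pos x.2
  have h2 : ContMDiffAt 𝓘(ℂ, B) 𝓘(ℂ, ℂ) ω (fun x : V => G x) x₀ :=
    (contMDiffAt_subtype_iff (f := G)).2
      ((contMDiffAt_subtype_iff (f := G) (x := (⟨x₀.1, hx₀⟩ : W k))).1 h1)
  refine h2.congr_of_eventuallyEq ?_
  have h3 : ∀ᶠ x : V in nhds x₀, (x : M) ∈ W k :=
    continuous_subtype_val.continuousAt.eventually ((W k).isOpen.mem_nhds hx₀)
  filter_upwards [h3] with x hx
  simp only [G, dif_pos hx]
  rw [hval k x.1 x.2 hx]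

theorem mem_degPart_of_cover {S : Set ℕ} {V : Opens M} {W : κ → Opens M}
    (hcov : ∀ x ∈ V, ∃ k, x ∈ W k) {s : Sec B F E V}
    (h : ∀ k, resSec B (inf_le_left : V ⊓ W k ≤ V) s ∈ degPart B F E S (V ⊓ W k)) :
    s ∈ degPart B F E S V := fun j hj =>
  Sec.ext_of_cover hcov fun k => (h k j hj : projSec B j _ (resSec B inf_le_left s) = 0)

theorem resSec_mem_degPart {S : Set ℕ} {V' V : Opens M} (h : V' ≤ V) {s : Sec B F E V}
    (hs : s ∈ degPart B F E S V) : resSec B h s ∈ degPart B F E S V' := fun j hj => by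
  change resSec B h (projSec B j V s) = 0
  rw [hs j hj, map_zero]

variable {U : Opens M}

theorem EndΛ.resSec_app (f : EndΛ B F E U) {V' V : Opens M} (h' : V' ≤ V) (h : V ≤ U)
    (s : Sec B F E V) : resSec B h' (f.app h s) = f.app (h'.trans h) (resSec B h' s) :=
  f.2.1 ⟨V, h⟩ ⟨V', h'.trans h⟩ h' s

variable {W : κ → Opens M}

theorem EndΛ.ext_of_cover (hW : ∀ k, W k ≤ U) (hcov : ∀ x ∈ U, ∃ k, x ∈ W k)
    {f g : EndΛ B F E U} (h : ∀ k, resEnd B (hW k) f = resEnd B (hW k) g) :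
    f = g :=
  EndΛ.ext fun V hV s => Sec.ext_of_cover (fun x hx => hcov x (hV hx)) fun k => by
    rw [EndΛ.resSec_app, EndΛ.resSec_app]
    exact congrArg (fun f : EndΛ B F E (W k) => f.app inf_le_right (resSec B inf_le_left s)) (h k)

theorem EndΛ.exists_glue (hW : ∀ k, W k ≤ U) (hcov : ∀ x ∈ U, ∃ k, x ∈ W k)
    (f : ∀ k, EndΛ B F E (W k))
    (hf : ∀ k l, resEnd B inf_le_left (f k) =
      resEnd B (inf_le_right : W k ⊓ W l ≤ W l) (f l)) :
    ∃ g : EndΛ B F E U, ∀ k, resEnd B (hW k) g = f k := by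
  -- The glued endomorphism sends `s` to the section glued from the `f k (s|_{V ∩ W k})`; linearity
  -- and compatibility with restrictions then follow from uniqueness of gluing.
  have hex : ∀ V : {V : Opens M // V ≤ U}, ∀ s : Sec B F E V.1, ∃ t : Sec B F E V.1, ∀ k,
      resSec B inf_le_left t =
        (f k).app (inf_le_right : V.1 ⊓ W k ≤ W k) (resSec B inf_le_left s) := by
    intro V s
    refine Sec.exists_glue (fun _ => inf_le_left)
      (fun x hx => (hcov x (V.2 hx)).imp fun k hk => ⟨hx, hk⟩) _ fun k l => ?_
    rw [EndΛ.resSec_app, EndΛ.resSec_app]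
    exact congrArg (fun f : EndΛ B F E (W k ⊓ W l) =>
      f.app (V := V.1 ⊓ W k ⊓ (V.1 ⊓ W l)) (inf_le_inf inf_le_right inf_le_right)
        (resSec B (inf_le_left.trans inf_le_left) s)) (hf k l)
  choose t ht using hex
  have hext : ∀ (V : {V : Opens M // V ≤ U}) {s s' : Sec B F E V.1},
      (∀ k, resSec B (inf_le_left : V.1 ⊓ W k ≤ V.1) s = resSec B inf_le_left s') → s = s' :=
    fun V _ _ h => Sec.ext_of_cover (fun x hx => hcov x (V.2 hx)) h
  let g : EndΛ B F E U := ⟨fun V =>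
    { toFun := t V
      map_add' := fun s s' => hext V fun k => by rw [map_add, ht, ht, ht, map_add, map_add]
      map_smul' := fun c s => hext V fun k => by
        rw [map_smul, ht, ht, map_smul, map_smul, RingHom.id_apply] },
    fun V V' h s => hext V' fun k => by
      change resSec B _ (resSec B h (t V s)) = resSec B _ (t V' (resSec B h s))
      rw [ht V']
      have h1 := congrArg (resSec B (inf_le_inf_right (W k) h)) (ht V s k)
      rw [EndΛ.resSec_app] at h1
      exact h1,
    fun V p s hs => mem_degPart_of_cover (fun x hx => hcov x (V.2 hx)) fun k => by
      change resSec B inf_le_left (t V s) ∈ _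
      rw [ht V]
      exact (f k).2.2 ⟨V.1 ⊓ W k, inf_le_right⟩ p _ (resSec_mem_degPart inf_le_left hs)⟩
  refine ⟨g, fun k => EndΛ.ext fun V hV s => ?_⟩
  change t ⟨V, hV.trans (hW k)⟩ s = _
  have h1 := congrArg (resSec B (le_inf le_rfl hV : V ≤ V ⊓ W k))
    (ht ⟨V, hV.trans (hW k)⟩ s k)
  rw [EndΛ.resSec_app] at h1
  exact h1

theorem mem_EndFil_of_cover (hW : ∀ k, W k ≤ U) (hcov : ∀ x ∈ U, ∃ k, x ∈ W k)
    {n : ℕ} {f : EndΛ B F E U}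
    (h : ∀ k, resEnd B (hW k) f ∈ EndFil B F E n (W k)) : f ∈ EndFil B F E n U :=
  fun V hV j s hs => mem_degPart_of_cover (fun x hx => hcov x (hV hx)) fun k => by
    rw [EndΛ.resSec_app]
    exact h k (V ⊓ W k) inf_le_right j _ (resSec_mem_degPart inf_le_left hs)

/-- As a supremum of submodules `Der2` is not visibly local, but both conditions in `mem_Der2_iff`
are. -/
theorem mem_Der2_of_cover (hW : ∀ k, W k ≤ U) (hcov : ∀ x ∈ U, ∃ k, x ∈ W k)
    {f : EndΛ B F E U}
    (h : ∀ k, resEnd B (hW k) f ∈ Der2 B F E (W k)) : f ∈ Der2 B F E U := by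
  refine mem_Der2_iff.2 ⟨mem_EndFil_of_cover hW hcov fun k => (mem_Der2_iff.1 (h k)).1,
    fun V hV s s' => Sec.ext_of_cover (fun x hx => hcov x (hV hx)) fun k => ?_⟩
  simp only [map_add, map_mul, EndΛ.resSec_app]
  exact (mem_Der2_iff.1 (h k)).2 (V ⊓ W k) inf_le_right _ _

theorem mem_GE_of_cover (hW : ∀ k, W k ≤ U) (hcov : ∀ x ∈ U, ∃ k, x ∈ W k)
    {g : (EndΛ B F E U)ˣ}
    (h : ∀ k, Units.map (resEnd B (hW k)).toMonoidHom g ∈ GE B F E (W k)) : g ∈ GE B F E U := by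
  refine ⟨fun V hV => ⟨?_, fun s s' => ?_⟩, mem_EndGe2_iff.2 (mem_EndFil_of_cover hW hcov
    fun k => mem_EndGe2_iff.1 (h k).2)⟩
  · refine Sec.ext_of_cover (fun x hx => hcov x (hV hx)) fun k => ?_
    rw [EndΛ.resSec_app, map_one]
    exact ((h k).1 (V ⊓ W k) inf_le_right).1
  · refine Sec.ext_of_cover (fun x hx => hcov x (hV hx)) fun k => ?_
    simp only [map_mul, EndΛ.resSec_app]
    exact ((h k).1 (V ⊓ W k) inf_le_right).2 _ _

theorem valDer2_injective :
    Function.Injective (valDer2 : Multiplicative (Der2 B F E U) → EndΛ B F E U) :=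
  fun _ _ h => Multiplicative.toAdd.injective (Subtype.ext h)

variable (B F E)

theorem isGluing_Der2Sheaf : IsGluing (Der2Sheaf B F E) where
  separated W hW hcov s s' h :=
    valDer2_injective (EndΛ.ext_of_cover hW hcov fun k => congrArg valDer2 (h k))
  glue W hW hcov s hs := by
    obtain ⟨f, hf⟩ := EndΛ.exists_glue hW hcov (fun k => valDer2 (s k))
      fun k l => congrArg valDer2 (hs k l)
    have hmem : f ∈ Der2 B F E _ := mem_Der2_of_cover hW hcov fun k => by
      rw [hf k]
      exact (Multiplicative.toAdd (s k)).2
    exact ⟨Multiplicative.ofAdd ⟨f, hmem⟩, fun k => valDer2_injective (hf k)⟩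

theorem isGluing_GESheaf : IsGluing (GESheaf B F E) where
  separated W hW hcov s s' h :=
    valGE_injective (EndΛ.ext_of_cover hW hcov fun k => congrArg valGE (h k))
  glue W hW hcov s hs := by
    obtain ⟨f, hf⟩ := EndΛ.exists_glue hW hcov (fun k => valGE (s k))
      fun k l => congrArg valGE (hs k l)
    -- The inverses are glued as well, so that the glued endomorphism is a unit.
    obtain ⟨f', hf'⟩ := EndΛ.exists_glue hW hcov (fun k => (s k).1⁻¹.1)
      fun k l => congrArg (fun g : GE B F E _ => g.1⁻¹.1) (hs k l)
    have h1 : f * f' = 1 := EndΛ.ext_of_cover hW hcov fun k => by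
      rw [map_mul, hf, hf', map_one]
      exact (s k).1.mul_inv
    have h2 : f' * f = 1 := EndΛ.ext_of_cover hW hcov fun k => by
      rw [map_mul, hf, hf', map_one]
      exact (s k).1.inv_mul
    have hval : ∀ k, Units.map (resEnd B (hW k)).toMonoidHom ⟨f, f', h1, h2⟩ = (s k).1 :=
      fun k => Units.ext (hf k)
    exact ⟨⟨⟨f, f', h1, h2⟩, mem_GE_of_cover hW hcov fun k => by
      rw [hval k]
      exact (s k).2⟩, fun k => valGE_injective (hf k)⟩

end Gluing

/-! ### The construction -/

section CechValues

variable {M : Type u} [TopologicalSpace M] {P : (Opens M)ᵒᵖ ⥤ GrpCat.{w}}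

/-- In the absence of elements of order `3`, a cochain `c` is a cocycle if
`c_{ij} c_{jk} c_{ki} = 1`. -/
theorem exists_cocycle_of_mul_mul_eq_one {I : Type u} {U : I → Opens M}
    (h3 : ∀ (T : Opens M) (x : P.obj (Opposite.op T)), x * x * x = 1 → x = 1)
    (c : ∀ i j, P.obj (Opposite.op (U i ⊓ U j)))
    (hc : ∀ i j k, resP P inf_le_left (c i j) *
      resP P (le_inf (inf_le_left.trans inf_le_right) inf_le_right) (c j k) *
      resP P (le_inf inf_le_right (inf_le_left.trans inf_le_left) :
        U i ⊓ U j ⊓ U k ≤ U k ⊓ U i) (c k i) = 1) :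
    ∃ γ : PresheafOfGroups.OneCocycle P U,
      ∀ i j, evP γ i j inf_le_left inf_le_right = c i j := by
  have hc' : ∀ (i j k : I) (T : Opens M) (a : T ≤ U i) (b : T ≤ U j) (d : T ≤ U k),
      resP P (le_inf a b) (c i j) * resP P (le_inf b d) (c j k) *
        resP P (le_inf d a) (c k i) = 1 := fun i j k T a b d => by
    have h := congrArg (resP P (le_inf (le_inf a b) d)) (hc i j k)
    rwa [map_mul, map_mul, resP_resP, resP_resP, resP_resP, map_one] at h
  -- Equal indices give `c_ii ^ 3 = 1`, hence `c_ii = 1`; then `k = j` gives `c_ij c_ji = 1`, and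
  -- the triple relation becomes `c_ij c_jk = c_ik`.
  have h1 : ∀ (i : I) (T : Opens M) (a : T ≤ U i), resP P (le_inf a a) (c i i) = 1 :=
    fun i T a => h3 T _ (hc' i i i T a a a)
  have h2 : ∀ (i j : I) (T : Opens M) (a : T ≤ U i) (b : T ≤ U j),
      resP P (le_inf a b) (c i j) * resP P (le_inf b a) (c j i) = 1 := fun i j T a b => by
    have h := hc' i j j T a b b
    rwa [h1 j T b, mul_one] at h
  refine ⟨cocycleOf c fun i j k T a b d => ?_, fun i j => resP_self _⟩
  have h := hc' i j k T a b d
  rw [mul_eq_one_iff_eq_inv] at h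
  rw [h, inv_eq_iff_mul_eq_one]
  exact h2 k i T d a

theorem class_eq_of_evP_eq {I : Type u} {U : I → Opens M}
    {γ γ' : PresheafOfGroups.OneCocycle P U}
    (h : ∀ i j, evP γ i j inf_le_left inf_le_right = evP γ' i j inf_le_left inf_le_right) :
    γ.class = γ'.class :=
  (isCohomologous_of_inf (fun _ => 1) fun i j => by
    rw [map_one, map_one, one_mul, mul_one, h]).class_eq

/-- A relation which is total on the left and compatible with equality in both directions is the
graph of a unique map, and this map is injective. -/
theorem existsUnique_map_of_rel {X Y : Type*} (R : X → Y → Prop) (htot : ∀ x, ∃ y, R x y)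
    (hiff : ∀ x y x' y', R x y → R x' y' → (x = x' ↔ y = y')) (S : (X → Y) → Prop)
    (hS : ∀ σ, S σ ↔ ∀ x y, R x y → σ x = y) :
    (∃! σ, S σ) ∧ ∀ σ, S σ → Function.Injective σ := by
  choose f hf using htot
  refine ⟨⟨f, (hS f).2 fun x y h => (hiff _ _ _ _ (hf x) h).1 rfl, fun σ hσ =>
    funext fun x => (hS σ).1 hσ x _ (hf x)⟩, fun σ hσ x x' h => ?_⟩
  rw [(hS σ).1 hσ x _ (hf x), (hS σ).1 hσ x' _ (hf x')] at h
  exact (hiff _ _ _ _ (hf x) (hf x')).2 h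

end CechValues

section Main

variable {B : Type t} [NormedAddCommGroup B] [NormedSpace ℂ B]
variable {M : Type u} [TopologicalSpace M] [ChartedSpace B M]
variable {F : Type v} [NormedAddCommGroup F] [NormedSpace ℂ F] [FiniteDimensional ℂ F]
variable {E : M → Type w} [∀ x, AddCommGroup (E x)] [∀ x, Module ℂ (E x)]
  [∀ x, TopologicalSpace (E x)] [TopologicalSpace (Bundle.TotalSpace F E)]
  [FiberBundle F E] [VectorBundle ℂ F E]

/-! ### Leading terms of products of exponentials -/

section Leading

variable {U : Opens M} {q : ℕ}

/-- Factors of the form `1 + …` act as the identity on leading terms, so perturbations of order `q`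
of a product add up modulo the next step. -/
theorem mul_sub_mul_mem_EndFil {X X' Y Y' p r : EndΛ B F E U}
    (hX' : X' - 1 ∈ EndFil B F E 1 U) (hY : Y - 1 ∈ EndFil B F E 1 U)
    (hp : p ∈ EndFil B F E q U) (hr : r ∈ EndFil B F E q U)
    (h : X - X' - p ∈ EndFil B F E (q + 1) U) (h' : Y - Y' - r ∈ EndFil B F E (q + 1) U) :
    X * Y - X' * Y' - (p + r) ∈ EndFil B F E (q + 1) U := by
  have e : X * Y - X' * Y' - (p + r) = ((X - X' - p) * (Y - 1) + (X - X' - p)) + p * (Y - 1) +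
      ((X' - 1) * (Y - Y' - r) + (Y - Y' - r)) + (X' - 1) * r := by noncomm_ring
  rw [e]
  refine add_mem (add_mem (add_mem (add_mem ?_ h) ?_) (add_mem ?_ h')) ?_
  · exact EndFil_anti (by omega) (EndFil.mul_mem h hY)
  · exact EndFil.mul_mem hp hY
  · exact EndFil_anti (by omega) (EndFil.mul_mem hX' h')
  · exact EndFil_anti (by omega) (EndFil.mul_mem hX' hr)

theorem mul_sub_one_mem_EndFil {X Y : EndΛ B F E U} (hX : X - 1 ∈ EndFil B F E 1 U)
    (hY : Y - 1 ∈ EndFil B F E 1 U) : X * Y - 1 ∈ EndFil B F E 1 U := by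
  have e : X * Y - 1 = (X - 1) * (Y - 1) + (X - 1) + (Y - 1) := by noncomm_ring
  rw [e]
  exact add_mem (add_mem (EndFil_anti (by omega) (EndFil.mul_mem hX hY)) hX) hY

/-- Here `a` and its truncation differ by an element of step `q` with leading term `pr q a`, and the
exponential preserves leading terms of differences. -/
theorem expΛ_sub_expΛ_prLe_mem {a : EndΛ B F E U} (ha : a ∈ EndFil B F E 1 U) (hq : 1 ≤ q) :
    expΛ a - expΛ (prLe (q - 1) a) - pr q a ∈ EndFil B F E (q + 1) U := by
  have h1 := sub_prLe_mem_EndFil ha (q - 1)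
  rw [Nat.sub_add_cancel hq] at h1
  have h2 := expΛ_sub_sub_mem_EndFil ha (prLe_mem_EndFil (q - 1) a) h1
  have h3 := sub_pr_mem_EndFil h1
  rw [pr_sub, pr_prLe_of_lt (by omega), sub_zero] at h3
  have h4 := add_mem h2 h3
  rwa [sub_add_sub_cancel] at h4

/-- The leading term of the difference between a product of exponentials and the product of the
exponentials of the truncations. -/
theorem expΛ_mul_mul_sub_mem {a b c : EndΛ B F E U} (ha : a ∈ EndFil B F E 1 U)
    (hb : b ∈ EndFil B F E 1 U) (hc : c ∈ EndFil B F E 1 U) (hq : 1 ≤ q) :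
    expΛ a * expΛ b * expΛ c -
      expΛ (prLe (q - 1) a) * expΛ (prLe (q - 1) b) * expΛ (prLe (q - 1) c) -
      (pr q a + pr q b + pr q c) ∈ EndFil B F E (q + 1) U :=
  mul_sub_mul_mem_EndFil
    (mul_sub_one_mem_EndFil (expΛ_sub_one_mem (prLe_mem_EndFil _ _))
      (expΛ_sub_one_mem (prLe_mem_EndFil _ _))) (expΛ_sub_one_mem hc)
    (add_mem (pr_mem_EndFil _ _) (pr_mem_EndFil _ _)) (pr_mem_EndFil _ _)
    (mul_sub_mul_mem_EndFil (expΛ_sub_one_mem (prLe_mem_EndFil _ _)) (expΛ_sub_one_mem hb)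
      (pr_mem_EndFil _ _) (pr_mem_EndFil _ _) (expΛ_sub_expΛ_prLe_mem ha hq)
      (expΛ_sub_expΛ_prLe_mem hb hq)) (expΛ_sub_expΛ_prLe_mem hc hq)

theorem pr_one (hq : 1 ≤ q) : pr q (1 : EndΛ B F E U) = 0 := by
  have h : (1 : EndΛ B F E U) ∈ EndDeg B F E 0 U := fun V h j s hs => hs
  rw [pr_of_mem_EndDeg h, if_neg (by omega)]

theorem prLe_neg (k : ℕ) (f : EndΛ B F E U) : prLe k (-f) = -prLe k f := by
  simp only [prLe, pr_neg, Finset.sum_neg_distrib]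

/-- For the components of `u ∈ C̃^1` on a triple intersection this reads `R_{2q}(u) + d(pr_{2q} u) =
0`. -/
theorem pr_add_pr_add_pr {a b c : EndΛ B F E U} (ha : a ∈ EndFil B F E 1 U)
    (hb : b ∈ EndFil B F E 1 U) (hc : c ∈ EndFil B F E 1 U) (hq : 1 ≤ q)
    (h : expΛ a * expΛ b * expΛ c = 1) :
    pr q (expΛ (prLe (q - 1) a) * expΛ (prLe (q - 1) b) * expΛ (prLe (q - 1) c)) +
      (pr q a + pr q b + pr q c) = 0 := by
  have h1 := pr_eq_zero_of_mem_EndFil (expΛ_mul_mul_sub_mem ha hb hc hq)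
  rw [h, pr_sub, pr_sub, pr_one hq, pr_add, pr_add, pr_pr, pr_pr, pr_pr, if_pos rfl,
    if_pos rfl, if_pos rfl, zero_sub, ← neg_add', neg_eq_zero] at h1
  exact h1

/-- For `a = v_i`, `b = u_ij`, `c = -v_j` the last summand is `pr_{2q} log F_{2q}(v,u)`, the
correction in the compatibility identity. -/
theorem pr_logΛ_expΛ_mul_mul {a b c : EndΛ B F E U} (ha : a ∈ EndFil B F E 1 U)
    (hb : b ∈ EndFil B F E 1 U) (hc : c ∈ EndFil B F E 1 U) (hq : 1 ≤ q) :
    pr q (logΛ (expΛ a * expΛ b * expΛ c)) = pr q a + pr q b + pr q c +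
      pr q (logΛ (1 + prLe q (expΛ (prLe (q - 1) a) * expΛ (prLe (q - 1) b) *
        expΛ (prLe (q - 1) c) - 1))) := by
  have h1 := expΛ_mul_mul_sub_mem ha hb hc hq
  set H := expΛ a * expΛ b * expΛ c
  set H' := expΛ (prLe (q - 1) a) * expΛ (prLe (q - 1) b) * expΛ (prLe (q - 1) c)
  have hH : H - 1 ∈ EndFil B F E 1 U := mul_sub_one_mem_EndFil
    (mul_sub_one_mem_EndFil (expΛ_sub_one_mem ha) (expΛ_sub_one_mem hb)) (expΛ_sub_one_mem hc)
  have hH' : H' - 1 ∈ EndFil B F E 1 U := mul_sub_one_mem_EndFil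
    (mul_sub_one_mem_EndFil (expΛ_sub_one_mem (prLe_mem_EndFil _ _))
      (expΛ_sub_one_mem (prLe_mem_EndFil _ _))) (expΛ_sub_one_mem (prLe_mem_EndFil _ _))
  have h2 := sub_prLe_mem_EndFil hH' q
  rw [sub_sub] at h2
  -- `G` and `H'` agree modulo step `q + 1`, so `H - G` has the leading term already found for `H -
  -- H'`; the logarithm keeps it.
  set G := 1 + prLe q (H' - 1) with hG
  have h3 := add_mem h1 h2
  have hG1 : G - 1 ∈ EndFil B F E 1 U := by
    rw [hG, add_sub_cancel_left]
    exact prLe_mem_EndFil _ _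
  have hp : pr q a + pr q b + pr q c ∈ EndFil B F E q U :=
    add_mem (add_mem (pr_mem_EndFil _ _) (pr_mem_EndFil _ _)) (pr_mem_EndFil _ _)
  have h4 : H - G - (pr q a + pr q b + pr q c) ∈ EndFil B F E (q + 1) U := by
    convert h3 using 1
    abel
  have h5 : H - G ∈ EndFil B F E q U := by
    have h := add_mem (EndFil_anti (by omega) h4) hp
    rwa [sub_add_cancel] at h
  have h6 := pr_eq_zero_of_mem_EndFil (add_mem (logΛ_sub_sub_mem_EndFil hH hG1 h5) h4)
  rw [sub_add_sub_cancel, pr_sub, pr_sub, pr_add, pr_add, pr_pr, pr_pr, pr_pr, if_pos rfl,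
    if_pos rfl, if_pos rfl, sub_sub, sub_eq_zero] at h6
  rw [h6, add_comm]

end Leading

variable {𝒰 : OpenCover M}

/-! ### The action of 0-cochains on `C̃^1` -/

/-- The three exponentials multiply inside the group `G_E`, so the logarithm of the product is a
derivation and exponentiates back to it. -/
theorem lam_apply_eq {v : C0 B F E 𝒰} (hv : v ∈ C0Der B F E 𝒰) {u : C1 B F E 𝒰}
    (hu : u ∈ C1Tilde B F E 𝒰) (i j : 𝒰.ι) :
    lam v u i j ∈ Der2 B F E (𝒰.U i ⊓ 𝒰.U j) ∧ expΛ (lam v u i j) = expAct v u i j := by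
  let g : GE B F E (𝒰.U i ⊓ 𝒰.U j) := expGE _ (resEnd_mem_Der2 inf_le_left (hv i)) *
    expGE _ (hu.1 i j) * expGE _ (neg_mem (resEnd_mem_Der2 inf_le_right (hv j)))
  exact ⟨logΛ_valGE_mem g, expΛ_logΛ (valGE_sub_one_mem g)⟩

theorem lam_mem_C1Tilde {v : C0 B F E 𝒰} (hv : v ∈ C0Der B F E 𝒰) {u : C1 B F E 𝒰}
    (hu : u ∈ C1Tilde B F E 𝒰) : lam v u ∈ C1Tilde B F E 𝒰 := by
  refine ⟨fun i j => (lam_apply_eq hv hu i j).1, fun i j k => ?_⟩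
  have h := hu.2 i j k
  simp only [dMul] at h ⊢
  simp only [(lam_apply_eq hv hu _ _).2, expAct, map_mul, resEnd_expΛ, map_neg] at h ⊢
  set x := expΛ (resEnd B (inf_le_left.trans inf_le_left : 𝒰.U i ⊓ 𝒰.U j ⊓ 𝒰.U k ≤ 𝒰.U i) (v i))
  set x' := expΛ (-resEnd B (inf_le_left.trans inf_le_left : 𝒰.U i ⊓ 𝒰.U j ⊓ 𝒰.U k ≤ 𝒰.U i) (v i))
  set y := expΛ (resEnd B (inf_le_left.trans inf_le_right : 𝒰.U i ⊓ 𝒰.U j ⊓ 𝒰.U k ≤ 𝒰.U j) (v j))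
  set y' := expΛ (-resEnd B (inf_le_left.trans inf_le_right :
    𝒰.U i ⊓ 𝒰.U j ⊓ 𝒰.U k ≤ 𝒰.U j) (v j))
  set z := expΛ (resEnd B (inf_le_right : 𝒰.U i ⊓ 𝒰.U j ⊓ 𝒰.U k ≤ 𝒰.U k) (v k))
  set z' := expΛ (-resEnd B (inf_le_right : 𝒰.U i ⊓ 𝒰.U j ⊓ 𝒰.U k ≤ 𝒰.U k) (v k))
  have hx : x * x' = 1 :=
    expΛ_mul_expΛ_neg (resEnd_mem_EndFil _ (Der2_le_EndFil (hv i)))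
  have hy : y' * y = 1 :=
    expΛ_neg_mul_expΛ (resEnd_mem_EndFil _ (Der2_le_EndFil (hv j)))
  have hz : z' * z = 1 :=
    expΛ_neg_mul_expΛ (resEnd_mem_EndFil _ (Der2_le_EndFil (hv k)))
  -- In the triple product the factors at `j` and `k` cancel, leaving a conjugate of `a * b * c` by
  -- `exp(v_i)`.
  have key : ∀ a b c : EndΛ B F E (𝒰.U i ⊓ 𝒰.U j ⊓ 𝒰.U k), a * b * c = 1 →
      x * a * y' * (y * b * z') * (z * c * x') = 1 := fun a b c habc => by
    calc x * a * y' * (y * b * z') * (z * c * x')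
        = x * (a * (y' * y) * b * (z' * z) * c) * x' := by noncomm_ring
      _ = 1 := by rw [hy, hz, mul_one, mul_one, habc, mul_one, hx]
  exact key _ _ _ h

theorem pr_lam {v : C0 B F E 𝒰} (hv : v ∈ C0Der B F E 𝒰) {u : C1 B F E 𝒰}
    (hu : u ∈ C1Tilde B F E 𝒰) {q : ℕ} (hq : 1 ≤ q) (i j : 𝒰.ι) :
    pr q (lam v u i j) = pr q (resEnd B inf_le_left (v i)) + pr q (u i j) -
      pr q (resEnd B inf_le_right (v j)) + pr q (logΛ (Fmap q v u i j)) := by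
  have h := pr_logΛ_expΛ_mul_mul
    (resEnd_mem_EndFil (inf_le_left : 𝒰.U i ⊓ 𝒰.U j ≤ 𝒰.U i) (Der2_le_EndFil (hv i)))
    (Der2_le_EndFil (hu.1 i j)) (neg_mem (resEnd_mem_EndFil
      (inf_le_right : 𝒰.U i ⊓ 𝒰.U j ≤ 𝒰.U j) (Der2_le_EndFil (hv j)))) hq
  rw [pr_neg, ← sub_eq_add_neg, prLe_neg, ← resEnd_prLe, ← resEnd_prLe] at h
  exact h

/-- The case `q = 1`, where there is no `D'_2` to absorb a correction: the truncations are zero, so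
`F_2 = Id`. -/
theorem pr_one_logΛ_Fmap (v : C0 B F E 𝒰) (u : C1 B F E 𝒰) (i j : 𝒰.ι) :
    pr 1 (logΛ (Fmap 1 v u i j)) = 0 := by
  have h : Fmap 1 v u i j = 1 := by
    simp only [Fmap, expAct, Nat.sub_self, prLe_zero, map_zero, neg_zero, expΛ_zero, mul_one,
      sub_self]
    simp [prLe, pr]
  rw [h, logΛ_one]
  simp [pr]

/-! ### The cochain `D(Id,0,u) + u` -/

section Choice

variable {D' : ℕ → C1 B F E 𝒰 → C1 B F E 𝒰} {u : C1 B F E 𝒰}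

theorem Dsum_add_mem (hD : IsChoice D') (hu : u ∈ C1Tilde B F E 𝒰) (i j : 𝒰.ι) :
    Dsum D' u i j + u i j ∈ Der2 B F E (𝒰.U i ⊓ 𝒰.U j) :=
  add_mem (sum_mem fun q hq => DerDeg_le_Der2 (one_le_two.trans (Finset.mem_Icc.1 hq).1)
    (hD.mem_der q (Finset.mem_Icc.1 hq).1 u hu i j)) (hu.1 i j)

theorem pr_Dsum (hD : IsChoice D') (hu : u ∈ C1Tilde B F E 𝒰) (q : ℕ) (i j : 𝒰.ι) :
    pr q (Dsum D' u i j) = if 2 ≤ q then D' q u i j else 0 := by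
  have h : ∀ l ∈ Finset.Icc 2 (Module.finrank ℂ F), pr q (D' l u i j) =
      if q = l then D' l u i j else 0 := fun l hl =>
    pr_of_mem_EndDeg (hD.mem_der l (Finset.mem_Icc.1 hl).1 u hu i j).1 q
  rw [Dsum, pr_sum, Finset.sum_congr rfl h, Finset.sum_ite_eq]
  by_cases hq : 2 ≤ q
  · rw [if_pos hq]
    split_ifs with h'
    · rfl
    -- For `q` above the rank `D'_{2q}(u)` is itself zero, so the cut-off in `Dsum` loses nothing.
    · rw [Finset.mem_Icc] at h'
      exact (EndFil.eq_zero (EndDeg_le_EndFil q (hD.mem_der q hq u hu i j).1) (by omega)).symm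
  · rw [if_neg hq, if_neg fun h' => hq (Finset.mem_Icc.1 h').1]

/-- Checked in each degree `2q`: for `q ≥ 2`, `dD'_{2q}(u) = R_{2q}(u)` cancels `d(pr_{2q} u)`; for
`q = 1` the obstruction is `pr 1` of the identity, which is zero. -/
theorem dAdd_Dsum_add (hD : IsChoice D') (hu : u ∈ C1Tilde B F E 𝒰) :
    dAdd (fun i j => Dsum D' u i j + u i j) = 0 := by
  funext i j k
  have hF := fun i j => Der2_le_EndFil (Dsum_add_mem hD hu i j)
  refine eq_of_pr_eq (add_mem (add_mem (resEnd_mem_EndFil _ (hF i j))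
    (resEnd_mem_EndFil _ (hF j k))) (resEnd_mem_EndFil _ (hF k i))) (zero_mem _) fun q hq => ?_
  have huF := fun i j => Der2_le_EndFil (hu.1 i j)
  have h1 := hu.2 i j k
  simp only [dMul, resEnd_expΛ] at h1
  have h2 := pr_add_pr_add_pr (resEnd_mem_EndFil _ (huF i j)) (resEnd_mem_EndFil _ (huF j k))
    (resEnd_mem_EndFil _ (huF k i)) hq h1
  have h3 : pr q (0 : EndΛ B F E (𝒰.U i ⊓ 𝒰.U j ⊓ 𝒰.U k)) = 0 := by simp [pr]
  rw [Pi.zero_apply, Pi.zero_apply, Pi.zero_apply, h3, ← h2, dAdd]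
  simp only [pr_add, map_add, ← resEnd_pr, pr_Dsum hD hu]
  by_cases hq2 : 2 ≤ q
  · have h4 := congrFun (congrFun (congrFun (hD.d_eq q hq2 u hu) i) j) k
    simp only [dAdd, Rmap, dMul, resEnd_expΛ, resEnd_prLe] at h4
    rw [← h4]
    simp only [if_pos hq2]
    abel
  · obtain rfl : q = 1 := by omega
    simp only [if_neg hq2, map_zero, zero_add, Nat.sub_self, prLe_zero, expΛ_zero, mul_one,
      pr_one le_rfl]

/-- In each degree the correction `pr_{2q} log F_{2q}(v,u)` enters `λ(v,u)` with a plus sign and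
`D'_{2q}(λ(v,u))` with a minus sign, so only the additive coboundary of `v` remains. -/
theorem Dsum_lam_add (hD : IsChoice D') (hcomp : IsCompatible D') (hu : u ∈ C1Tilde B F E 𝒰)
    {v : C0 B F E 𝒰} (hv : v ∈ C0Der B F E 𝒰) (i j : 𝒰.ι) :
    Dsum D' (lam v u) i j + lam v u i j = Dsum D' u i j + u i j +
      (resEnd B inf_le_left (v i) - resEnd B inf_le_right (v j)) := by
  have hl := lam_mem_C1Tilde hv hu
  refine eq_of_pr_eq (Der2_le_EndFil (Dsum_add_mem hD hl i j))
    (add_mem (Der2_le_EndFil (Dsum_add_mem hD hu i j))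
      (sub_mem (resEnd_mem_EndFil _ (Der2_le_EndFil (hv i)))
        (resEnd_mem_EndFil _ (Der2_le_EndFil (hv j))))) fun q hq => ?_
  rw [pr_add, pr_add, pr_add, pr_sub, pr_Dsum hD hl, pr_Dsum hD hu, pr_lam hv hu hq]
  by_cases hq2 : 2 ≤ q
  · rw [if_pos hq2, if_pos hq2, hcomp q hq2 v hv u hu]
    abel
  · obtain rfl : q = 1 := by omega
    rw [if_neg hq2, if_neg hq2, pr_one_logΛ_Fmap]
    abel

/-- Triangularity: once the components of `u` and `u'` agree below degree `2q`, the values of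
`D'_{2q}` agree, hence so do the components of degree `2q`. -/
theorem eq_of_Dsum_add_eq (hD : IsChoice D') (hu : u ∈ C1Tilde B F E 𝒰) {u' : C1 B F E 𝒰}
    (hu' : u' ∈ C1Tilde B F E 𝒰)
    (h : ∀ i j, Dsum D' u i j + u i j = Dsum D' u' i j + u' i j) : u = u' := by
  have key : ∀ k i j, prLe k (u i j) = prLe k (u' i j) := by
    intro k
    induction k with
    | zero => exact fun i j => rfl
    | succ k ih =>
      intro i j
      rw [prLe_succ, prLe_succ, ih i j]
      have h1 := congrArg (pr (k + 1)) (h i j)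
      rw [pr_add, pr_add, pr_Dsum hD hu, pr_Dsum hD hu'] at h1
      by_cases hk : 2 ≤ k + 1
      · rw [if_pos hk, if_pos hk, hD.factors (k + 1) hk u hu u' hu' ih] at h1
        rw [add_left_cancel h1]
      · rw [if_neg hk, if_neg hk, zero_add, zero_add] at h1
        rw [h1]
  funext i j
  rw [← prLe_eq_self (Der2_le_EndFil (hu.1 i j)) le_rfl, key,
    prLe_eq_self (Der2_le_EndFil (hu'.1 i j)) le_rfl]

end Choice

/-! ### Cocycles and their components -/

theorem exists_hasValuesGE {u : C1 B F E 𝒰} (hu : u ∈ C1Tilde B F E 𝒰) :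
    ∃ γ, HasValuesGE (𝒰 := 𝒰) γ fun i j => expΛ (u i j) := by
  obtain ⟨γ, hγ⟩ := exists_cocycle_of_mul_mul_eq_one (P := GESheaf B F E) (U := 𝒰.U)
    (fun T (x : GE B F E T) hx => valGE_injective
      (eq_one_of_mul_mul_eq_one (valGE_sub_one_mem x) (congrArg valGE hx)))
    (fun i j => expGE (u i j) (hu.1 i j)) fun i j k => valGE_injective (hu.2 i j k)
  exact ⟨γ, fun i j => congrArg valGE (hγ i j)⟩

theorem exists_hasValuesDer2 {x : C1 B F E 𝒰} (hx : ∀ i j, x i j ∈ Der2 B F E (𝒰.U i ⊓ 𝒰.U j))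
    (hdx : dAdd x = 0) : ∃ δ, HasValuesDer2 (𝒰 := 𝒰) δ x := by
  obtain ⟨δ, hδ⟩ := exists_cocycle_of_mul_mul_eq_one (P := Der2Sheaf B F E) (U := 𝒰.U)
    (fun T (f : Multiplicative (Der2 B F E T)) hf => valDer2_injective (by
      have h : valDer2 f + valDer2 f + valDer2 f = 0 := congrArg valDer2 hf
      have h5 : (3 : ℂ) • valDer2 f = 0 := by
        rw [← h, show (3 : ℂ) = 1 + 1 + 1 by norm_num, add_smul, add_smul, one_smul]
      exact (smul_eq_zero_iff_right (by norm_num : (3 : ℂ) ≠ 0)).1 h5))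
    (fun i j => Multiplicative.ofAdd ⟨x i j, hx i j⟩)
    fun i j k => valDer2_injective (congrFun (congrFun (congrFun hdx i) j) k)
  exact ⟨δ, fun i j => congrArg valDer2 (hδ i j)⟩

theorem class_eq_of_hasValuesGE {γ γ' : PresheafOfGroups.OneCocycle (GESheaf B F E) 𝒰.U}
    {g : C1 B F E 𝒰} (h : HasValuesGE γ g) (h' : HasValuesGE γ' g) : γ.class = γ'.class :=
  class_eq_of_evP_eq fun i j => valGE_injective ((h i j).trans (h' i j).symm)

theorem class_eq_of_hasValuesDer2 {δ δ' : PresheafOfGroups.OneCocycle (Der2Sheaf B F E) 𝒰.U}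
    {x : C1 B F E 𝒰} (h : HasValuesDer2 δ x) (h' : HasValuesDer2 δ' x) : δ.class = δ'.class :=
  class_eq_of_evP_eq fun i j => valDer2_injective ((h i j).trans (h' i j).symm)

/-- Every cocycle of `G_E` is the exponential of a cochain of `Der^{(2)}(ΛE)`. -/
theorem exists_mem_C1Tilde (γ : PresheafOfGroups.OneCocycle (GESheaf B F E) 𝒰.U) :
    ∃ u ∈ C1Tilde B F E 𝒰, HasValuesGE γ fun i j => expΛ (u i j) := by
  let g : ∀ i j, GE B F E (𝒰.U i ⊓ 𝒰.U j) := fun i j => evP γ i j inf_le_left inf_le_right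
  have hg : ∀ i j, expΛ (logΛ (valGE (g i j))) = valGE (g i j) := fun i j =>
    expΛ_logΛ (valGE_sub_one_mem _)
  refine ⟨fun i j => logΛ (valGE (g i j)), ⟨fun i j => logΛ_valGE_mem _, fun i j k => ?_⟩,
    fun i j => (hg i j).symm⟩
  simp only [hg]
  -- The cocycle relation contracts `γ_ij γ_jk γ_ki` to `γ_ii = 1`.
  have hcoc : evP γ i j (inf_le_left.trans inf_le_left : 𝒰.U i ⊓ 𝒰.U j ⊓ 𝒰.U k ≤ _)
        (inf_le_left.trans inf_le_right) *
      evP γ j k (inf_le_left.trans inf_le_right) inf_le_right *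
      evP γ k i inf_le_right (inf_le_left.trans inf_le_left) = 1 := by
    rw [evP_trans, evP_trans]
    exact γ.ev_refl _ _ i _
  rw [← evP_res γ i j inf_le_left inf_le_left inf_le_right,
    ← evP_res γ j k (le_inf (inf_le_left.trans inf_le_right) inf_le_right) inf_le_left
      inf_le_right,
    ← evP_res γ k i (le_inf inf_le_right (inf_le_left.trans inf_le_left)) inf_le_left
      inf_le_right] at hcoc
  exact congrArg valGE hcoc

/-- A 0-cochain of `G_E` is `exp(v)` for its logarithm `v`, so cohomologous cocycles are those
related by the action of `C0Der` through `λ`. -/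
theorem isCohomologous_GE_iff {γ γ' : PresheafOfGroups.OneCocycle (GESheaf B F E) 𝒰.U}
    {u u' : C1 B F E 𝒰} (hu : u ∈ C1Tilde B F E 𝒰) (hu' : u' ∈ C1Tilde B F E 𝒰)
    (hγ : HasValuesGE γ fun i j => expΛ (u i j))
    (hγ' : HasValuesGE γ' fun i j => expΛ (u' i j)) :
    γ.IsCohomologous γ' ↔ ∃ v ∈ C0Der B F E 𝒰, lam v u = u' := by
  have hval : ∀ (v : C0 B F E 𝒰) (hv : v ∈ C0Der B F E 𝒰) (i j : 𝒰.ι),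
      expAct v u i j = expΛ (u' i j) ↔
      resP (GESheaf B F E) inf_le_left (expGE (v i) (hv i)) * evP γ i j inf_le_left inf_le_right =
        evP γ' i j inf_le_left inf_le_right *
          resP (GESheaf B F E) inf_le_right (expGE (v j) (hv j)) := by
    intro v hv i j
    have hj := resEnd_mem_EndFil (inf_le_right : 𝒰.U i ⊓ 𝒰.U j ≤ 𝒰.U j) (Der2_le_EndFil (hv j))
    have h1 : expAct v u i j = expΛ (u' i j) ↔
        expΛ (resEnd B inf_le_left (v i)) * expΛ (u i j) =
          expΛ (u' i j) * expΛ (resEnd B inf_le_right (v j)) := by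
      constructor
      · intro h
        rw [← h, expAct, mul_assoc, expΛ_neg_mul_expΛ hj, mul_one]
      · intro h
        rw [expAct, h, mul_assoc, expΛ_mul_expΛ_neg hj, mul_one]
    have e : valGE (evP γ i j inf_le_left inf_le_right) = expΛ (u i j) := hγ i j
    have e' : valGE (evP γ' i j inf_le_left inf_le_right) = expΛ (u' i j) := hγ' i j
    rw [h1, ← resEnd_expΛ, ← resEnd_expΛ, ← e, ← e']
    exact ⟨fun h => valGE_injective h, fun h => congrArg valGE h⟩
  constructor
  · intro h
    obtain ⟨α, hα⟩ := isCohomologous_iff.1 h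
    have hv : (fun i => logΛ (valGE (α i))) ∈ C0Der B F E 𝒰 := fun i => logΛ_valGE_mem (α i)
    refine ⟨_, hv, funext fun i => funext fun j => ?_⟩
    have h1 := (hval _ hv i j).2
      ((congrArg (fun x => resP (GESheaf B F E) inf_le_left x * _) (expGE_logΛ (α i))).trans
        ((hα i j _ inf_le_left inf_le_right).trans
          (congrArg (fun x => _ * resP (GESheaf B F E) inf_le_right x) (expGE_logΛ (α j)).symm)))
    rw [lam, h1, logΛ_expΛ (Der2_le_EndFil (hu'.1 i j))]
  · rintro ⟨v, hv, rfl⟩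
    exact isCohomologous_of_inf (fun i => expGE (v i) (hv i)) fun i j =>
      (hval v hv i j).1 (lam_apply_eq hv hu i j).2.symm

theorem isCohomologous_Der2_iff {δ δ' : PresheafOfGroups.OneCocycle (Der2Sheaf B F E) 𝒰.U}
    {x x' : C1 B F E 𝒰} (hδ : HasValuesDer2 δ x) (hδ' : HasValuesDer2 δ' x') :
    δ.IsCohomologous δ' ↔ ∃ v ∈ C0Der B F E 𝒰, ∀ i j,
      x' i j = x i j + (resEnd B inf_le_left (v i) - resEnd B inf_le_right (v j)) := by
  have hval : ∀ (α : ∀ i, (Der2Sheaf B F E).obj (Opposite.op (𝒰.U i))) (i j : 𝒰.ι),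
      x' i j = x i j + (resEnd B inf_le_left (valDer2 (α i)) -
        resEnd B inf_le_right (valDer2 (α j))) ↔
      resP (Der2Sheaf B F E) inf_le_left (α i) * evP δ i j inf_le_left inf_le_right =
        evP δ' i j inf_le_left inf_le_right * resP (Der2Sheaf B F E) inf_le_right (α j) := by
    intro α i j
    have h1 : x' i j = x i j + (resEnd B inf_le_left (valDer2 (α i)) -
        resEnd B inf_le_right (valDer2 (α j))) ↔
        resEnd B inf_le_left (valDer2 (α i)) + x i j =
          x' i j + resEnd B inf_le_right (valDer2 (α j)) := by
      rw [← add_sub_assoc, eq_sub_iff_add_eq, eq_comm, add_comm (x i j)]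
    rw [h1, ← hδ i j, ← hδ' i j]
    exact ⟨fun h => valDer2_injective h, fun h => congrArg valDer2 h⟩
  constructor
  · intro h
    obtain ⟨α, hα⟩ := isCohomologous_iff.1 h
    exact ⟨fun i => valDer2 (α i), fun i => (Multiplicative.toAdd (α i)).2, fun i j =>
      (hval α i j).2 (hα i j _ inf_le_left inf_le_right)⟩
  · rintro ⟨v, hv, h⟩
    exact isCohomologous_of_inf (fun i => Multiplicative.ofAdd ⟨v i, hv i⟩) fun i j =>
      (hval (fun i => Multiplicative.ofAdd ⟨v i, hv i⟩) i j).1 (h i j)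

/-! ### The graph of `σ_D` -/

/-- The graph of `σ_D`: the pairs `([exp(u)], [D(Id,0,u) + u])`. -/
def SigmaRel (D' : ℕ → C1 B F E 𝒰 → C1 B F E 𝒰)
    (c : PresheafOfGroups.H1 (GESheaf B F E) 𝒰.U)
    (d : PresheafOfGroups.H1 (Der2Sheaf B F E) 𝒰.U) : Prop :=
  ∃ u ∈ C1Tilde B F E 𝒰, ∃ γ δ, HasValuesGE γ (fun i j => expΛ (u i j)) ∧
    HasValuesDer2 δ (fun i j => Dsum D' u i j + u i j) ∧ c = γ.class ∧ d = δ.class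

/-- The graph of `σ_D` on `M`. -/
def CechSigmaRel (D' : ℕ → C1 B F E 𝒰 → C1 B F E 𝒰) (c : CechH1 (GESheaf B F E))
    (d : CechH1 (Der2Sheaf B F E)) : Prop :=
  ∃ c₀ d₀, SigmaRel D' c₀ d₀ ∧ c = toCechH1 _ 𝒰 c₀ ∧ d = toCechH1 _ 𝒰 d₀

section Graph

variable {D' : ℕ → C1 B F E 𝒰 → C1 B F E 𝒰}

theorem SigmaRel.total (hD : IsChoice D') (c : PresheafOfGroups.H1 (GESheaf B F E) 𝒰.U) :
    ∃ d, SigmaRel D' c d := by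
  induction c using Quot.ind with | mk γ => ?_
  obtain ⟨u, hu, hγ⟩ := exists_mem_C1Tilde γ
  obtain ⟨δ, hδ⟩ := exists_hasValuesDer2 (Dsum_add_mem hD hu) (dAdd_Dsum_add hD hu)
  exact ⟨δ.class, u, hu, γ, δ, hγ, hδ, rfl, rfl⟩

/-- The same 0-cochain `v` witnesses both equalities. One direction is `Dsum_lam_add`; the other
compares `u'` with `λ(v,u)`, which have the same image under `u ↦ D(Id,0,u) + u`, and uses the
injectivity of that map. -/
theorem SigmaRel.eq_iff (hD : IsChoice D') (hcomp : IsCompatible D')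
    {c c' : PresheafOfGroups.H1 (GESheaf B F E) 𝒰.U}
    {d d' : PresheafOfGroups.H1 (Der2Sheaf B F E) 𝒰.U}
    (h : SigmaRel D' c d) (h' : SigmaRel D' c' d') : c = c' ↔ d = d' := by
  obtain ⟨u, hu, γ, δ, hγ, hδ, rfl, rfl⟩ := h
  obtain ⟨u', hu', γ', δ', hγ', hδ', rfl, rfl⟩ := h'
  rw [PresheafOfGroups.OneCocycle.class_eq_iff, PresheafOfGroups.OneCocycle.class_eq_iff,
    isCohomologous_GE_iff hu hu' hγ hγ', isCohomologous_Der2_iff hδ hδ']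
  refine exists_congr fun v => and_congr_right fun hv => ⟨?_, fun h => ?_⟩
  · rintro rfl i j
    exact Dsum_lam_add hD hcomp hu hv i j
  · refine eq_of_Dsum_add_eq hD (lam_mem_C1Tilde hv hu) hu' fun i j => ?_
    rw [h i j, Dsum_lam_add hD hcomp hu hv i j]

/-- The class of a cocycle depends only on its components on pairwise intersections, so the
existential choice of `γ` and `δ` in `IsSigma` is immaterial. -/
theorem isSigma_iff (hD : IsChoice D')
    (σ : PresheafOfGroups.H1 (GESheaf B F E) 𝒰.U → PresheafOfGroups.H1 (Der2Sheaf B F E) 𝒰.U) :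
    IsSigma D' σ ↔ ∀ c d, SigmaRel D' c d → σ c = d := by
  constructor
  · rintro h c d ⟨u, hu, γ, δ, hγ, hδ, rfl, rfl⟩
    obtain ⟨γ', δ', hγ', hδ', h1⟩ := h u hu
    rw [class_eq_of_hasValuesGE hγ hγ', class_eq_of_hasValuesDer2 hδ hδ', h1]
  · intro h u hu
    obtain ⟨γ, hγ⟩ := exists_hasValuesGE hu
    obtain ⟨δ, hδ⟩ := exists_hasValuesDer2 (Dsum_add_mem hD hu) (dAdd_Dsum_add hD hu)
    exact ⟨γ, δ, hγ, hδ, h _ _ ⟨u, hu, γ, δ, hγ, hδ, rfl, rfl⟩⟩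

theorem isCechSigma_iff (hD : IsChoice D')
    (σ : CechH1 (GESheaf B F E) → CechH1 (Der2Sheaf B F E)) :
    IsCechSigma D' σ ↔ ∀ c d, CechSigmaRel D' c d → σ c = d := by
  constructor
  · rintro h c d ⟨_, _, ⟨u, hu, γ, δ, hγ, hδ, rfl, rfl⟩, rfl, rfl⟩
    obtain ⟨γ', δ', hγ', hδ', h1⟩ := h u hu
    rw [class_eq_of_hasValuesGE hγ hγ', class_eq_of_hasValuesDer2 hδ hδ', h1]
  · intro h u hu
    obtain ⟨γ, hγ⟩ := exists_hasValuesGE hu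
    obtain ⟨δ, hδ⟩ := exists_hasValuesDer2 (Dsum_add_mem hD hu) (dAdd_Dsum_add hD hu)
    exact ⟨γ, δ, hγ, hδ, h _ _ ⟨_, _, ⟨u, hu, γ, δ, hγ, hδ, rfl, rfl⟩, rfl, rfl⟩⟩

/-- Injectivity of `toCechH1` for both sheaves reduces this to the covering `𝒰`. -/
theorem CechSigmaRel.eq_iff (hD : IsChoice D') (hcomp : IsCompatible D')
    {c c' : CechH1 (GESheaf B F E)} {d d' : CechH1 (Der2Sheaf B F E)}
    (h : CechSigmaRel D' c d) (h' : CechSigmaRel D' c' d') : c = c' ↔ d = d' := by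
  obtain ⟨c₀, d₀, h, rfl, rfl⟩ := h
  obtain ⟨c₁, d₁, h', rfl, rfl⟩ := h'
  rw [((isGluing_GESheaf B F E).toCechH1_injective 𝒰).eq_iff,
    ((isGluing_Der2Sheaf B F E).toCechH1_injective 𝒰).eq_iff, h.eq_iff hD hcomp h']

theorem AutE.act_mem_C1Tilde (φ : AutE B F E) {u : C1 B F E 𝒰} (hu : u ∈ C1Tilde B F E 𝒰) :
    (fun i j => φ.act (u i j)) ∈ C1Tilde B F E 𝒰 := by
  refine ⟨fun i j => φ.act_mem_Der2 (hu.1 i j), fun i j k => ?_⟩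
  have h := congrArg (φ.actHom _) (hu.2 i j k)
  rw [map_one] at h
  simp only [dMul, map_mul, AutE.actHom_apply] at h
  simp only [dMul, ← AutE.act_expΛ]
  exact h

/-- Conjugation by `φ` is an algebra automorphism, so it commutes with the exponential; with the
equivariance of `D'` it carries the pair attached to `u` to the pair attached to `φ.u`. -/
theorem SigmaRel.act (heq : IsEquivariant D') (φ : AutE B F E)
    {c : PresheafOfGroups.H1 (GESheaf B F E) 𝒰.U}
    {d : PresheafOfGroups.H1 (Der2Sheaf B F E) 𝒰.U} (h : SigmaRel D' c d) :
    SigmaRel D' (mapH1 φ.onGE c) (mapH1 φ.onDer2 d) := by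
  obtain ⟨u, hu, γ, δ, hγ, hδ, rfl, rfl⟩ := h
  refine ⟨_, φ.act_mem_C1Tilde hu, mapCocycle φ.onGE γ, mapCocycle φ.onDer2 δ, fun i j => ?_,
    fun i j => ?_, rfl, rfl⟩
  · change φ.act (valGE (γ.ev i j _ _)) = expΛ (φ.act (u i j))
    rw [← AutE.act_expΛ]
    exact congrArg φ.act (hγ i j)
  · change φ.act (valDer2 (δ.ev i j _ _)) =
      Dsum D' (fun i j => φ.act (u i j)) i j + φ.act (u i j)
    have h1 : Dsum D' (fun i j => φ.act (u i j)) i j = φ.act (Dsum D' u i j) := by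
      simp only [Dsum, ← AutE.actHom_apply, map_sum]
      refine Finset.sum_congr rfl fun q hq => ?_
      exact congrFun (congrFun (heq φ q (Finset.mem_Icc.1 hq).1 u hu) i) j
    rw [h1, ← AutE.act_add]
    exact congrArg φ.act (hδ i j)

theorem CechSigmaRel.act (heq : IsEquivariant D') (φ : AutE B F E)
    {c : CechH1 (GESheaf B F E)} {d : CechH1 (Der2Sheaf B F E)} (h : CechSigmaRel D' c d) :
    CechSigmaRel D' (mapCechH1 φ.onGE c) (mapCechH1 φ.onDer2 d) := by
  obtain ⟨c₀, d₀, h, rfl, rfl⟩ := h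
  refine ⟨_, _, h.act heq φ, ?_, ?_⟩
  · induction c₀ using Quot.ind with | mk γ => rfl
  · induction d₀ using Quot.ind with | mk δ => rfl

end Graph

end Main

end HolSuper

theorem mainTheorem1
    {B : Type t} [NormedAddCommGroup B] [NormedSpace ℂ B] [FiniteDimensional ℂ B]
    {M : Type u} [TopologicalSpace M] [ChartedSpace B M] [IsManifold 𝓘(ℂ, B) ω M]
    {F : Type v} [NormedAddCommGroup F] [NormedSpace ℂ F] [FiniteDimensional ℂ F]
    {E : M → Type w} [∀ x, AddCommGroup (E x)] [∀ x, Module ℂ (E x)]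
    [∀ x, TopologicalSpace (E x)] [TopologicalSpace (Bundle.TotalSpace F E)]
    [FiberBundle F E] [VectorBundle ℂ F E] [ContMDiffVectorBundle ω F E 𝓘(ℂ, B)]
    (𝒰 : HolSuper.OpenCover M) (D' : ℕ → HolSuper.C1 B F E 𝒰 → HolSuper.C1 B F E 𝒰)
    (hD : HolSuper.IsChoice D') (hcomp : HolSuper.IsCompatible D') :
    ((∃! σ, HolSuper.IsSigma D' σ) ∧
      ∀ σ, HolSuper.IsSigma D' σ → Function.Injective σ ∧
        (HolSuper.IsEquivariant D' → ∀ (φ : HolSuper.AutE B F E) c,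
          σ (HolSuper.mapH1 φ.onGE c) = HolSuper.mapH1 φ.onDer2 (σ c))) ∧
    (Function.Surjective (HolSuper.toCechH1 (HolSuper.GESheaf B F E) 𝒰) →
      (∃! σ, HolSuper.IsCechSigma D' σ) ∧
      ∀ σ, HolSuper.IsCechSigma D' σ → Function.Injective σ ∧
        (HolSuper.IsEquivariant D' → ∀ (φ : HolSuper.AutE B F E) c,
          σ (HolSuper.mapCechH1 φ.onGE c) = HolSuper.mapCechH1 φ.onDer2 (σ c))) := by
  refine ⟨?_, fun hsurj => ?_⟩
  · obtain ⟨h1, h2⟩ := HolSuper.existsUnique_map_of_rel (HolSuper.SigmaRel D')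
      (HolSuper.SigmaRel.total hD) (fun _ _ _ _ h h' => h.eq_iff hD hcomp h') _
      (HolSuper.isSigma_iff hD)
    refine ⟨h1, fun σ hσ => ⟨h2 σ hσ, fun heq φ c => ?_⟩⟩
    have hσ' := (HolSuper.isSigma_iff hD σ).1 hσ
    obtain ⟨d, hd⟩ := HolSuper.SigmaRel.total hD c
    rw [hσ' _ _ hd, hσ' _ _ (hd.act heq φ)]
  -- This is where surjectivity of `H^1(𝒰, G_E) → H^1(M, G_E)` enters: every class on `M` comes from
  -- `𝒰`, so the graph on `M` is total.
  · have htot : ∀ c, ∃ d, HolSuper.CechSigmaRel D' c d := fun c => by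
      obtain ⟨c₀, rfl⟩ := hsurj c
      obtain ⟨d, hd⟩ := HolSuper.SigmaRel.total hD c₀
      exact ⟨_, c₀, d, hd, rfl, rfl⟩
    obtain ⟨h1, h2⟩ := HolSuper.existsUnique_map_of_rel (HolSuper.CechSigmaRel D') htot
      (fun _ _ _ _ h h' => h.eq_iff hD hcomp h') _ (HolSuper.isCechSigma_iff hD)
    refine ⟨h1, fun σ hσ => ⟨h2 σ hσ, fun heq φ c => ?_⟩⟩
    have hσ' := (HolSuper.isCechSigma_iff hD σ).1 hσ
    obtain ⟨d, hd⟩ := htot c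
    rw [hσ' _ _ hd, hσ' _ _ (hd.act heq φ)]
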